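/- **Setting.** Let $R_1<R_2$ and $T>0$. Let $\tilde R$ be the image of $[R_1,R_2]^2$ under the rotation $(a,b)\mapsto\big(\tfrac{a-b}{\sqrt2},\tfrac{a+b}{\sqrt2}\big)$. For $(s,t)$ with $s+t\ge 0$ let $\tilde C(s,t)=\{(u,v): u\le s,\ v\le t,\ u+v\ge 0\}$ be the rotated light cone (the triangle with corners $(s,t)$, $(s,-s)$, $(-t,t)$). Let $D_T$ be the set $\{(s,t)\in\tilde R:\ -s\le t\le -s+\sqrt2\,T\}$ together with the cones $\tilde C(s,t)$ of all its points. For a rectangle $Q=[a,b]\times[c,d]$ put $\Delta_Q f=f(a,c)-f(a,d)-f(b,c)+f(b,d)$. For $\rho,\hat\rho\in(0,1)$ let $$\|f\|_{\rho,\hat\rho}=\sup_{[a,b]\times[c,d]\subset D_T,\ a<b,\ c<d}\frac{|\Delta_{[a,b]\times[c,d]}f|}{(b-a)^{\rho}(d-c)^{\hat\rho}},\qquad \|f\|=\|f\|_{\rho,\hat\rho}+\|f\|_{1:\rho}+\|f\|_{2:\hat\rho},$$ where $\|f\|_{1:\rho}$ and $\|f\|_{2:\hat\rho}$ are the Hölder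 semi-norms on $D_T$ in the first variable (uniformly in the second) and in the second variable (uniformly in the first). Let $\mathcal C^{\rho,\hat\rho}(D_T)$ and $\mathcal H^{\rho,\hat\rho}(D_T)$ be the spaces of continuous $f:D_T\to\mathbb R$ with $\|f\|_{\rho,\hat\rho}<\infty$, respectively $\|f\|<\infty$. *Hypothesis (L)* on $\sigma:\mathbb R\to\mathbb R$: $\sigma$ is of class $C^3$, and for all $\rho,\hat\rho\in(0,1)$ one has $\sigma(y)\in\mathcal H^{\rho,\hat\rho}(D_T)$ whenever $y\in\mathcal H^{\rho,\hat\rho}(D_T)$, and there are constants $C,K>0$ such that for all $y,y_1,y_2\in\mathcal H^{\rho,\hat\rho}(D_T)$ $$\|\sigma(y)\|\le C\|y\|(1+\|y\|),$$ $$\|\sigma(y_1)-\sigma(y_2)\|\le K\big(\|y_1-y_2\|_\infty+\|y_1-y_2\|\big)\Big(1+\|y_1\|+\|y_2\|+\|y_1-y_2\|+\big(\|y_1\|+\|y_1-y_2\|\big)^2\Big).$$ The Young integral $\iint_R f\,dx$ over a rectangle $R=[s_1,s_2]\times[t_1,t_2]$ is the limit of the sums $\sum_{i,j}f(a_i,b_j)\,\Delta_{[a_i,a_{i+1}]\times[b_j,b_{j+1}]}x$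 over the grids $s_1=a_0\le\dots\le a_n=s_2$, $t_1=b_0\le\dots\le b_m=t_2$ as the mesh tends to $0$. Given $\gamma,\hat\gamma$, the Young integral over $\tilde C(s,t)$ is $\sum_n\iint_{R_n}f\,dx$, where $(R_n)_{n}$ is any sequence of rectangles $R_n=[s_1^n,s_2^n]\times[t_1^n,t_2^n]\subset\tilde C(s,t)$ with disjoint interiors whose union contains the interior of $\tilde C(s,t)$ and with $\sum_n (s_2^n-s_1^n)^{\gamma}(t_2^n-t_1^n)^{\hat\gamma}<\infty$; that the integral equals $I$ means that such sequences exist and that for each of them all the integrals over the $R_n$ exist and their series converges to $I$. **Theorem.** Let $x\in\mathcal C^{\gamma,\hat\gamma}(D_T)$ with $\gamma,\hat\gamma\in(\tfrac12,1)$, and let $\sigma$ be bounded and satisfy Hypothesis (L). Then there is a function $y:D_T\to\mathbb R$ that solves the rotated wave equation $$y(s,t)=\iint_{\tilde C(s,t)}\sigma(y(u,v))\,x(du,dv)\qquad\text{for all }(s,t)\in D_T,$$ satisfies the initial conditions $$y(s,-s)=0,\qquad \frac{\partial y}{\partial s}(s,-s)=-\frac{\partial y}{\partial t}(s,-s)\qquad\text{for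 all }(s,-s)\in D_T$$ (the partial derivatives exist, taken within $D_T$), and is such that for all $\kappa\in(1-\gamma,\gamma)$ and $\hat\kappa\in(1-\hat\gamma,\hat\gamma)$ it belongs to $\mathcal H^{\kappa,\hat\kappa}(D_T)$ and is the only solution of the equation in $\mathcal H^{\kappa,\hat\kappa}(D_T)$. -/

import Mathlib

open Set
open scoped ENNReal

noncomputable section

namespace YoungWave

/-- The rotation of the plane by 45 degrees. -/
def rotation (p : ℝ × ℝ) : ℝ × ℝ := ((p.1 - p.2) / √2, (p.1 + p.2) / √2)

/-- The image of the square `[R₁, R₂]²` under the rotation. -/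
def rotatedSquare (R₁ R₂ : ℝ) : Set (ℝ × ℝ) := rotation '' (Icc R₁ R₂ ×ˢ Icc R₁ R₂)

/-- The part of the rotated square in the band `-s ≤ t ≤ -s + √2 T`. -/
def band (R₁ R₂ T : ℝ) : Set (ℝ × ℝ) :=
  {p | p ∈ rotatedSquare R₁ R₂ ∧ -p.1 ≤ p.2 ∧ p.2 ≤ -p.1 + √2 * T}

/-- The closed rotated light cone: the triangle with corners `(s, t)`, `(s, -s)`, `(-t, t)`
(for `p = (s, t)` with `0 ≤ s + t`). -/
def closedCone (p : ℝ × ℝ) : Set (ℝ × ℝ) := {q | q.1 ≤ p.1 ∧ q.2 ≤ p.2 ∧ 0 ≤ q.1 + q.2}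

/-- The open rotated light cone with vertex `p`. -/
def openCone (p : ℝ × ℝ) : Set (ℝ × ℝ) := {q | q.1 < p.1 ∧ q.2 < p.2 ∧ 0 < q.1 + q.2}

/-- The domain of the rotated equation: the band together with the light cones of all its points,
over which the equation integrates. It contains the band and the light cone of each
of its own points. -/
def domain (R₁ R₂ T : ℝ) : Set (ℝ × ℝ) := ⋃ p ∈ band R₁ R₂ T, closedCone p

/-- The rectangular increment of `f` on `[a, b] × [c, d]`. -/
def rectIncr (f : ℝ × ℝ → ℝ) (a b c d : ℝ) : ℝ := f (a, c) - f (a, d) - f (b, c) + f (b, d)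

/-- The Hölder semi-norm on rectangles contained in `D`. -/
def rectNorm (D : Set (ℝ × ℝ)) (γ γ' : ℝ) (f : ℝ × ℝ → ℝ) : ℝ≥0∞ :=
  ⨆ (a : ℝ) (b : ℝ) (c : ℝ) (d : ℝ) (_ : a < b) (_ : c < d) (_ : Icc a b ×ˢ Icc c d ⊆ D),
    ENNReal.ofReal (|rectIncr f a b c d| / ((b - a) ^ γ * (d - c) ^ γ'))

/-- The Hölder semi-norm in the first variable, uniformly in the second one. -/
def holderFst (D : Set (ℝ × ℝ)) (α : ℝ) (f : ℝ × ℝ → ℝ) : ℝ≥0∞ :=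
  ⨆ (a : ℝ) (b : ℝ) (t : ℝ) (_ : a < b) (_ : (a, t) ∈ D) (_ : (b, t) ∈ D),
    ENNReal.ofReal (|f (b, t) - f (a, t)| / (b - a) ^ α)

/-- The Hölder semi-norm in the second variable, uniformly in the first one. -/
def holderSnd (D : Set (ℝ × ℝ)) (β : ℝ) (f : ℝ × ℝ → ℝ) : ℝ≥0∞ :=
  ⨆ (s : ℝ) (c : ℝ) (d : ℝ) (_ : c < d) (_ : (s, c) ∈ D) (_ : (s, d) ∈ D),
    ENNReal.ofReal (|f (s, d) - f (s, c)| / (d - c) ^ β)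

/-- The supremum norm on `D`. -/
def supNorm (D : Set (ℝ × ℝ)) (f : ℝ × ℝ → ℝ) : ℝ≥0∞ := ⨆ p ∈ D, ENNReal.ofReal |f p|

/-- The semi-norm of the space of solutions. -/
def hNorm (D : Set (ℝ × ℝ)) (ρ ρ' : ℝ) (f : ℝ × ℝ → ℝ) : ℝ≥0∞ :=
  rectNorm D ρ ρ' f + holderFst D ρ f + holderSnd D ρ' f

/-- Continuous functions on `D` with finite Hölder semi-norm on rectangles. -/
def MemC (D : Set (ℝ × ℝ)) (γ γ' : ℝ) (f : ℝ × ℝ → ℝ) : Prop :=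
  ContinuousOn f D ∧ rectNorm D γ γ' f < ∞

/-- Continuous functions on `D`, Hölder continuous on rectangles and in each variable. -/
def MemH (D : Set (ℝ × ℝ)) (ρ ρ' : ℝ) (f : ℝ × ℝ → ℝ) : Prop :=
  ContinuousOn f D ∧ hNorm D ρ ρ' f < ∞

/-- The coefficient `σ` is smooth (three times continuously differentiable), acts on each Hölder
space by composition, and does so with quadratic growth and in a locally Lipschitz way. The
constants may depend on the space. -/
structure HypL (D : Set (ℝ × ℝ)) (σ : ℝ → ℝ) : Prop where
  smooth : ContDiff ℝ 3 σ
  preserves : ∀ ρ ∈ Ioo (0 : ℝ) 1, ∀ ρ' ∈ Ioo (0 : ℝ) 1, ∀ y : ℝ × ℝ → ℝ,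
    MemH D ρ ρ' y → MemH D ρ ρ' (σ ∘ y)
  growth : ∀ ρ ∈ Ioo (0 : ℝ) 1, ∀ ρ' ∈ Ioo (0 : ℝ) 1, ∃ C : ℝ, 0 < C ∧
    ∀ y : ℝ × ℝ → ℝ, MemH D ρ ρ' y →
      hNorm D ρ ρ' (σ ∘ y) ≤ ENNReal.ofReal C * hNorm D ρ ρ' y * (1 + hNorm D ρ ρ' y)
  lipschitz : ∀ ρ ∈ Ioo (0 : ℝ) 1, ∀ ρ' ∈ Ioo (0 : ℝ) 1, ∃ K : ℝ, 0 < K ∧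
    ∀ y₁ y₂ : ℝ × ℝ → ℝ, MemH D ρ ρ' y₁ → MemH D ρ ρ' y₂ →
      hNorm D ρ ρ' (σ ∘ y₁ - σ ∘ y₂) ≤
        ENNReal.ofReal K * (supNorm D (y₁ - y₂) + hNorm D ρ ρ' (y₁ - y₂)) *
          (1 + hNorm D ρ ρ' y₁ + hNorm D ρ ρ' y₂ + hNorm D ρ ρ' (y₁ - y₂) +
            (hNorm D ρ ρ' y₁ + hNorm D ρ ρ' (y₁ - y₂)) ^ 2)

/-- `l = a 0 ≤ a 1 ≤ … ≤ a n = r` is a partition of `[l, r]` with mesh less than `δ`. -/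
def IsPartition (a : ℕ → ℝ) (n : ℕ) (l r δ : ℝ) : Prop :=
  a 0 = l ∧ a n = r ∧ ∀ i < n, a i ≤ a (i + 1) ∧ a (i + 1) - a i < δ

/-- The Riemann sum of `f` against the rectangular increments of `x` on a grid. -/
def riemannSum (f x : ℝ × ℝ → ℝ) (a : ℕ → ℝ) (n : ℕ) (b : ℕ → ℝ) (m : ℕ) : ℝ :=
  ∑ i ∈ Finset.range n, ∑ j ∈ Finset.range m,
    f (a i, b j) * rectIncr x (a i) (a (i + 1)) (b j) (b (j + 1))

/-- `z` is the Young integral of `f` against `x` over `[s₁, s₂] × [t₁, t₂]`: the limit of the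
Riemann sums as the mesh of the grid tends to zero. -/
def HasYoungIntegral (f x : ℝ × ℝ → ℝ) (s₁ s₂ t₁ t₂ z : ℝ) : Prop :=
  ∀ ε > 0, ∃ δ > 0, ∀ (a b : ℕ → ℝ) (n m : ℕ), IsPartition a n s₁ s₂ δ → IsPartition b m t₁ t₂ δ →
    |riemannSum f x a n b m - z| < ε

/-- The rectangles `[s₁ n, s₂ n] × [t₁ n, t₂ n]` do not overlap, fill the light cone with
vertex `p` (no condition is imposed on points of the boundary of the cone), and the
sum of their Hölder sizes is finite. -/
structure IsConeFamily (γ γ' : ℝ) (p : ℝ × ℝ) (s₁ s₂ t₁ t₂ : ℕ → ℝ) : Prop where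
  le_fst : ∀ n, s₁ n ≤ s₂ n
  le_snd : ∀ n, t₁ n ≤ t₂ n
  disjoint : Pairwise fun n m =>
    Disjoint (Ioo (s₁ n) (s₂ n) ×ˢ Ioo (t₁ n) (t₂ n)) (Ioo (s₁ m) (s₂ m) ×ˢ Ioo (t₁ m) (t₂ m))
  covers : openCone p ⊆ ⋃ n, Icc (s₁ n) (s₂ n) ×ˢ Icc (t₁ n) (t₂ n)
  subset : ⋃ n, Icc (s₁ n) (s₂ n) ×ˢ Icc (t₁ n) (t₂ n) ⊆ closedCone p
  summable : Summable fun n => (s₂ n - s₁ n) ^ γ * (t₂ n - t₁ n) ^ γ'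

/-- `I` is the Young integral of `f` against `x` over the light cone with vertex `p`: there are
families of rectangles as above, and for each of them the Young integrals over the rectangles
exist and sum up to `I`. -/
def HasConeIntegral (γ γ' : ℝ) (f x : ℝ × ℝ → ℝ) (p : ℝ × ℝ) (I : ℝ) : Prop :=
  (∃ s₁ s₂ t₁ t₂ : ℕ → ℝ, IsConeFamily γ γ' p s₁ s₂ t₁ t₂) ∧
  ∀ s₁ s₂ t₁ t₂ : ℕ → ℝ, IsConeFamily γ γ' p s₁ s₂ t₁ t₂ →
    ∃ z : ℕ → ℝ, (∀ n, HasYoungIntegral f x (s₁ n) (s₂ n) (t₁ n) (t₂ n) (z n)) ∧ HasSum z I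

/-- `y` solves the rotated wave equation on `D`. -/
def IsSolution (D : Set (ℝ × ℝ)) (γ γ' : ℝ) (σ : ℝ → ℝ) (x y : ℝ × ℝ → ℝ) : Prop :=
  ∀ p ∈ D, HasConeIntegral γ γ' (σ ∘ y) x p (y p)

/-- The initial conditions `y(s, -s) = 0` and `∂y/∂s (s, -s) = - ∂y/∂t (s, -s)`; the partial
derivatives exist as derivatives within `D`. -/
def InitialConditions (D : Set (ℝ × ℝ)) (y : ℝ × ℝ → ℝ) : Prop :=
  ∀ s : ℝ, (s, -s) ∈ D → y (s, -s) = 0 ∧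
    ∃ d : ℝ, HasDerivWithinAt (fun u => y (u, -s)) d {u | (u, -s) ∈ D} s ∧
      HasDerivWithinAt (fun v => y (s, v)) (-d) {v | (s, v) ∈ D} (-s)

end YoungWave

end

open Set
open scoped ENNReal

noncomputable section

namespace YoungWave

/-! ### The sewing lemma for cocycles -/

/-! Write `Y (w, -u)` for the integral of `f dx` over the cone with vertex `(w, -u)`, the triangle
whose diagonal side runs from `(u, -u)` to `(w, -w)`. For `u ≤ v ≤ w` this triangle consists of the
triangles over `[u, v]` and over `[v, w]` and of the rectangle `[v, w] × [-v, -u]`. Let `h u v w` be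
the Young integral over that rectangle. It is of order `γ + γ' > 1` in `w - u`, and `Y` has to solve
`Y (w, -u) = Y (v, -u) + Y (w, -v) + h u v w`. A sewing lemma for cocycles of three points
(`exists_sewing`) solves this equation, so `f dx` has a primitive that decays at the antidiagonal to
the order `γ + γ'` (`exists_primitive`); `abs_le_of_coboundary` then turns bounds for `h` into
bounds for `Y`. The rectangle integrals themselves come from sewing in one variable after the other
(`exists_young2`).

The cone integral refers to arbitrary families of rectangles, so the primitive has to be countably
additive (`hasSum_rectIncr_cone`). Subtracting from `Y` its increments over the parts of the
rectangles below and to the left of a point leaves a continuous function `W` that has no rectangular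
increments near any point off countably many lines. Baire's theorem removes the lines
(`flat_of_flat_off_lines`). Hence `W` at the vertex is a sum over `N` small triangles along the
antidiagonal, and this sum tends to zero. The equation thus says that `y` is a primitive of `σ ∘ y`
(`IsPrimitive.hasConeIntegral`, `IsSolution.isPrimitive`).

The fixed point is found on the whole domain at once. Increments are measured at scales below `h`
and weighted by `exp ((u + v) / h)`. Cutting a strip into pieces of length `h` produces a geometric
series of weights, so taking primitives gains `h ^ (γ + γ')` with a constant independent of the
number of pieces, and a small `h` makes the map halve distances (`CtrlDom.contraction`).

A set preserved by the map exists because Hypothesis (L) is strong: its growth bound, tested at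
exponents `1 / 2` on sums of a constant and two square roots, is uniform in the constant and forces
`σ'` and `σ''` to be bounded (`HypL.exists_regFun`). Increments of `σ ∘ y` are then controlled
linearly, and Picard iteration converges (`exists_isPrimitive_comp_self`). The solution inherits the
exponents `γ, γ'` of the integrator, hence lies in all the smaller spaces; uniqueness is the same
halving applied to two solutions (`eqOn_of_isPrimitive`). The decay of order `γ + γ' > 1` gives the
initial conditions, with both partial derivatives zero. -/

/-- The constant of the sewing lemma. -/
def sewConst (θ : ℝ) : ℝ := 2 / (1 - 2 ^ (1 - θ))

lemma two_rpow_one_sub_lt {θ : ℝ} (hθ : 1 < θ) : (2 : ℝ) ^ (1 - θ) < 1 :=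
  Real.rpow_lt_one_of_one_lt_of_neg (by norm_num) (by linarith)

lemma sewConst_pos {θ : ℝ} (hθ : 1 < θ) : 0 < sewConst θ :=
  div_pos two_pos (by linarith [two_rpow_one_sub_lt hθ])

/-- A function of ordered triples in `[a, b]` that satisfies the cocycle relation and is of
order `θ`. -/
structure IsCocycle (h : ℝ → ℝ → ℝ → ℝ) (a b K θ : ℝ) : Prop where
  coc : ∀ u v w z, a ≤ u → u ≤ v → v ≤ w → w ≤ z → z ≤ b →
    h u v w + h u w z = h u v z + h v w z
  left : ∀ u w, a ≤ u → u ≤ w → w ≤ b → h u u w = 0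
  right : ∀ u w, a ≤ u → u ≤ w → w ≤ b → h u w w = 0
  bound : ∀ u v w, a ≤ u → u ≤ v → v ≤ w → w ≤ b → |h u v w| ≤ K * (w - u) ^ θ

lemma IsCocycle.mono {h : ℝ → ℝ → ℝ → ℝ} {a b a' b' K θ : ℝ} (hc : IsCocycle h a b K θ)
    (ha : a ≤ a') (hb : b' ≤ b) : IsCocycle h a' b' K θ where
  coc u v w z h1 h2 h3 h4 h5 := hc.coc u v w z (ha.trans h1) h2 h3 h4 (h5.trans hb)
  left u w h1 h2 h3 := hc.left u w (ha.trans h1) h2 (h3.trans hb)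
  right u w h1 h2 h3 := hc.right u w (ha.trans h1) h2 (h3.trans hb)
  bound u v w h1 h2 h3 h4 := hc.bound u v w (ha.trans h1) h2 h3 (h4.trans hb)

/-- The sum of a cocycle along the points `u i ≤ … ≤ u j`. -/
def stair (h : ℝ → ℝ → ℝ → ℝ) (u : ℕ → ℝ) (i j : ℕ) : ℝ :=
  ∑ k ∈ Finset.Ico i j, h (u i) (u k) (u (k + 1))

lemma stair_self (h : ℝ → ℝ → ℝ → ℝ) (u : ℕ → ℝ) (i : ℕ) : stair h u i i = 0 := by
  simp [stair]

lemma stair_succ (h : ℝ → ℝ → ℝ → ℝ) (u : ℕ → ℝ) {i j : ℕ} (hij : i ≤ j) :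
    stair h u i (j + 1) = stair h u i j + h (u i) (u j) (u (j + 1)) :=
  Finset.sum_Ico_succ_top hij _

/-- The sum is a fan with base point `u i`. Past `m`, the cocycle relation exchanges each term of
the fan for one based at `u m`, and the corrections telescope to the last summand. -/
lemma stair_split {h : ℝ → ℝ → ℝ → ℝ} {a b K θ : ℝ} (hc : IsCocycle h a b K θ) {u : ℕ → ℝ}
    (hu : Monotone u) (hab : ∀ k, u k ∈ Icc a b) {i m j : ℕ} (him : i ≤ m) (hmj : m ≤ j) :
    stair h u i j = stair h u i m + stair h u m j + h (u i) (u m) (u j) := by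
  induction j, hmj using Nat.le_induction with
  | base => rw [stair_self, hc.right _ _ (hab i).1 (hu him) (hab m).2]; ring
  | succ j hmj ih =>
    rw [stair_succ h u (him.trans hmj), stair_succ h u hmj, ih]
    linarith [hc.coc (u i) (u m) (u j) (u (j + 1)) (hab i).1 (hu him) (hu hmj)
      (hu (Nat.le_succ j)) (hab _).2]

lemma stair_one {h : ℝ → ℝ → ℝ → ℝ} {a b K θ : ℝ} (hc : IsCocycle h a b K θ) {u : ℕ → ℝ}
    (hu : Monotone u) (hab : ∀ k, u k ∈ Icc a b) (i : ℕ) : stair h u i (i + 1) = 0 := by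
  rw [stair_succ h u le_rfl, stair_self, hc.left _ _ (hab i).1 (hu (Nat.le_succ i)) (hab _).2,
    add_zero]

lemma exists_crossing {u : ℕ → ℝ} {i j : ℕ} (hij : i < j) {r : ℝ} (hi : u i ≤ r) (hj : r ≤ u j) :
    ∃ m, i ≤ m ∧ m < j ∧ u m ≤ r ∧ r ≤ u (m + 1) := by
  induction j, hij using Nat.le_induction with
  | base => exact ⟨i, le_rfl, Nat.lt_succ_self i, hi, hj⟩
  | succ j hij ih =>
    by_cases h : r ≤ u j
    · obtain ⟨m, h1, h2, h3⟩ := ih h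
      exact ⟨m, h1, h2.trans (Nat.lt_succ_self j), h3⟩
    · exact ⟨j, (Nat.le_succ i).trans hij, Nat.lt_succ_self j, (not_le.1 h).le, hj⟩

/-- Cut at the step that crosses the midpoint of `[u i, u j]`. The pieces on either side have at
most half the length, and two terms of size `K * (u j - u i) ^ θ` appear. So the constant has to
satisfy `C = 2 ^ (1 - θ) * C + 2`, the equation solved by `sewConst θ`. The number of points does
not enter. -/
theorem abs_stair_le {h : ℝ → ℝ → ℝ → ℝ} {a b K θ : ℝ} (hθ : 1 < θ) (hK : 0 ≤ K)
    (hc : IsCocycle h a b K θ) {u : ℕ → ℝ} (hu : Monotone u) (hab : ∀ k, u k ∈ Icc a b)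
    {i j : ℕ} (hij : i ≤ j) : |stair h u i j| ≤ sewConst θ * K * (u j - u i) ^ θ := by
  obtain ⟨n, hn⟩ : ∃ n, j - i = n := ⟨_, rfl⟩
  induction n using Nat.strong_induction_on generalizing i j with
  | _ n ih =>
  have hC := sewConst_pos hθ
  have hL : 0 ≤ u j - u i := sub_nonneg.2 (hu hij)
  rcases hij.eq_or_lt with rfl | hlt
  · rw [stair_self, abs_zero]
    positivity
  obtain ⟨m, him, hmj, h1, h2⟩ := exists_crossing (u := u) hlt
    (r := (u i + u j) / 2) (by linarith) (by linarith)
  have e1 := ih (m - i) (by omega) him rfl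
  have e2 := ih (j - (m + 1)) (by omega) (show m + 1 ≤ j from hmj) rfl
  have hm1 : u m ≤ u (m + 1) := hu (Nat.le_succ m)
  have hm2 : u i ≤ u m := hu him
  have hm3 : u (m + 1) ≤ u j := hu hmj
  have b1 := hc.bound (u i) (u m) (u j) (hab i).1 hm2 (hm1.trans hm3) (hab j).2
  have b2 := hc.bound (u m) (u (m + 1)) (u j) (hab m).1 hm1 hm3 (hab j).2
  have b2' : K * (u j - u m) ^ θ ≤ K * (u j - u i) ^ θ := by
    have := sub_nonneg.2 (hm1.trans hm3)
    gcongr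
  have key : ∀ r, 0 ≤ r → r ≤ (u j - u i) / 2 →
      sewConst θ * K * r ^ θ ≤ sewConst θ * K * ((u j - u i) ^ θ / 2 ^ θ) := by
    intro r hr hr'
    rw [← Real.div_rpow hL (by norm_num)]
    gcongr
  have k1 := key (u m - u i) (by linarith) (by linarith)
  have k2 := key (u j - u (m + 1)) (by linarith) (by linarith)
  have hid : 2 * (sewConst θ * K * ((u j - u i) ^ θ / 2 ^ θ)) + 2 * (K * (u j - u i) ^ θ) =
      sewConst θ * K * (u j - u i) ^ θ := by
    have h2 : (2 : ℝ) ^ (1 - θ) = 2 / 2 ^ θ := by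
      rw [Real.rpow_sub two_pos, Real.rpow_one]
    have h3 : sewConst θ * (1 - 2 / 2 ^ θ) = 2 := by
      rw [← h2, sewConst, div_mul_cancel₀]
      linarith [two_rpow_one_sub_lt hθ]
    have h4 : 2 * (sewConst θ * K * ((u j - u i) ^ θ / 2 ^ θ)) =
      K * (u j - u i) ^ θ * (sewConst θ * (2 / 2 ^ θ)) := by ring
    have h5 : sewConst θ * (2 / 2 ^ θ) = sewConst θ - 2 := by linarith
    rw [h4, h5]; ring
  rw [stair_split hc hu hab him hmj.le, stair_split hc hu hab (Nat.le_succ m) hmj,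
    stair_one hc hu hab]
  calc _ ≤ |stair h u i m| + |stair h u (m + 1) j| + |h (u m) (u (m + 1)) (u j)| +
        |h (u i) (u m) (u j)| := by
        refine (abs_add_le _ _).trans (add_le_add ?_ le_rfl)
        rw [zero_add, ← add_assoc]
        refine (abs_add_le _ _).trans (add_le_add (abs_add_le _ _) le_rfl)
    _ ≤ _ := by linarith

/-- The point `k` of the uniform grid of mesh `1 / (n + 1)` starting at `-R`, clamped to `[u, w]`. -/
def clampGrid (R : ℝ) (n : ℕ) (u w : ℝ) (k : ℕ) : ℝ := max u (min w (-R + k / (n + 1)))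

lemma clampGrid_monotone (R : ℝ) (n : ℕ) (u w : ℝ) : Monotone (clampGrid R n u w) := by
  intro k l hkl
  unfold clampGrid
  gcongr

lemma clampGrid_mem (R : ℝ) (n : ℕ) {u w : ℝ} (huw : u ≤ w) (k : ℕ) :
    clampGrid R n u w k ∈ Icc u w :=
  ⟨le_max_left _ _, max_le huw (min_le_left _ _)⟩

lemma clampGrid_zero {R : ℝ} (n : ℕ) {u w : ℝ} (hu : -R ≤ u) : clampGrid R n u w 0 = u := by
  simp only [clampGrid, Nat.cast_zero, zero_div, add_zero]
  exact max_eq_left ((min_le_right _ _).trans hu)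

/-- The index of a grid point beyond `R`. -/
def gridSize (R : ℝ) (n : ℕ) : ℕ := (n + 1) * (⌈2 * R⌉₊ + 1)

lemma le_grid_gridSize (R : ℝ) (n : ℕ) : R < -R + (gridSize R n : ℝ) / (n + 1) := by
  have h := Nat.le_ceil (2 * R)
  have : (gridSize R n : ℝ) / (n + 1) = (⌈2 * R⌉₊ : ℝ) + 1 := by
    unfold gridSize; push_cast; field_simp
  rw [this]; linarith

lemma clampGrid_gridSize {R : ℝ} (n : ℕ) {u w : ℝ} (huw : u ≤ w) (hw : w ≤ R) :
    clampGrid R n u w (gridSize R n) = w := by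
  rw [clampGrid, min_eq_left (hw.trans (le_grid_gridSize R n).le), max_eq_right huw]

lemma stair_congr {h : ℝ → ℝ → ℝ → ℝ} {u v : ℕ → ℝ} {i j : ℕ} (hij : i ≤ j)
    (huv : ∀ k, i ≤ k → k ≤ j → u k = v k) : stair h u i j = stair h v i j := by
  refine Finset.sum_congr rfl fun k hk => ?_
  rw [Finset.mem_Ico] at hk
  rw [huv i le_rfl hij, huv k hk.1 hk.2.le, huv (k + 1) (by omega) hk.2]

/-- The three fans run along one and the same grid, clamped to different intervals, so their points
agree outside the cell that contains `v`. The cocycle relation cancels everything except a single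
term inside that cell, whose length is at most `1 / (n + 1)`. -/
lemma stair_clamp_defect {h : ℝ → ℝ → ℝ → ℝ} {u v w K θ R : ℝ} (hc : IsCocycle h u w K θ)
    (hK : 0 ≤ K) (hθ : 0 ≤ θ)
    (huR : -R ≤ u) (huv : u ≤ v) (hvw : v ≤ w) (hwR : w ≤ R) (n : ℕ) :
    |stair h (clampGrid R n u w) 0 (gridSize R n) - stair h (clampGrid R n u v) 0 (gridSize R n) -
      stair h (clampGrid R n v w) 0 (gridSize R n) - h u v w| ≤ K * (1 / ((n : ℝ) + 1)) ^ θ := by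
  set N := gridSize R n
  set p := clampGrid R n u w with hp
  set q := clampGrid R n u v with hq
  set r := clampGrid R n v w with hr
  have huw := huv.trans hvw
  obtain ⟨j, -, hjN, hj1, hj2⟩ : ∃ j, 0 ≤ j ∧ j < N ∧ -R + (j : ℝ) / (n + 1) ≤ v ∧
      v ≤ -R + ((j + 1 : ℕ) : ℝ) / (n + 1) :=
    exists_crossing (u := fun k : ℕ => -R + (k : ℝ) / (n + 1)) (i := 0) (j := N)
      (by simp [N, gridSize]) (by simp; linarith)
      ((hvw.trans hwR).trans (le_grid_gridSize R n).le)
  have mono_t : ∀ {k l : ℕ}, k ≤ l → -R + (k : ℝ) / (n + 1) ≤ -R + (l : ℝ) / (n + 1) := by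
    intro k l hkl; gcongr
  have pq : ∀ k, k ≤ j → p k = q k := fun k hk => by
    have := (mono_t hk).trans hj1
    simp only [hp, hq, clampGrid, min_eq_right this, min_eq_right (this.trans hvw)]
  have rv : ∀ k, k ≤ j → r k = v := fun k hk => by
    have := (mono_t hk).trans hj1
    simp only [hr, clampGrid, min_eq_right (this.trans hvw), max_eq_left this]
  have qv : ∀ k, j + 1 ≤ k → q k = v := fun k hk => by
    have := hj2.trans (mono_t hk)
    simp only [hq, clampGrid, min_eq_left this, max_eq_right huv]
  have pr : ∀ k, j + 1 ≤ k → p k = r k := fun k hk => by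
    have h1 := hj2.trans (mono_t hk)
    have h2 : v ≤ min w (-R + (k : ℝ) / (n + 1)) := le_min hvw h1
    simp only [hp, hr, clampGrid, max_eq_right h2, max_eq_right (huv.trans h2)]
  have mp : Monotone p := clampGrid_monotone R n u w
  have mq : Monotone q := clampGrid_monotone R n u v
  have mr : Monotone r := clampGrid_monotone R n v w
  have ip : ∀ k, p k ∈ Icc u w := clampGrid_mem R n huw
  have iq : ∀ k, q k ∈ Icc u w := fun k => Icc_subset_Icc_right hvw (clampGrid_mem R n huv k)
  have ir : ∀ k, r k ∈ Icc u w := fun k => Icc_subset_Icc_left huv (clampGrid_mem R n hvw k)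
  have p0 : p 0 = u := clampGrid_zero n huR
  have q0 : q 0 = u := clampGrid_zero n huR
  have r0 : r 0 = v := clampGrid_zero n (huR.trans huv)
  have pN : p N = w := clampGrid_gridSize n huw hwR
  have qN : q N = v := clampGrid_gridSize n huv (hvw.trans hwR)
  have rN : r N = w := clampGrid_gridSize n hvw hwR
  have s1 : stair h p 0 N = stair h p 0 j + stair h p (j + 1) N + h (p j) (p (j + 1)) w +
      h u (p j) w := by
    rw [stair_split hc mp ip (Nat.zero_le j) hjN.le, stair_split hc mp ip (Nat.le_succ j) hjN,
      stair_one hc mp ip, p0, pN]; ring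
  have s2 : stair h q 0 N = stair h p 0 j + h u (p j) v := by
    have z : stair h q j N = 0 := by
      refine Finset.sum_eq_zero fun k hk => ?_
      rw [Finset.mem_Ico] at hk
      rcases hk.1.eq_or_lt with rfl | hlt
      · exact hc.left _ _ (iq _).1 (mq (Nat.le_succ _)) (iq _).2
      · rw [qv k hlt, qv (k + 1) (by omega), ← qv (j + 1) le_rfl]
        exact hc.right _ _ (iq _).1 (mq (Nat.le_succ _)) (iq _).2
    rw [stair_split hc mq iq (Nat.zero_le j) hjN.le, z, q0, qN, ← pq j le_rfl,
      stair_congr (Nat.zero_le j) fun k _ hk => (pq k hk).symm]; ring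
  have s3 : stair h r 0 N = stair h p (j + 1) N + h v (p (j + 1)) w := by
    have z : stair h r 0 (j + 1) = 0 := by
      refine Finset.sum_eq_zero fun k hk => ?_
      rw [Finset.mem_Ico] at hk
      rw [r0, ← rv k (by omega)]
      exact hc.left _ _ (ir _).1 (mr (Nat.le_succ _)) (ir _).2
    rw [stair_split hc mr ir (Nat.zero_le (j + 1)) hjN, z, r0, rN, ← pr (j + 1) le_rfl,
      stair_congr hjN fun k hk _ => (pr k hk).symm]; ring
  have hpv : p j ≤ v := by rw [pq j le_rfl]; exact (clampGrid_mem R n huv j).2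
  have hvp : v ≤ p (j + 1) := by rw [pr _ le_rfl]; exact (clampGrid_mem R n hvw _).1
  have c1 := hc.coc u (p j) v w le_rfl (ip j).1 hpv hvw le_rfl
  have c2 := hc.coc (p j) v (p (j + 1)) w (ip j).1 hpv hvp (ip _).2 le_rfl
  have e : stair h p 0 N - stair h q 0 N - stair h r 0 N - h u v w =
      -h (p j) v (p (j + 1)) := by rw [s1, s2, s3]; linarith
  rw [e, abs_neg]
  refine (hc.bound _ _ _ (ip j).1 hpv hvp (ip _).2).trans ?_
  have hle : p (j + 1) - p j ≤ 1 / ((n : ℝ) + 1) := by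
    have h1 : -R + ((j + 1 : ℕ) : ℝ) / (n + 1) = -R + (j : ℝ) / (n + 1) + 1 / (n + 1) := by
      push_cast; ring
    have hpos : (0 : ℝ) ≤ 1 / (n + 1) := by positivity
    have h2 : p (j + 1) ≤ max u (-R + (j : ℝ) / (n + 1)) + 1 / (n + 1) := by
      refine max_le ?_ ((min_le_right _ _).trans ?_)
      · linarith [le_max_left u (-R + (j : ℝ) / (n + 1))]
      · rw [h1]; linarith [le_max_right u (-R + (j : ℝ) / (n + 1))]
    have h3 : p j = max u (-R + (j : ℝ) / (n + 1)) := by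
      rw [hp, clampGrid, min_eq_right (hj1.trans hvw)]
    linarith
  have := sub_nonneg.2 (hpv.trans hvp)
  gcongr

lemma tendsto_one_div_add_one_rpow {θ : ℝ} (hθ : 0 < θ) :
    Filter.Tendsto (fun n : ℕ => (1 / ((n : ℝ) + 1)) ^ θ) Filter.atTop (nhds 0) := by
  have h := (tendsto_one_div_add_atTop_nhds_zero_nat (𝕜 := ℝ)).rpow_const (p := θ) (Or.inr hθ.le)
  rwa [Real.zero_rpow hθ.ne'] at h

/-- The sewing lemma: a cocycle of order `θ > 1` is the coboundary of a function of order `θ`. -/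
theorem exists_sewing {S : ℝ → ℝ → Prop} {h : ℝ → ℝ → ℝ → ℝ} {K θ R : ℝ} (hθ : 1 < θ) (hK : 0 ≤ K)
    (hS : ∀ a b u w, S a b → a ≤ u → u ≤ w → w ≤ b → S u w)
    (hR : ∀ a b, S a b → -R ≤ a ∧ a ≤ b ∧ b ≤ R)
    (hc : ∀ a b, S a b → IsCocycle h a b K θ) :
    ∃ y : ℝ → ℝ → ℝ, (∀ u v w, u ≤ v → v ≤ w → S u w → y u w = y u v + y v w + h u v w) ∧
      ∀ u w, S u w → |y u w| ≤ sewConst θ * K * (w - u) ^ θ := by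
  set s : ℕ → ℝ → ℝ → ℝ := fun n u w => stair h (clampGrid R n u w) 0 (gridSize R n) with hs
  -- Boundedness alone provides limits along an ultrafilter, for all pairs simultaneously, so
  -- convergence of the sums plays no role; only the vanishing defect is used.
  set l : Filter ℕ := (Filter.hyperfilter ℕ : Filter ℕ) with hl
  have hle : l ≤ Filter.atTop := by
    rw [← Nat.cofinite_eq_atTop]; exact Filter.hyperfilter_le_cofinite
  have hbd : ∀ u w, S u w → ∀ n, |s n u w| ≤ sewConst θ * K * (w - u) ^ θ := by
    intro u w huw n
    obtain ⟨h1, h2, h3⟩ := hR u w huw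
    have := abs_stair_le hθ hK (hc u w huw) (clampGrid_monotone R n u w) (clampGrid_mem R n h2)
      (Nat.zero_le (gridSize R n))
    rwa [clampGrid_zero n h1, clampGrid_gridSize n h2 h3] at this
  have hex : ∀ u w, ∃ y, S u w → Filter.Tendsto (fun n => s n u w) l (nhds y) := by
    intro u w
    by_cases huw : S u w
    · set B := sewConst θ * K * (w - u) ^ θ
      have hmem : ((Filter.hyperfilter ℕ).map fun n => s n u w : Filter ℝ) ≤
          Filter.principal (Icc (-B) B) := by
        rw [Filter.le_principal_iff]
        exact Filter.mem_map.2 (Filter.univ_mem' fun n => abs_le.1 (hbd u w huw n))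
      obtain ⟨y, -, hy⟩ := isCompact_Icc.ultrafilter_le_nhds _ hmem
      exact ⟨y, fun _ => hy⟩
    · exact ⟨0, fun h => absurd h huw⟩
  choose y hy using hex
  refine ⟨y, fun u v w huv hvw huw => ?_, fun u w huw => ?_⟩
  · have S1 := hS u w u v huw le_rfl huv hvw
    have S2 := hS u w v w huw huv hvw le_rfl
    obtain ⟨h1, h2, h3⟩ := hR u w huw
    have t1 := (((hy u w huw).sub (hy u v S1)).sub (hy v w S2)).sub_const (h u v w)
    have t2 : Filter.Tendsto (fun n : ℕ => K * (1 / ((n : ℝ) + 1)) ^ θ) l (nhds (K * 0)) :=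
      ((tendsto_one_div_add_one_rpow (by linarith)).const_mul K).mono_left hle
    rw [mul_zero] at t2
    have t3 := squeeze_zero_norm (f := fun n => s n u w - s n u v - s n v w - h u v w)
      (fun n => stair_clamp_defect (hc u w huw) hK (by linarith)
      h1 huv hvw h3 n) t2
    linarith [tendsto_nhds_unique t1 t3]
  · exact le_of_tendsto (hy u w huw).abs (Filter.Eventually.of_forall (hbd u w huw))

/-- The point `k` of the uniform partition of `[a, b]` into `n` intervals, constant beyond `n`. -/
def unifPart (a b : ℝ) (n k : ℕ) : ℝ := a + (min k n : ℕ) * ((b - a) / n)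

lemma unifPart_zero (a b : ℝ) (n : ℕ) : unifPart a b n 0 = a := by simp [unifPart]

lemma unifPart_last (a b : ℝ) {n : ℕ} (hn : n ≠ 0) : unifPart a b n n = b := by
  have : (n : ℝ) ≠ 0 := by exact_mod_cast hn
  simp only [unifPart, min_self]; field_simp; ring

lemma unifPart_monotone {a b : ℝ} (hab : a ≤ b) (n : ℕ) : Monotone (unifPart a b n) := by
  intro k l hkl
  have h := sub_nonneg.2 hab
  have : min k n ≤ min l n := min_le_min_right n hkl
  unfold unifPart
  gcongr

lemma unifPart_mem {a b : ℝ} (hab : a ≤ b) {n : ℕ} (hn : n ≠ 0) (k : ℕ) :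
    unifPart a b n k ∈ Icc a b := by
  constructor
  · exact (unifPart_zero a b n).symm.le.trans (unifPart_monotone hab n (Nat.zero_le k))
  · calc unifPart a b n k = unifPart a b n (min k n) := by simp [unifPart]
      _ ≤ unifPart a b n n := unifPart_monotone hab n (min_le_right k n)
      _ = b := unifPart_last a b hn

lemma unifPart_succ_sub (a b : ℝ) {n k : ℕ} (hk : k < n) :
    unifPart a b n (k + 1) - unifPart a b n k = (b - a) / n := by
  simp only [unifPart, min_eq_left hk.le, min_eq_left (Nat.succ_le_of_lt hk)]
  push_cast; ring

lemma tendsto_nat_mul_div_rpow (L : ℝ) {θ : ℝ} (hL : 0 ≤ L) (hθ : 1 < θ) :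
    Filter.Tendsto (fun n : ℕ => (n : ℝ) * (L / n) ^ θ) Filter.atTop (nhds 0) := by
  have h1 : Filter.Tendsto (fun n : ℕ => L ^ θ * (n : ℝ) ^ (-(θ - 1))) Filter.atTop
      (nhds (L ^ θ * 0)) :=
    ((tendsto_rpow_neg_atTop (by linarith)).comp tendsto_natCast_atTop_atTop).const_mul _
  rw [mul_zero] at h1
  refine h1.congr' ?_
  filter_upwards [Filter.eventually_gt_atTop 0] with n hn
  have hn' : (0 : ℝ) < n := by exact_mod_cast hn
  rw [Real.div_rpow hL hn'.le, neg_sub, Real.rpow_sub hn', Real.rpow_one]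
  field_simp

lemma sum_add_stair {h : ℝ → ℝ → ℝ → ℝ} {y : ℝ → ℝ → ℝ} {a b : ℝ}
    (hy : ∀ u v w, a ≤ u → u ≤ v → v ≤ w → w ≤ b → y u w = y u v + y v w + h u v w)
    (h0 : ∀ u, a ≤ u → u ≤ b → y u u = 0)
    {u : ℕ → ℝ} (hu : Monotone u) (hab : ∀ k, u k ∈ Icc a b) (n : ℕ) :
    y (u 0) (u n) = ∑ k ∈ Finset.range n, y (u k) (u (k + 1)) + stair h u 0 n := by
  induction n with
  | zero => simp [stair_self, h0 _ (hab 0).1 (hab 0).2]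
  | succ n ih =>
    rw [Finset.sum_range_succ, stair_succ h u (Nat.zero_le n),
      hy (u 0) (u n) (u (n + 1)) (hab 0).1 (hu (Nat.zero_le n)) (hu (Nat.le_succ n)) (hab _).2, ih]
    ring

/-- A function of superlinear order with coboundary of order `θ > 1` is itself of order `θ`. -/
theorem abs_le_of_coboundary {h : ℝ → ℝ → ℝ → ℝ} {y : ℝ → ℝ → ℝ} {a b K θ C θ' : ℝ} (hab : a ≤ b)
    (hθ : 1 < θ) (hθ' : 1 < θ') (hK : 0 ≤ K) (hc : IsCocycle h a b K θ)
    (hy : ∀ u v w, a ≤ u → u ≤ v → v ≤ w → w ≤ b → y u w = y u v + y v w + h u v w)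
    (hb : ∀ u w, a ≤ u → u ≤ w → w ≤ b → |y u w| ≤ C * (w - u) ^ θ') :
    |y a b| ≤ sewConst θ * K * (b - a) ^ θ := by
  have h0 : ∀ u, a ≤ u → u ≤ b → y u u = 0 := fun u h1 h2 => by
    have := hy u u u h1 le_rfl le_rfl h2
    rw [hc.left u u h1 le_rfl h2] at this
    linarith
  -- Along the uniform partition into `n` pieces the values of `y` add up to at most `C * n * ((b -
  -- a) / n) ^ θ'`, which tends to zero. Only the fan of `h` survives, and its bound does not see
  -- `n`.
  have lim : Filter.Tendsto (fun n : ℕ => C * ((n : ℝ) * ((b - a) / n) ^ θ') +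
      sewConst θ * K * (b - a) ^ θ) Filter.atTop (nhds (C * 0 + sewConst θ * K * (b - a) ^ θ)) :=
    ((tendsto_nat_mul_div_rpow (b - a) (sub_nonneg.2 hab) hθ').const_mul C).add_const _
  rw [mul_zero, zero_add] at lim
  refine ge_of_tendsto lim ?_
  filter_upwards [Filter.eventually_gt_atTop 0] with n hn
  have m := unifPart_monotone hab n
  have i := unifPart_mem hab hn.ne'
  have e := sum_add_stair hy h0 m i n
  rw [unifPart_zero, unifPart_last a b hn.ne'] at e
  have e2 := abs_stair_le hθ hK hc m i (Nat.zero_le n)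
  rw [unifPart_zero, unifPart_last a b hn.ne'] at e2
  have e3 : |∑ k ∈ Finset.range n, y (unifPart a b n k) (unifPart a b n (k + 1))| ≤
      C * ((n : ℝ) * ((b - a) / n) ^ θ') := by
    refine (Finset.abs_sum_le_sum_abs _ _).trans ?_
    calc _ ≤ ∑ k ∈ Finset.range n, C * ((b - a) / n) ^ θ' := by
          refine Finset.sum_le_sum fun k hk => ?_
          rw [← unifPart_succ_sub a b (Finset.mem_range.1 hk)]
          exact hb _ _ (i k).1 (m (Nat.le_succ k)) (i _).2
      _ = _ := by rw [Finset.sum_const, Finset.card_range, nsmul_eq_mul]; ring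
  rw [e]
  exact (abs_add_le _ _).trans (add_le_add e3 e2)

/-! ### Germs -/

/-- The coboundary of a function of two points satisfies the cocycle relation identically, so the
results on three points contain the usual additive sewing lemma. -/
lemma isCocycle_of_germ {φ : ℝ → ℝ → ℝ} {a b K θ : ℝ} (h0 : ∀ u, a ≤ u → u ≤ b → φ u u = 0)
    (hδ : ∀ u v w, a ≤ u → u ≤ v → v ≤ w → w ≤ b → |φ u w - φ u v - φ v w| ≤ K * (w - u) ^ θ) :
    IsCocycle (fun u v w => φ u w - φ u v - φ v w) a b K θ where
  coc u v w z _ _ _ _ _ := by ring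
  left u w h1 h2 h3 := by simp [h0 u h1 (h2.trans h3)]
  right u w h1 h2 h3 := by simp [h0 w (h1.trans h2) h3]
  bound := hδ

/-- The version for one fixed partition, without passage to the limit. `exists_young2` applies it to
the error of Riemann sums in the second variable, regarded as a germ in the first. -/
theorem germ_discrete {φ : ℝ → ℝ → ℝ} {a b K θ : ℝ} (hθ : 1 < θ) (hK : 0 ≤ K)
    (h0 : ∀ u, φ u u = 0)
    (hδ : ∀ u v w, a ≤ u → u ≤ v → v ≤ w → w ≤ b → |φ u w - φ u v - φ v w| ≤ K * (w - u) ^ θ)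
    {p : ℕ → ℝ} (hp : Monotone p) (hab : ∀ k, p k ∈ Icc a b) (n : ℕ) :
    |∑ k ∈ Finset.range n, φ (p k) (p (k + 1)) - φ (p 0) (p n)| ≤
      sewConst θ * K * (p n - p 0) ^ θ := by
  have hc := isCocycle_of_germ (fun u _ _ => h0 u) hδ
  have e := sum_add_stair (h := fun u v w => φ u w - φ u v - φ v w) (y := φ) (a := a) (b := b)
    (fun u v w _ _ _ _ => by ring) (fun u _ _ => h0 u) hp hab n
  have := abs_stair_le hθ hK hc hp hab (Nat.zero_le n)
  rw [e, sub_add_cancel_left, abs_neg]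
  exact this

theorem germ_sewing {φ : ℝ → ℝ → ℝ} {a b K θ : ℝ} (hθ : 1 < θ) (hK : 0 ≤ K)
    (h0 : ∀ u, φ u u = 0)
    (hδ : ∀ u v w, a ≤ u → u ≤ v → v ≤ w → w ≤ b → |φ u w - φ u v - φ v w| ≤ K * (w - u) ^ θ) :
    ∃ J : ℝ → ℝ → ℝ, (∀ u v w, a ≤ u → u ≤ v → v ≤ w → w ≤ b → J u w = J u v + J v w) ∧
      ∀ u w, a ≤ u → u ≤ w → w ≤ b → |φ u w - J u w| ≤ sewConst θ * K * (w - u) ^ θ := by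
  have hc := isCocycle_of_germ (fun u _ _ => h0 u) hδ
  obtain ⟨y, h1, h2⟩ := exists_sewing (S := fun u w => a ≤ u ∧ u ≤ w ∧ w ≤ b)
    (R := max |a| |b|) hθ hK
    (fun a' b' u w h h1 h2 h3 => ⟨h.1.trans h1, h2, h3.trans h.2.2⟩)
    (fun u w h => ⟨by linarith [neg_abs_le a, le_max_left |a| |b|, h.1], h.2.1,
      by linarith [le_abs_self b, le_max_right |a| |b|, h.2.2]⟩)
    (fun u w h => hc.mono h.1 h.2.2)
  refine ⟨fun u w => φ u w - y u w, fun u v w h3 h4 h5 h6 => ?_, fun u w h3 h4 h5 => ?_⟩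
  · have := h1 u v w h4 h5 ⟨h3, h4.trans h5, h6⟩
    linarith
  · simpa using h2 u w ⟨h3, h4, h5⟩

/-! ### Partitions -/

/-- The sequence of points of a partition, constant from the last one on. -/
def truncSeq (a : ℕ → ℝ) (n k : ℕ) : ℝ := a (min k n)

/-- A partition constrains only the indices up to `n`, while the sewing estimates ask for
monotonicity along all of `ℕ`; hence the truncation. -/
lemma IsPartition.truncSeq_monotone {a : ℕ → ℝ} {n : ℕ} {l r δ : ℝ} (h : IsPartition a n l r δ) :
    Monotone (truncSeq a n) := by
  refine monotone_nat_of_le_succ fun k => ?_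
  unfold truncSeq
  rcases lt_or_ge k n with hk | hk
  · rw [min_eq_left hk.le, min_eq_left (Nat.succ_le_of_lt hk)]
    exact (h.2.2 k hk).1
  · rw [min_eq_right hk, min_eq_right (hk.trans (Nat.le_succ k))]

lemma IsPartition.truncSeq_mem {a : ℕ → ℝ} {n : ℕ} {l r δ : ℝ} (h : IsPartition a n l r δ)
    (k : ℕ) : truncSeq a n k ∈ Icc l r := by
  have h0 : truncSeq a n 0 = l := by simp [truncSeq, h.1]
  have hn : truncSeq a n n = r := by simp [truncSeq, h.2.1]
  constructor
  · exact h0.symm.le.trans (h.truncSeq_monotone (Nat.zero_le k))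
  · calc truncSeq a n k = truncSeq a n (min k n) := by simp [truncSeq]
      _ ≤ truncSeq a n n := h.truncSeq_monotone (min_le_right k n)
      _ = r := hn

lemma sum_truncSeq (φ : ℝ → ℝ → ℝ) (a : ℕ → ℝ) (n : ℕ) :
    ∑ k ∈ Finset.range n, φ (truncSeq a n k) (truncSeq a n (k + 1)) =
      ∑ k ∈ Finset.range n, φ (a k) (a (k + 1)) := by
  refine Finset.sum_congr rfl fun k hk => ?_
  have hk := Finset.mem_range.1 hk
  simp [truncSeq, min_eq_left hk.le, min_eq_left (Nat.succ_le_of_lt hk)]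

lemma IsPartition.mem {a : ℕ → ℝ} {n : ℕ} {l r δ : ℝ} (h : IsPartition a n l r δ) {k : ℕ}
    (hk : k ≤ n) : a k ∈ Icc l r := by
  have := h.truncSeq_mem k
  rwa [truncSeq, min_eq_left hk] at this

lemma sum_additive {J : ℝ → ℝ → ℝ} {l r : ℝ}
    (hJ : ∀ u v w, l ≤ u → u ≤ v → v ≤ w → w ≤ r → J u w = J u v + J v w)
    {p : ℕ → ℝ} (hp : Monotone p) (hab : ∀ k, p k ∈ Icc l r) (n : ℕ) :
    ∑ k ∈ Finset.range n, J (p k) (p (k + 1)) = J (p 0) (p n) := by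
  have h0 : ∀ u, l ≤ u → u ≤ r → J u u = 0 := fun u h1 h2 => by
    linarith [hJ u u u h1 le_rfl le_rfl h2]
  have := sum_add_stair (h := fun _ _ _ => 0) (y := J) (a := l) (b := r)
    (fun u v w h1 h2 h3 h4 => by rw [hJ u v w h1 h2 h3 h4, add_zero]) h0 hp hab n
  rw [this]; simp [stair]

/-- Riemann sums of a germ converge to the additive function close to it. -/
theorem abs_sum_germ_sub_le {φ J : ℝ → ℝ → ℝ} {l r M θ δ : ℝ} (hθ : 1 < θ) (hM : 0 ≤ M)
    (hJ : ∀ u v w, l ≤ u → u ≤ v → v ≤ w → w ≤ r → J u w = J u v + J v w)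
    (hφ : ∀ u w, l ≤ u → u ≤ w → w ≤ r → |φ u w - J u w| ≤ M * (w - u) ^ θ)
    {a : ℕ → ℝ} {n : ℕ} (ha : IsPartition a n l r δ) :
    |∑ k ∈ Finset.range n, φ (a k) (a (k + 1)) - J l r| ≤ M * δ ^ (θ - 1) * (r - l) := by
  have e1 := sum_additive hJ ha.truncSeq_monotone ha.truncSeq_mem n
  have h0 : truncSeq a n 0 = l := by simp [truncSeq, ha.1]
  have hn : truncSeq a n n = r := by simp [truncSeq, ha.2.1]
  rw [sum_truncSeq, h0, hn] at e1
  rw [← e1, ← Finset.sum_sub_distrib]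
  refine (Finset.abs_sum_le_sum_abs _ _).trans ?_
  have : ∑ k ∈ Finset.range n, (a (k + 1) - a k) = r - l := by
    rw [Finset.sum_range_sub, ha.1, ha.2.1]
  rw [← this, Finset.mul_sum]
  refine Finset.sum_le_sum fun k hk => ?_
  have hk := Finset.mem_range.1 hk
  obtain ⟨h1, h2⟩ := ha.2.2 k hk
  refine (hφ _ _ (ha.mem hk.le).1 h1 (ha.mem (Nat.succ_le_of_lt hk)).2).trans ?_
  have hnn := sub_nonneg.2 h1
  rw [mul_assoc]
  refine mul_le_mul_of_nonneg_left ?_ hM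
  rcases hnn.eq_or_lt with h | h
  · rw [← h, mul_zero, Real.zero_rpow (by linarith)]
  · calc (a (k + 1) - a k) ^ θ = (a (k + 1) - a k) ^ (θ - 1) * (a (k + 1) - a k) := by
          rw [Real.rpow_sub_one h.ne']; field_simp
      _ ≤ _ := by
        refine mul_le_mul_of_nonneg_right ?_ hnn
        exact Real.rpow_le_rpow hnn h2.le (by linarith)

lemma isPartition_unifPart {a b δ : ℝ} (hab : a ≤ b) {n : ℕ} (hn : n ≠ 0) (hδ : (b - a) / n < δ) :
    IsPartition (unifPart a b n) n a b δ :=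
  ⟨unifPart_zero a b n, unifPart_last a b hn, fun i hi =>
    ⟨unifPart_monotone hab n (Nat.le_succ i), by rwa [unifPart_succ_sub a b hi]⟩⟩

lemma eventually_isPartition {a b δ : ℝ} (hab : a ≤ b) (hδ : 0 < δ) :
    ∀ᶠ n : ℕ in Filter.atTop, IsPartition (unifPart a b (n + 1)) (n + 1) a b δ := by
  have h1 : Filter.Tendsto (fun n : ℕ => (b - a) / ((n + 1 : ℕ) : ℝ)) Filter.atTop (nhds 0) :=
    (tendsto_const_div_atTop_nhds_zero_nat (b - a)).comp (Filter.tendsto_add_atTop_nat 1)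
  filter_upwards [h1.eventually_lt_const hδ] with n hn
  exact isPartition_unifPart hab n.succ_ne_zero hn

/-! ### The Young integral in one dimension -/

/-- Hölder continuity on an interval. -/
def HolderIcc (F : ℝ → ℝ) (c d A κ : ℝ) : Prop :=
  ∀ v v', c ≤ v → v ≤ v' → v' ≤ d → |F v' - F v| ≤ A * (v' - v) ^ κ

/-- One-dimensional Riemann sums. -/
def riemann1 (F G : ℝ → ℝ) (b : ℕ → ℝ) (m : ℕ) : ℝ :=
  ∑ j ∈ Finset.range m, F (b j) * (G (b (j + 1)) - G (b j))

/-- The one-dimensional Young integral, as the limit of Riemann sums along uniform partitions. -/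
def young1 (F G : ℝ → ℝ) (c d : ℝ) : ℝ :=
  Filter.atTop.limUnder fun n : ℕ => riemann1 F G (unifPart c d (n + 1)) (n + 1)

lemma rpow_mul_rpow_le {p q r κ γ : ℝ} (hp : 0 ≤ p) (hq : 0 ≤ q) (hpr : p ≤ r) (hqr : q ≤ r)
    (hκ : 0 ≤ κ) (hγ : 0 ≤ γ) (hs : 0 < κ + γ) : p ^ κ * q ^ γ ≤ r ^ (κ + γ) := by
  rw [Real.rpow_add' (hp.trans hpr) hs.ne']
  have := Real.rpow_nonneg hq γ
  gcongr
  exact Real.rpow_nonneg (hp.trans hpr) κ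

/-- The germ `F v * (G w - G v)` has coboundary `-((F v - F u) * (G w - G v))`, of order `κ + γ >
1`. The rate for arbitrary partitions and the expansion at the left end carry the explicit factor `A
* B`: when `G` is an increment of the integrator in the other variable, `B` contains a power of that
increment, and the result can be sewn again. -/
theorem young1_spec {F G : ℝ → ℝ} {c d A B κ γ : ℝ} (hcd : c ≤ d) (hA : 0 ≤ A) (hB : 0 ≤ B)
    (hκ : 0 ≤ κ) (hγ : 0 ≤ γ) (hθ : 1 < κ + γ) (hF : HolderIcc F c d A κ)
    (hG : HolderIcc G c d B γ) :
    Filter.Tendsto (fun n : ℕ => riemann1 F G (unifPart c d (n + 1)) (n + 1)) Filter.atTop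
      (nhds (young1 F G c d)) ∧
    (∀ (b : ℕ → ℝ) (m : ℕ) (δ : ℝ), IsPartition b m c d δ →
      |riemann1 F G b m - young1 F G c d| ≤
        sewConst (κ + γ) * (A * B) * δ ^ (κ + γ - 1) * (d - c)) ∧
    |young1 F G c d - F c * (G d - G c)| ≤ sewConst (κ + γ) * (A * B) * (d - c) ^ (κ + γ) := by
  have hAB : 0 ≤ A * B := mul_nonneg hA hB
  have hC := sewConst_pos hθ
  obtain ⟨J, hJ1, hJ2⟩ := germ_sewing (φ := fun v w => F v * (G w - G v)) (a := c) (b := d) hθ hAB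
    (fun u => by ring) (fun u v w h1 h2 h3 h4 => by
      have e : F u * (G w - G u) - F u * (G v - G u) - F v * (G w - G v) =
          -((F v - F u) * (G w - G v)) := by ring
      rw [e, abs_neg, abs_mul]
      calc _ ≤ (A * (v - u) ^ κ) * (B * (w - v) ^ γ) :=
            mul_le_mul (hF u v h1 h2 (h3.trans h4)) (hG v w (h1.trans h2) h3 h4) (abs_nonneg _)
              (mul_nonneg hA (Real.rpow_nonneg (sub_nonneg.2 h2) _))
        _ = A * B * ((v - u) ^ κ * (w - v) ^ γ) := by ring
        _ ≤ _ := mul_le_mul_of_nonneg_left (rpow_mul_rpow_le (by linarith) (by linarith)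
              (by linarith) (by linarith) hκ hγ (by linarith)) hAB)
  have hpart : ∀ (b : ℕ → ℝ) (m : ℕ) (δ : ℝ), IsPartition b m c d δ →
      |riemann1 F G b m - J c d| ≤ sewConst (κ + γ) * (A * B) * δ ^ (κ + γ - 1) * (d - c) :=
    fun b m δ hb => abs_sum_germ_sub_le hθ (mul_nonneg hC.le hAB) hJ1 hJ2 hb
  have hlim : Filter.Tendsto (fun n : ℕ => riemann1 F G (unifPart c d (n + 1)) (n + 1))
      Filter.atTop (nhds (J c d)) := by
    rw [Metric.tendsto_atTop']
    intro ε hε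
    have hd := sub_nonneg.2 hcd
    obtain ⟨δ, hδ0, hδ⟩ : ∃ δ > 0, sewConst (κ + γ) * (A * B) * δ ^ (κ + γ - 1) * (d - c) < ε := by
      have t : Filter.Tendsto (fun δ : ℝ => sewConst (κ + γ) * (A * B) * δ ^ (κ + γ - 1) * (d - c))
          (nhdsWithin 0 (Ioi 0)) (nhds (sewConst (κ + γ) * (A * B) * 0 ^ (κ + γ - 1) * (d - c))) :=
        (((tendsto_nhdsWithin_of_tendsto_nhds Filter.tendsto_id).rpow_const
          (Or.inr (by linarith))).const_mul _).mul_const _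
      rw [Real.zero_rpow (by linarith), mul_zero, zero_mul] at t
      obtain ⟨δ, h1, h2⟩ := ((t.eventually_lt_const hε).and self_mem_nhdsWithin).exists
      exact ⟨δ, h2, h1⟩
    obtain ⟨N, hN⟩ := Filter.eventually_atTop.1 (eventually_isPartition hcd hδ0)
    exact ⟨N, fun n hn => (hpart _ _ δ (hN n (le_of_lt hn))).trans_lt hδ⟩
  have hJ : young1 F G c d = J c d := hlim.limUnder_eq
  rw [hJ]
  refine ⟨hlim, hpart, ?_⟩
  rw [abs_sub_comm]
  exact hJ2 c d le_rfl hcd le_rfl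

/-! ### The Young integral on rectangles -/

/-- Hölder continuity on a rectangle, in each variable and for rectangular increments. -/
structure RectHolder (f : ℝ × ℝ → ℝ) (a b c d A₁ A₂ A₃ κ κ' : ℝ) : Prop where
  fst : ∀ u u' v, a ≤ u → u ≤ u' → u' ≤ b → c ≤ v → v ≤ d →
    |f (u', v) - f (u, v)| ≤ A₁ * (u' - u) ^ κ
  snd : ∀ u v v', a ≤ u → u ≤ b → c ≤ v → v ≤ v' → v' ≤ d →
    |f (u, v') - f (u, v)| ≤ A₂ * (v' - v) ^ κ'
  rect : ∀ u u' v v', a ≤ u → u ≤ u' → u' ≤ b → c ≤ v → v ≤ v' → v' ≤ d →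
    |rectIncr f u u' v v'| ≤ A₃ * (u' - u) ^ κ * (v' - v) ^ κ'

/-- Hölder bound for the rectangular increments in a rectangle. -/
def RectBound (x : ℝ × ℝ → ℝ) (a b c d X γ γ' : ℝ) : Prop :=
  ∀ u u' v v', a ≤ u → u ≤ u' → u' ≤ b → c ≤ v → v ≤ v' → v' ≤ d →
    |rectIncr x u u' v v'| ≤ X * (u' - u) ^ γ * (v' - v) ^ γ'

lemma rectIncr_swap (f : ℝ × ℝ → ℝ) (a b c d : ℝ) :
    rectIncr (f ∘ Prod.swap) c d a b = rectIncr f a b c d := by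
  simp only [rectIncr, Function.comp, Prod.swap]; ring

lemma RectHolder.swap {f : ℝ × ℝ → ℝ} {a b c d A₁ A₂ A₃ κ κ' : ℝ}
    (hf : RectHolder f a b c d A₁ A₂ A₃ κ κ') :
    RectHolder (f ∘ Prod.swap) c d a b A₂ A₁ A₃ κ' κ where
  fst u u' v h1 h2 h3 h4 h5 := hf.snd v u u' h4 h5 h1 h2 h3
  snd u v v' h1 h2 h3 h4 h5 := hf.fst v v' u h3 h4 h5 h1 h2
  rect u u' v v' h1 h2 h3 h4 h5 h6 := by
    rw [rectIncr_swap]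
    exact (hf.rect v v' u u' h4 h5 h6 h1 h2 h3).trans (le_of_eq (by ring))

lemma RectBound.swap {x : ℝ × ℝ → ℝ} {a b c d X γ γ' : ℝ} (hx : RectBound x a b c d X γ γ') :
    RectBound (x ∘ Prod.swap) c d a b X γ' γ := fun u u' v v' h1 h2 h3 h4 h5 h6 => by
  rw [rectIncr_swap]
  exact (hx v v' u u' h4 h5 h6 h1 h2 h3).trans (le_of_eq (by ring))

lemma riemannSum_swap (f x : ℝ × ℝ → ℝ) (a : ℕ → ℝ) (n : ℕ) (b : ℕ → ℝ) (m : ℕ) :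
    riemannSum (f ∘ Prod.swap) (x ∘ Prod.swap) b m a n = riemannSum f x a n b m := by
  unfold riemannSum
  rw [Finset.sum_comm]
  simp only [rectIncr_swap]
  rfl

lemma HasYoungIntegral.swap {f x : ℝ × ℝ → ℝ} {s₁ s₂ t₁ t₂ z : ℝ}
    (h : HasYoungIntegral (f ∘ Prod.swap) (x ∘ Prod.swap) t₁ t₂ s₁ s₂ z) :
    HasYoungIntegral f x s₁ s₂ t₁ t₂ z := by
  intro ε hε
  obtain ⟨δ, hδ, H⟩ := h ε hε
  refine ⟨δ, hδ, fun a b n m ha hb => ?_⟩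
  rw [← riemannSum_swap]
  exact H b a m n hb ha

lemma HasYoungIntegral.tendsto {f x : ℝ × ℝ → ℝ} {s₁ s₂ t₁ t₂ z : ℝ} (hs : s₁ ≤ s₂) (ht : t₁ ≤ t₂)
    (h : HasYoungIntegral f x s₁ s₂ t₁ t₂ z) :
    Filter.Tendsto (fun n : ℕ => riemannSum f x (unifPart s₁ s₂ (n + 1)) (n + 1)
      (unifPart t₁ t₂ (n + 1)) (n + 1)) Filter.atTop (nhds z) := by
  rw [Metric.tendsto_nhds]
  intro ε hε
  obtain ⟨δ, hδ, H⟩ := h ε hε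
  filter_upwards [eventually_isPartition hs hδ, eventually_isPartition ht hδ] with n h1 h2
  exact H _ _ _ _ h1 h2

lemma HasYoungIntegral.unique {f x : ℝ × ℝ → ℝ} {s₁ s₂ t₁ t₂ z z' : ℝ} (hs : s₁ ≤ s₂)
    (ht : t₁ ≤ t₂) (h : HasYoungIntegral f x s₁ s₂ t₁ t₂ z)
    (h' : HasYoungIntegral f x s₁ s₂ t₁ t₂ z') : z = z' :=
  tendsto_nhds_unique (h.tendsto hs ht) (h'.tendsto hs ht)

lemma HasYoungIntegral.sub {f g x : ℝ × ℝ → ℝ} {s₁ s₂ t₁ t₂ z z' : ℝ}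
    (h : HasYoungIntegral f x s₁ s₂ t₁ t₂ z) (h' : HasYoungIntegral g x s₁ s₂ t₁ t₂ z') :
    HasYoungIntegral (f - g) x s₁ s₂ t₁ t₂ (z - z') := by
  intro ε hε
  obtain ⟨δ, hδ, H⟩ := h (ε / 2) (half_pos hε)
  obtain ⟨δ', hδ', H'⟩ := h' (ε / 2) (half_pos hε)
  refine ⟨min δ δ', lt_min hδ hδ', fun a b n m ha hb => ?_⟩
  have e1 := H a b n m
    ⟨ha.1, ha.2.1, fun i hi => ⟨(ha.2.2 i hi).1, (ha.2.2 i hi).2.trans_le (min_le_left _ _)⟩⟩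
    ⟨hb.1, hb.2.1, fun i hi => ⟨(hb.2.2 i hi).1, (hb.2.2 i hi).2.trans_le (min_le_left _ _)⟩⟩
  have e2 := H' a b n m
    ⟨ha.1, ha.2.1, fun i hi => ⟨(ha.2.2 i hi).1, (ha.2.2 i hi).2.trans_le (min_le_right _ _)⟩⟩
    ⟨hb.1, hb.2.1, fun i hi => ⟨(hb.2.2 i hi).1, (hb.2.2 i hi).2.trans_le (min_le_right _ _)⟩⟩
  have e3 : riemannSum (f - g) x a n b m = riemannSum f x a n b m - riemannSum g x a n b m := by
    simp only [riemannSum, Pi.sub_apply, sub_mul, Finset.sum_sub_distrib]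
  rw [e3]
  rw [abs_lt] at e1 e2 ⊢
  constructor <;> linarith [e1.1, e1.2, e2.1, e2.2]

lemma HasYoungIntegral.congr {f g x : ℝ × ℝ → ℝ} {s₁ s₂ t₁ t₂ z : ℝ}
    (h : HasYoungIntegral f x s₁ s₂ t₁ t₂ z)
    (hfg : ∀ u v, s₁ ≤ u → u ≤ s₂ → t₁ ≤ v → v ≤ t₂ → f (u, v) = g (u, v)) :
    HasYoungIntegral g x s₁ s₂ t₁ t₂ z := by
  intro ε hε
  obtain ⟨δ, hδ, H⟩ := h ε hε
  refine ⟨δ, hδ, fun a b n m ha hb => ?_⟩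
  have e : riemannSum g x a n b m = riemannSum f x a n b m := by
    refine Finset.sum_congr rfl fun i hi => Finset.sum_congr rfl fun j hj => ?_
    have hi := ha.mem (Finset.mem_range.1 hi).le
    have hj := hb.mem (Finset.mem_range.1 hj).le
    rw [hfg _ _ hi.1 hi.2 hj.1 hj.2]
  rw [e]
  exact H a b n m ha hb

/-- The constant of the Young estimate on rectangles. -/
def youngConst (θ θ' : ℝ) : ℝ := (1 + sewConst θ) * (1 + sewConst θ')

lemma youngConst_pos {θ θ' : ℝ} (h : 1 < θ) (h' : 1 < θ') : 0 < youngConst θ θ' :=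
  mul_pos (by linarith [sewConst_pos h]) (by linarith [sewConst_pos h'])

lemma exists_pos_mul_rpow_lt (M N : ℝ) {p q ε : ℝ} (hp : 0 < p) (hq : 0 < q) (hε : 0 < ε) :
    ∃ δ > 0, M * δ ^ p + N * δ ^ q < ε := by
  have t : Filter.Tendsto (fun δ : ℝ => M * δ ^ p + N * δ ^ q) (nhdsWithin 0 (Ioi 0))
      (nhds (M * 0 ^ p + N * 0 ^ q)) :=
    (((tendsto_nhdsWithin_of_tendsto_nhds Filter.tendsto_id).rpow_const
      (Or.inr hp.le)).const_mul _).add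
    (((tendsto_nhdsWithin_of_tendsto_nhds Filter.tendsto_id).rpow_const
      (Or.inr hq.le)).const_mul _)
  rw [Real.zero_rpow hp.ne', Real.zero_rpow hq.ne', mul_zero, mul_zero, add_zero] at t
  obtain ⟨δ, h1, h2⟩ := ((t.eventually_lt_const hε).and self_mem_nhdsWithin).exists
  exact ⟨δ, h2, h1⟩

/-- Existence of the Young integral on rectangles, additivity in the first variable and the
Young estimate. -/
theorem exists_young2 {f x : ℝ × ℝ → ℝ} {a b c d A₁ A₂ A₃ X κ κ' γ γ' : ℝ} (hab : a ≤ b)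
    (hcd : c ≤ d) (hA₁ : 0 ≤ A₁) (hA₂ : 0 ≤ A₂) (hA₃ : 0 ≤ A₃) (hX : 0 ≤ X) (hκ : 0 ≤ κ)
    (hκ' : 0 ≤ κ') (hγ : 0 ≤ γ) (hγ' : 0 ≤ γ') (hθ : 1 < κ + γ) (hθ' : 1 < κ' + γ')
    (hf : RectHolder f a b c d A₁ A₂ A₃ κ κ') (hx : RectBound x a b c d X γ γ') :
    ∃ J : ℝ → ℝ → ℝ, (∀ u v w, a ≤ u → u ≤ v → v ≤ w → w ≤ b → J u w = J u v + J v w) ∧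
      (∀ u w, a ≤ u → u ≤ w → w ≤ b → HasYoungIntegral f x u w c d (J u w)) ∧
      |J a b| ≤ youngConst (κ + γ) (κ' + γ') * X * (b - a) ^ γ * (d - c) ^ γ' *
        (|f (a, c)| + A₁ * (b - a) ^ κ + A₂ * (d - c) ^ κ' +
          A₃ * (b - a) ^ κ * (d - c) ^ κ') := by
  set s := sewConst (κ + γ) with hs
  set s' := sewConst (κ' + γ') with hs'
  have hs0 : 0 < s := sewConst_pos hθ
  have hs'0 : 0 < s' := sewConst_pos hθ'
  have hdc : 0 ≤ d - c := sub_nonneg.2 hcd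
  have hba : 0 ≤ b - a := sub_nonneg.2 hab
  -- the integrators and integrands in the second variable
  have HG : ∀ u w, a ≤ u → u ≤ w → w ≤ b →
      HolderIcc (fun v => x (w, v) - x (u, v)) c d (X * (w - u) ^ γ) γ' := by
    intro u w h1 h2 h3 v v' h4 h5 h6
    have := hx u w v v' h1 h2 h3 h4 h5 h6
    rwa [show rectIncr x u w v v' = x (w, v') - x (u, v') - (x (w, v) - x (u, v)) by
      unfold rectIncr; ring] at this
  have HF : ∀ u, a ≤ u → u ≤ b → HolderIcc (fun v => f (u, v)) c d A₂ κ' :=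
    fun u h1 h2 v v' h4 h5 h6 => hf.snd u v v' h1 h2 h4 h5 h6
  have HD : ∀ u w, a ≤ u → u ≤ w → w ≤ b →
      HolderIcc (fun v => f (w, v) - f (u, v)) c d (A₃ * (w - u) ^ κ) κ' := by
    intro u w h1 h2 h3 v v' h4 h5 h6
    have := hf.rect u w v v' h1 h2 h3 h4 h5 h6
    rwa [show rectIncr f u w v v' = f (w, v') - f (u, v') - (f (w, v) - f (u, v)) by
      unfold rectIncr; ring] at this
  have nnX : ∀ u w, u ≤ w → 0 ≤ X * (w - u) ^ γ := fun u w h =>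
    mul_nonneg hX (Real.rpow_nonneg (sub_nonneg.2 h) _)
  have nnA : ∀ u w, u ≤ w → 0 ≤ A₃ * (w - u) ^ κ := fun u w h =>
    mul_nonneg hA₃ (Real.rpow_nonneg (sub_nonneg.2 h) _)
  have spec1 := fun u w (h1 : a ≤ u) (h2 : u ≤ w) (h3 : w ≤ b) =>
    young1_spec hcd hA₂ (nnX u w h2) hκ' hγ' hθ' (HF u h1 (h2.trans h3)) (HG u w h1 h2 h3)
  have spec2 := fun u v w (h1 : a ≤ u) (h2 : u ≤ v) (h3 : v ≤ w) (h4 : w ≤ b) =>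
    young1_spec hcd (nnA u v h2) (nnX v w h3) hκ' hγ' hθ' (HD u v h1 h2 (h3.trans h4))
      (HG v w (h1.trans h2) h3 h4)
  -- The germ in the first variable: `f` is frozen at the left end and integrated in the second
  -- variable. Its coboundary is `-ψ`, where `ψ` pairs an increment of `f` over `[u, v]` with one of
  -- `x` over `[v, w]` and so carries both powers `κ` and `γ`.
  set φ : ℝ → ℝ → ℝ := fun u w => young1 (fun v => f (u, v)) (fun v => x (w, v) - x (u, v)) c d
    with hφ
  set ψ : ℝ → ℝ → ℝ → ℝ := fun u v w =>
    young1 (fun r => f (v, r) - f (u, r)) (fun r => x (w, r) - x (v, r)) c d with hψ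
  have riem : ∀ (p : ℕ → ℝ) (m : ℕ) (u v w : ℝ),
      riemann1 (fun r => f (u, r)) (fun r => x (w, r) - x (u, r)) p m -
      riemann1 (fun r => f (u, r)) (fun r => x (v, r) - x (u, r)) p m -
      riemann1 (fun r => f (v, r)) (fun r => x (w, r) - x (v, r)) p m =
      -riemann1 (fun r => f (v, r) - f (u, r)) (fun r => x (w, r) - x (v, r)) p m := by
    intro p m u v w
    simp only [riemann1, ← Finset.sum_sub_distrib, ← Finset.sum_neg_distrib]
    exact Finset.sum_congr rfl fun j _ => by ring
  have delta : ∀ u v w, a ≤ u → u ≤ v → v ≤ w → w ≤ b →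
      φ u w - φ u v - φ v w = -ψ u v w := by
    intro u v w h1 h2 h3 h4
    have t := (((spec1 u w h1 (h2.trans h3) h4).1.sub (spec1 u v h1 h2 (h3.trans h4)).1).sub
      (spec1 v w (h1.trans h2) h3 h4).1)
    have t2 := (spec2 u v w h1 h2 h3 h4).1.neg
    refine tendsto_nhds_unique t (t2.congr fun n => ?_)
    exact (riem _ _ u v w).symm
  have φ0 : ∀ u, φ u u = 0 := by
    intro u
    refine Filter.Tendsto.limUnder_eq (tendsto_const_nhds.congr fun n => ?_)
    simp [riemann1]
  -- From the expansion of `ψ` at the lower edge: `A₁` bounds the increment of `f` at height `c`,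
  -- and `s' * A₃` the remainder, which involves rectangular increments of `f`.
  set K := X * (A₁ + (s' * A₃) * (d - c) ^ κ') * (d - c) ^ γ' with hK
  have hK0 : 0 ≤ K := by positivity
  have ψbound : ∀ u v w, a ≤ u → u ≤ v → v ≤ w → w ≤ b → |ψ u v w| ≤ K * (w - u) ^ (κ + γ) := by
    intro u v w h1 h2 h3 h4
    have e1 := (spec2 u v w h1 h2 h3 h4).2.2
    have e2 := hf.fst u v c h1 h2 (h3.trans h4) le_rfl hcd
    have e3 := HG v w (h1.trans h2) h3 h4 c d le_rfl hcd le_rfl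
    have hP := Real.rpow_nonneg (sub_nonneg.2 h2) κ
    have hQ := Real.rpow_nonneg (sub_nonneg.2 h3) γ
    have e4 : |ψ u v w| ≤ K * ((v - u) ^ κ * (w - v) ^ γ) := by
      have e5 : |(f (v, c) - f (u, c)) * (x (w, d) - x (v, d) - (x (w, c) - x (v, c)))| ≤
          (A₁ * (v - u) ^ κ) * (X * (w - v) ^ γ * (d - c) ^ γ') := by
        rw [abs_mul]
        exact mul_le_mul e2 e3 (abs_nonneg _) (mul_nonneg hA₁ hP)
      have e6 : |ψ u v w| ≤ |ψ u v w - (f (v, c) - f (u, c)) *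
          (x (w, d) - x (v, d) - (x (w, c) - x (v, c)))| +
          |(f (v, c) - f (u, c)) * (x (w, d) - x (v, d) - (x (w, c) - x (v, c)))| := by
        have := abs_add_le (ψ u v w - (f (v, c) - f (u, c)) *
          (x (w, d) - x (v, d) - (x (w, c) - x (v, c))))
          ((f (v, c) - f (u, c)) * (x (w, d) - x (v, d) - (x (w, c) - x (v, c))))
        rwa [sub_add_cancel] at this
      refine e6.trans ((add_le_add e1 e5).trans (le_of_eq ?_))
      rw [Real.rpow_add' hdc (by linarith), hK]
      ring
    refine e4.trans (mul_le_mul_of_nonneg_left (rpow_mul_rpow_le (by linarith) (by linarith)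
      (by linarith) (by linarith) hκ hγ (by linarith)) hK0)
  obtain ⟨J, hJ1, hJ2⟩ := germ_sewing (φ := φ) (a := a) (b := b) hθ hK0 φ0
    (fun u v w h1 h2 h3 h4 => by
      rw [delta u v w h1 h2 h3 h4, abs_neg]; exact ψbound u v w h1 h2 h3 h4)
  refine ⟨J, hJ1, ?_, ?_⟩
  · intro u₀ w₀ hu huw hw ε hε
    set M := s' * (A₂ * (X * (w₀ - u₀) ^ γ)) * (d - c) +
      s * (s' * (A₃ * X) * (d - c)) * (w₀ - u₀) ^ (κ + γ) with hM
    set N := s * K * (w₀ - u₀) with hN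
    obtain ⟨δ, hδ0, hδ⟩ := exists_pos_mul_rpow_lt M N (p := κ' + γ' - 1) (q := κ + γ - 1)
      (by linarith) (by linarith) hε
    refine ⟨δ, hδ0, fun p q n m hp hq => lt_of_le_of_lt ?_ hδ⟩
    -- Summing the errors of the columns one by one would only give the power `γ < 1` of their
    -- widths, useless for many thin columns. The error is therefore treated as a germ whose
    -- coboundary has order `κ + γ > 1` and a factor that is small with `δ`.
    set E : ℝ → ℝ → ℝ := fun u w =>
      riemann1 (fun r => f (u, r)) (fun r => x (w, r) - x (u, r)) q m - φ u w with hE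
    have hδp : 0 ≤ δ ^ (κ' + γ' - 1) := Real.rpow_nonneg hδ0.le _
    have E1 : |E u₀ w₀| ≤ s' * (A₂ * (X * (w₀ - u₀) ^ γ)) * δ ^ (κ' + γ' - 1) * (d - c) :=
      (spec1 u₀ w₀ hu huw hw).2.1 q m δ hq
    have E2 : ∀ u v w, u₀ ≤ u → u ≤ v → v ≤ w → w ≤ w₀ → |E u w - E u v - E v w| ≤
        (s' * (A₃ * X) * (d - c)) * δ ^ (κ' + γ' - 1) * (w - u) ^ (κ + γ) := by
      intro u v w h1 h2 h3 h4
      have e := (spec2 u v w (hu.trans h1) h2 h3 (h4.trans hw)).2.1 q m δ hq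
      have e' : E u w - E u v - E v w =
          -(riemann1 (fun r => f (v, r) - f (u, r)) (fun r => x (w, r) - x (v, r)) q m -
            ψ u v w) := by
        have := delta u v w (hu.trans h1) h2 h3 (h4.trans hw)
        have := riem q m u v w
        simp only [hE]
        linarith
      rw [e', abs_neg]
      refine e.trans ?_
      have hb := rpow_mul_rpow_le (p := v - u) (q := w - v) (r := w - u) (κ := κ) (γ := γ)
        (by linarith) (by linarith) (by linarith) (by linarith) hκ hγ (by linarith)
      calc _ = (s' * (A₃ * X) * (d - c)) * δ ^ (κ' + γ' - 1) * ((v - u) ^ κ * (w - v) ^ γ) := by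
            ring
        _ ≤ _ := mul_le_mul_of_nonneg_left hb (by positivity)
    have E0 : ∀ u, E u u = 0 := fun u => by simp [hE, φ0, riemann1]
    have d1 := germ_discrete hθ (by positivity) E0 E2 hp.truncSeq_monotone hp.truncSeq_mem n
    have h0 : truncSeq p n 0 = u₀ := by simp [truncSeq, hp.1]
    have hn : truncSeq p n n = w₀ := by simp [truncSeq, hp.2.1]
    rw [sum_truncSeq, h0, hn] at d1
    have d2 := abs_sum_germ_sub_le hθ (mul_nonneg hs0.le hK0)
      (fun u v w h1 h2 h3 h4 => hJ1 u v w (hu.trans h1) h2 h3 (h4.trans hw))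
      (fun u w h1 h2 h3 => hJ2 u w (hu.trans h1) h2 (h3.trans hw)) hp
    have e : riemannSum f x p n q m = ∑ k ∈ Finset.range n, E (p k) (p (k + 1)) +
        ∑ k ∈ Finset.range n, φ (p k) (p (k + 1)) := by
      rw [← Finset.sum_add_distrib]
      refine Finset.sum_congr rfl fun k _ => ?_
      simp only [hE, riemann1, sub_add_cancel]
      exact Finset.sum_congr rfl fun j _ => by unfold rectIncr; ring
    rw [e]
    rw [abs_le] at d1 d2 E1 ⊢
    have eM : M * δ ^ (κ' + γ' - 1) + N * δ ^ (κ + γ - 1) =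
      s' * (A₂ * (X * (w₀ - u₀) ^ γ)) * δ ^ (κ' + γ' - 1) * (d - c) +
      s * (s' * (A₃ * X) * (d - c) * δ ^ (κ' + γ' - 1)) * (w₀ - u₀) ^ (κ + γ) +
      s * K * δ ^ (κ + γ - 1) * (w₀ - u₀) := by rw [hM, hN]; ring
    rw [eM]
    constructor <;> linarith [d1.1, d1.2, d2.1, d2.2, E1.1, E1.2]
  · have e1 := (spec1 a b le_rfl hab le_rfl).2.2
    have e2 := hJ2 a b le_rfl hab le_rfl
    have e3 := HG a b le_rfl hab le_rfl c d le_rfl hcd le_rfl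
    have e4 : |f (a, c) * (x (b, d) - x (a, d) - (x (b, c) - x (a, c)))| ≤
        |f (a, c)| * (X * (b - a) ^ γ * (d - c) ^ γ') := by
      rw [abs_mul]; exact mul_le_mul_of_nonneg_left e3 (abs_nonneg _)
    set P := (b - a) ^ γ with hP
    set Q := (d - c) ^ γ' with hQ
    set p := (b - a) ^ κ with hp
    set q := (d - c) ^ κ' with hq
    have hP0 : 0 ≤ P := Real.rpow_nonneg hba _
    have hQ0 : 0 ≤ Q := Real.rpow_nonneg hdc _
    have hp0 : 0 ≤ p := Real.rpow_nonneg hba _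
    have hq0 : 0 ≤ q := Real.rpow_nonneg hdc _
    rw [Real.rpow_add' hba (by linarith)] at e2
    rw [Real.rpow_add' hdc (by linarith)] at e1
    have e5 : |J a b| ≤ |f (a, c)| * (X * P * Q) + s' * (A₂ * (X * P)) * (q * Q) +
        s * K * (p * P) := by
      change |φ a b - _| ≤ _ at e1
      rw [abs_le] at e1 e2 e4 ⊢
      constructor <;> linarith [e1.1, e1.2, e2.1, e2.2, e4.1, e4.2]
    refine e5.trans ?_
    have hXPQ : 0 ≤ X * P * Q := by positivity
    have e6 : |f (a, c)| * (X * P * Q) + s' * (A₂ * (X * P)) * (q * Q) + s * K * (p * P) =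
        (X * P * Q) * (|f (a, c)| + s' * (A₂ * q) + s * (A₁ * p) + s * s' * (A₃ * p * q)) := by
      rw [hK]; ring
    have e7 : youngConst (κ + γ) (κ' + γ') * X * P * Q *
        (|f (a, c)| + A₁ * p + A₂ * q + A₃ * p * q) = (X * P * Q) * ((1 + s) * (1 + s') *
        (|f (a, c)| + A₁ * p + A₂ * q + A₃ * p * q)) := by
      rw [youngConst]; ring
    rw [e6, e7]
    refine mul_le_mul_of_nonneg_left ?_ hXPQ
    have f0 := abs_nonneg (f (a, c))
    have f1 : 0 ≤ A₁ * p := by positivity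
    have f2 : 0 ≤ A₂ * q := by positivity
    have f3 : 0 ≤ A₃ * p * q := by positivity
    have hss : 0 ≤ s * s' := by positivity
    have i0 : |f (a, c)| ≤ (1 + s) * (1 + s') * |f (a, c)| :=
      le_mul_of_one_le_left f0 (by linarith)
    have i1 : s * (A₁ * p) ≤ (1 + s) * (1 + s') * (A₁ * p) :=
      mul_le_mul_of_nonneg_right (by linarith) f1
    have i2 : s' * (A₂ * q) ≤ (1 + s) * (1 + s') * (A₂ * q) :=
      mul_le_mul_of_nonneg_right (by linarith) f2
    have i3 : s * s' * (A₃ * p * q) ≤ (1 + s) * (1 + s') * (A₃ * p * q) :=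
      mul_le_mul_of_nonneg_right (by linarith) f3
    linarith

/-! ### Lower domains and Hölder functions on them -/

/-- A domain above the antidiagonal which contains with each point the points below it, up to the
antidiagonal, and which is bounded. -/
structure LowerDomain (D : Set (ℝ × ℝ)) (R : ℝ) : Prop where
  nonneg : ∀ u v, (u, v) ∈ D → 0 ≤ u + v
  lower : ∀ u v u' v', (u, v) ∈ D → u' ≤ u → v' ≤ v → 0 ≤ u' + v' → (u', v') ∈ D
  bdd : ∀ u v, (u, v) ∈ D → u ≤ R ∧ v ≤ R

/-- Hölder bounds on a domain. -/
structure HolderDom (D : Set (ℝ × ℝ)) (κ κ' A : ℝ) (f : ℝ × ℝ → ℝ) : Prop where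
  fst : ∀ a b t, a ≤ b → (a, t) ∈ D → (b, t) ∈ D → |f (b, t) - f (a, t)| ≤ A * (b - a) ^ κ
  snd : ∀ s c d, c ≤ d → (s, c) ∈ D → (s, d) ∈ D → |f (s, d) - f (s, c)| ≤ A * (d - c) ^ κ'
  rect : ∀ a b c d, a ≤ b → c ≤ d → 0 ≤ a + c → (b, d) ∈ D →
    |rectIncr f a b c d| ≤ A * (b - a) ^ κ * (d - c) ^ κ'

/-- Hölder bound for the rectangular increments on a domain. -/
def RectDom (D : Set (ℝ × ℝ)) (γ γ' X : ℝ) (x : ℝ × ℝ → ℝ) : Prop :=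
  ∀ a b c d, a ≤ b → c ≤ d → 0 ≤ a + c → (b, d) ∈ D →
    |rectIncr x a b c d| ≤ X * (b - a) ^ γ * (d - c) ^ γ'

/-- Hölder bounds at scales below `h`, weighted by a function of `u + v` at the upper right
corner. -/
structure SemiDom (D : Set (ℝ × ℝ)) (κ κ' h A : ℝ) (ω : ℝ → ℝ) (f : ℝ × ℝ → ℝ) : Prop where
  fst : ∀ a b t, a ≤ b → b - a ≤ h → (a, t) ∈ D → (b, t) ∈ D →
    |f (b, t) - f (a, t)| ≤ A * ω (b + t) * ((b - a) / h) ^ κ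
  snd : ∀ s c d, c ≤ d → d - c ≤ h → (s, c) ∈ D → (s, d) ∈ D →
    |f (s, d) - f (s, c)| ≤ A * ω (s + d) * ((d - c) / h) ^ κ'
  rect : ∀ a b c d, a ≤ b → c ≤ d → b - a ≤ h → d - c ≤ h → 0 ≤ a + c → (b, d) ∈ D →
    |rectIncr f a b c d| ≤ A * ω (b + d) * ((b - a) / h) ^ κ * ((d - c) / h) ^ κ'

/-- Weighted bound for a function and its Hölder increments at scales below `h`. -/
structure CtrlDom (D : Set (ℝ × ℝ)) (κ κ' h A : ℝ) (ω : ℝ → ℝ) (f : ℝ × ℝ → ℝ) : Prop extends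
    SemiDom D κ κ' h A ω f where
  sup : ∀ u v, (u, v) ∈ D → |f (u, v)| ≤ A * ω (u + v)

/-! ### Symmetry under exchange of the two variables -/

section Swap

variable {D : Set (ℝ × ℝ)} {R κ κ' γ γ' h A X : ℝ} {ω : ℝ → ℝ} {f x : ℝ × ℝ → ℝ}

lemma LowerDomain.swap (hD : LowerDomain D R) : LowerDomain (Prod.swap ⁻¹' D) R where
  nonneg u v h := by linarith [hD.nonneg v u h]
  lower u v u' v' h h1 h2 h3 := hD.lower v u v' u' h h2 h1 (by linarith)
  bdd u v h := (hD.bdd v u h).symm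

lemma RectDom.swap (hx : RectDom D γ γ' X x) :
    RectDom (Prod.swap ⁻¹' D) γ' γ X (x ∘ Prod.swap) := fun a b c d h1 h2 h3 h4 => by
  rw [rectIncr_swap]
  exact (hx c d a b h2 h1 (by linarith) h4).trans (le_of_eq (by ring))

lemma SemiDom.swap (hf : SemiDom D κ κ' h A ω f) :
    SemiDom (Prod.swap ⁻¹' D) κ' κ h A ω (f ∘ Prod.swap) where
  fst a b t h1 h2 h3 h4 := by
    rw [add_comm b t]; exact hf.snd t a b h1 h2 h3 h4
  snd s c d h1 h2 h3 h4 := by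
    rw [add_comm s d]; exact hf.fst c d s h1 h2 h3 h4
  rect a b c d h1 h2 h3 h4 h5 h6 := by
    rw [rectIncr_swap, add_comm b d]
    exact (hf.rect c d a b h2 h1 h4 h3 (by linarith) h6).trans (le_of_eq (by ring))

lemma CtrlDom.swap (hf : CtrlDom D κ κ' h A ω f) :
    CtrlDom (Prod.swap ⁻¹' D) κ' κ h A ω (f ∘ Prod.swap) where
  toSemiDom := hf.toSemiDom.swap
  sup u v huv := by rw [add_comm u v]; exact hf.sup v u huv

end Swap

lemma LowerDomain.mem_of_rect {D : Set (ℝ × ℝ)} {R : ℝ} (hD : LowerDomain D R) {a b c d u v : ℝ}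
    (hac : 0 ≤ a + c) (hbd : (b, d) ∈ D) (h1 : a ≤ u) (h2 : u ≤ b) (h3 : c ≤ v) (h4 : v ≤ d) :
    (u, v) ∈ D :=
  hD.lower b d u v hbd h2 h4 (by linarith)

lemma HolderDom.rectHolder {D : Set (ℝ × ℝ)} {R κ κ' A : ℝ} {f : ℝ × ℝ → ℝ}
    (hD : LowerDomain D R) (hf : HolderDom D κ κ' A f) {a b c d : ℝ} (hac : 0 ≤ a + c)
    (hbd : (b, d) ∈ D) : RectHolder f a b c d A A A κ κ' where
  fst u u' v h1 h2 h3 h4 h5 := hf.fst u u' v h2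
    (hD.mem_of_rect hac hbd h1 (h2.trans h3) h4 h5) (hD.mem_of_rect hac hbd (h1.trans h2) h3 h4 h5)
  snd u v v' h1 h2 h3 h4 h5 := hf.snd u v v' h4
    (hD.mem_of_rect hac hbd h1 h2 h3 (h4.trans h5)) (hD.mem_of_rect hac hbd h1 h2 (h3.trans h4) h5)
  rect u u' v v' h1 h2 h3 h4 h5 h6 := hf.rect u u' v v' h2 h5 (by linarith)
    (hD.mem_of_rect hac hbd (h1.trans h2) h3 (h4.trans h5) h6)

lemma RectDom.rectBound {D : Set (ℝ × ℝ)} {R γ γ' X : ℝ} {x : ℝ × ℝ → ℝ}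
    (hD : LowerDomain D R) (hx : RectDom D γ γ' X x) {a b c d : ℝ} (hac : 0 ≤ a + c)
    (hbd : (b, d) ∈ D) : RectBound x a b c d X γ γ' :=
  fun u u' v v' h1 h2 h3 h4 h5 h6 => hx u u' v v' h2 h5 (by linarith)
    (hD.mem_of_rect hac hbd (h1.trans h2) h3 (h4.trans h5) h6)

/-- Exponents of the integrand and of the integrator for which the Young integral exists. -/
structure YoungExp (κ κ' γ γ' : ℝ) : Prop where
  κ_nonneg : 0 ≤ κ
  κ'_nonneg : 0 ≤ κ'
  γ_pos : 0 < γ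
  γ'_pos : 0 < γ'
  fst : 1 < κ + γ
  snd : 1 < κ' + γ'
  sum : 1 < γ + γ'

lemma YoungExp.swap {κ κ' γ γ' : ℝ} (h : YoungExp κ κ' γ γ') : YoungExp κ' κ γ' γ :=
  ⟨h.κ'_nonneg, h.κ_nonneg, h.γ'_pos, h.γ_pos, h.snd, h.fst, by linarith [h.sum]⟩

/-! ### Primitives -/

/-- `Y` is the primitive of `f dx`: its rectangular increments are the Young integrals, and it
vanishes on the antidiagonal to the order `γ + γ'`. -/
structure IsPrimitive (D : Set (ℝ × ℝ)) (γ γ' : ℝ) (f x Y : ℝ × ℝ → ℝ) : Prop where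
  rect : ∀ a b c d, a ≤ b → c ≤ d → 0 ≤ a + c → (b, d) ∈ D →
    HasYoungIntegral f x a b c d (rectIncr Y a b c d)
  bound : ∃ C, ∀ u v, (u, v) ∈ D → |Y (u, v)| ≤ C * (u + v) ^ (γ + γ')

lemma IsPrimitive.sub {D : Set (ℝ × ℝ)} {γ γ' : ℝ} {f g x Y Z : ℝ × ℝ → ℝ}
    (hY : IsPrimitive D γ γ' f x Y) (hZ : IsPrimitive D γ γ' g x Z) :
    IsPrimitive D γ γ' (f - g) x (Y - Z) where
  rect a b c d h1 h2 h3 h4 := by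
    have := (hY.rect a b c d h1 h2 h3 h4).sub (hZ.rect a b c d h1 h2 h3 h4)
    rwa [show rectIncr Y a b c d - rectIncr Z a b c d = rectIncr (Y - Z) a b c d by
      simp only [rectIncr, Pi.sub_apply]; ring] at this
  bound := by
    obtain ⟨C, hC⟩ := hY.bound
    obtain ⟨C', hC'⟩ := hZ.bound
    refine ⟨C + C', fun u v h => ?_⟩
    rw [Pi.sub_apply, add_mul]
    exact (abs_sub _ _).trans (add_le_add (hC u v h) (hC' u v h))

lemma IsPrimitive.congr {D : Set (ℝ × ℝ)} {R γ γ' : ℝ} {f g x Y : ℝ × ℝ → ℝ}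
    (hD : LowerDomain D R) (hY : IsPrimitive D γ γ' f x Y) (hfg : EqOn f g D) :
    IsPrimitive D γ γ' g x Y where
  rect a b c d h1 h2 h3 h4 := (hY.rect a b c d h1 h2 h3 h4).congr
    fun _ _ i1 i2 i3 i4 => hfg (hD.mem_of_rect h3 h4 i1 i2 i3 i4)
  bound := hY.bound

lemma IsPrimitive.congr_right {D : Set (ℝ × ℝ)} {R γ γ' : ℝ} {f x Y Z : ℝ × ℝ → ℝ}
    (hD : LowerDomain D R) (hY : IsPrimitive D γ γ' f x Y) (hYZ : EqOn Y Z D) :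
    IsPrimitive D γ γ' f x Z where
  rect a b c d h1 h2 h3 h4 := by
    have m : ∀ u v, a ≤ u → u ≤ b → c ≤ v → v ≤ d → Y (u, v) = Z (u, v) :=
      fun u v i1 i2 i3 i4 => hYZ (hD.mem_of_rect h3 h4 i1 i2 i3 i4)
    have := hY.rect a b c d h1 h2 h3 h4
    rwa [rectIncr, m a c le_rfl h1 le_rfl h2, m a d le_rfl h1 h2 le_rfl, m b c h1 le_rfl le_rfl h2,
      m b d h1 le_rfl h2 le_rfl] at this
  bound := by
    obtain ⟨C, hC⟩ := hY.bound
    exact ⟨C, fun u v h => by rw [← hYZ h]; exact hC u v h⟩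

lemma IsPrimitive.swap {D : Set (ℝ × ℝ)} {γ γ' : ℝ} {f x Y : ℝ × ℝ → ℝ}
    (hY : IsPrimitive D γ γ' f x Y) :
    IsPrimitive (Prod.swap ⁻¹' D) γ' γ (f ∘ Prod.swap) (x ∘ Prod.swap) (Y ∘ Prod.swap) where
  rect a b c d h1 h2 h3 h4 := by
    rw [rectIncr_swap]
    refine HasYoungIntegral.swap ?_
    exact hY.rect c d a b h2 h1 (by linarith) h4
  bound := by
    obtain ⟨C, hC⟩ := hY.bound
    refine ⟨C, fun u v h => ?_⟩
    rw [add_comm γ', add_comm u]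
    exact hC v u h

lemma IsPrimitive.diag {D : Set (ℝ × ℝ)} {γ γ' : ℝ} {f x Y : ℝ × ℝ → ℝ}
    (hY : IsPrimitive D γ γ' f x Y) (hγ : 0 < γ + γ') {u v : ℝ} (huv : (u, v) ∈ D)
    (h0 : u + v = 0) : Y (u, v) = 0 := by
  obtain ⟨C, hC⟩ := hY.bound
  have := hC u v huv
  rw [h0, Real.zero_rpow hγ.ne', mul_zero] at this
  exact abs_eq_zero.1 (le_antisymm this (abs_nonneg _))

/-- A choice of the Young integral on a rectangle. -/
def yint (f x : ℝ × ℝ → ℝ) (a b c d : ℝ) : ℝ := Classical.epsilon (HasYoungIntegral f x a b c d)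

/-! ### Young integrals over rectangles of the domain, and existence of the primitive -/

section YoungDomain

variable {D : Set (ℝ × ℝ)} {R κ κ' γ γ' A B X : ℝ} {f x : ℝ × ℝ → ℝ}

lemma young_estimate {a b c d A₁ A₂ A₃ z : ℝ} (he : YoungExp κ κ' γ γ')
    (hab : a ≤ b) (hcd : c ≤ d) (hA₁ : 0 ≤ A₁) (hA₂ : 0 ≤ A₂) (hA₃ : 0 ≤ A₃) (hX : 0 ≤ X)
    (hf : RectHolder f a b c d A₁ A₂ A₃ κ κ') (hx : RectBound x a b c d X γ γ')
    (hz : HasYoungIntegral f x a b c d z) :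
    |z| ≤ youngConst (κ + γ) (κ' + γ') * X * (b - a) ^ γ * (d - c) ^ γ' *
        (|f (a, c)| + A₁ * (b - a) ^ κ + A₂ * (d - c) ^ κ' +
          A₃ * (b - a) ^ κ * (d - c) ^ κ') := by
  obtain ⟨J, -, h2, h3⟩ := exists_young2 hab hcd hA₁ hA₂ hA₃ hX he.κ_nonneg he.κ'_nonneg
    he.γ_pos.le he.γ'_pos.le he.fst he.snd hf hx
  rwa [hz.unique hab hcd (h2 a b le_rfl hab le_rfl)]

lemma hasYoungIntegral_yint (he : YoungExp κ κ' γ γ') (hD : LowerDomain D R) (hA : 0 ≤ A)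
    (hX : 0 ≤ X) (hf : HolderDom D κ κ' A f) (hx : RectDom D γ γ' X x)
    {a b c d : ℝ} (hab : a ≤ b) (hcd : c ≤ d) (hac : 0 ≤ a + c)
    (hbd : (b, d) ∈ D) : HasYoungIntegral f x a b c d (yint f x a b c d) := by
  obtain ⟨J, -, h2, -⟩ := exists_young2 hab hcd hA hA hA hX he.κ_nonneg he.κ'_nonneg
    he.γ_pos.le he.γ'_pos.le he.fst he.snd (hf.rectHolder hD hac hbd) (hx.rectBound hD hac hbd)
  exact Classical.epsilon_spec ⟨_, h2 a b le_rfl hab le_rfl⟩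

lemma yint_add_fst (he : YoungExp κ κ' γ γ') (hD : LowerDomain D R) (hA : 0 ≤ A)
    (hX : 0 ≤ X) (hf : HolderDom D κ κ' A f) (hx : RectDom D γ γ' X x)
    {a m b c d : ℝ} (ham : a ≤ m) (hmb : m ≤ b) (hcd : c ≤ d) (hac : 0 ≤ a + c)
    (hbd : (b, d) ∈ D) : yint f x a b c d = yint f x a m c d + yint f x m b c d := by
  have hab := ham.trans hmb
  obtain ⟨J, h1, h2, -⟩ := exists_young2 hab hcd hA hA hA hX he.κ_nonneg he.κ'_nonneg
    he.γ_pos.le he.γ'_pos.le he.fst he.snd (hf.rectHolder hD hac hbd) (hx.rectBound hD hac hbd)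
  have hmd := hD.mem_of_rect hac hbd ham hmb hcd le_rfl
  rw [(hasYoungIntegral_yint he hD hA hX hf hx hab hcd hac hbd).unique hab hcd
      (h2 a b le_rfl hab le_rfl),
    (hasYoungIntegral_yint he hD hA hX hf hx ham hcd hac hmd).unique ham hcd
      (h2 a m le_rfl ham hmb),
    (hasYoungIntegral_yint he hD hA hX hf hx hmb hcd (by linarith) hbd).unique hmb hcd
      (h2 m b ham hmb le_rfl)]
  exact h1 a m b le_rfl ham hmb le_rfl

lemma yint_add_snd (he : YoungExp κ κ' γ γ') (hD : LowerDomain D R) (hA : 0 ≤ A)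
    (hX : 0 ≤ X) (hf : HolderDom D κ κ' A f) (hx : RectDom D γ γ' X x)
    {a b c m d : ℝ} (hab : a ≤ b) (hcm : c ≤ m) (hmd : m ≤ d) (hac : 0 ≤ a + c)
    (hbd : (b, d) ∈ D) : yint f x a b c d = yint f x a b c m + yint f x a b m d := by
  have hcd := hcm.trans hmd
  obtain ⟨J, h1, h2, -⟩ := exists_young2 hcd hab hA hA hA hX he.κ'_nonneg he.κ_nonneg
    he.γ'_pos.le he.γ_pos.le he.snd he.fst (hf.rectHolder hD hac hbd).swap
    (hx.rectBound hD hac hbd).swap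
  have hbm := hD.mem_of_rect hac hbd hab le_rfl hcm hmd
  rw [(hasYoungIntegral_yint he hD hA hX hf hx hab hcd hac hbd).unique hab hcd
      (h2 c d le_rfl hcd le_rfl).swap,
    (hasYoungIntegral_yint he hD hA hX hf hx hab hcm hac hbm).unique hab hcm
      (h2 c m le_rfl hcm hmd).swap,
    (hasYoungIntegral_yint he hD hA hX hf hx hab hmd (by linarith) hbd).unique hab hmd
      (h2 m d hcm hmd le_rfl).swap]
  exact h1 c m d le_rfl hcm hmd le_rfl

/-- Cones are parametrized by the ends of their diagonal side: `y u w` stands for the integral over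
the cone with vertex `(w, -u)`. The cocycle relation for the rectangles `[v, w] × [-v, -u]`
expresses two ways of cutting one staircase region into two rectangles, and follows from additivity
in each variable. -/
theorem exists_primitive (he : YoungExp κ κ' γ γ') (hD : LowerDomain D R) (hA : 0 ≤ A)
    (hX : 0 ≤ X) (hf : HolderDom D κ κ' A f) (hx : RectDom D γ γ' X x)
    (hB : ∀ u v, (u, v) ∈ D → |f (u, v)| ≤ B) :
    ∃ Y, IsPrimitive D γ γ' f x Y := by
  set h : ℝ → ℝ → ℝ → ℝ := fun u v w => yint f x v w (-v) (-u) with hh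
  -- The sides of the rectangles are at most `2 * R`, since both coordinates are at most `R` and the
  -- lower left corner is not below the antidiagonal. The maximum keeps `L` nonnegative when `R <
  -- 0`, where the domain is empty.
  set L := max (2 * R) 0 with hL
  set K := youngConst (κ + γ) (κ' + γ') * X * (|B| + A * L ^ κ + A * L ^ κ' + A * L ^ κ * L ^ κ')
    with hK
  have hL0 : 0 ≤ L := le_max_right _ _
  have hyc := youngConst_pos he.fst he.snd
  have hK0 : 0 ≤ K := by positivity
  have hcoc : ∀ a b, (b, -a) ∈ D → IsCocycle h a b K (γ + γ') := by
    intro a b hab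
    have hmem : ∀ u w, a ≤ u → u ≤ w → w ≤ b → (w, -u) ∈ D := fun u w h1 h2 h3 =>
      hD.lower b (-a) w (-u) hab h3 (by linarith) (by linarith)
    have hzero : ∀ u v w, a ≤ u → u ≤ v → v ≤ w → w ≤ b → (u = v ∨ v = w) → h u v w = 0 := by
      rintro u v w h1 h2 h3 h4 (rfl | rfl)
      · have := yint_add_snd he hD hA hX hf hx h3 (le_refl (-u)) (le_refl (-u))
          (by linarith) (hmem u w h1 h3 h4)
        simp only [hh]; linarith
      · have := yint_add_fst he hD hA hX hf hx (le_refl v) (le_refl v)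
          (show -v ≤ -u by linarith) (by linarith) (hmem u v h1 h2 h4)
        simp only [hh]; linarith
    refine ⟨?_, fun u w h1 h2 h3 => hzero u u w h1 le_rfl h2 h3 (Or.inl rfl),
      fun u w h1 h2 h3 => hzero u w w h1 h2 le_rfl h3 (Or.inr rfl), ?_⟩
    · intro u v w z h1 h2 h3 h4 h5
      have e1 := yint_add_fst he hD hA hX hf hx h3 h4 (show -v ≤ -u by linarith) (by linarith)
        (hmem u z h1 (by linarith) h5)
      have e2 := yint_add_snd he hD hA hX hf hx h4 (show -w ≤ -v by linarith)
        (show -v ≤ -u by linarith) (by linarith) (hmem u z h1 (by linarith) h5)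
      simp only [hh]; linarith
    · intro u v w h1 h2 h3 h4
      have hm := hmem u w h1 (h2.trans h3) h4
      have hm' := hmem v w (h1.trans h2) h3 h4
      have hm'' := hmem v v (h1.trans h2) le_rfl (h3.trans h4)
      have hm3 := hmem u v h1 h2 (h3.trans h4)
      have e := young_estimate he h3 (show -v ≤ -u by linarith) hA hA hA hX
        (hf.rectHolder hD (by linarith) hm) (hx.rectBound hD (by linarith) hm)
        (hasYoungIntegral_yint he hD hA hX hf hx h3 (show -v ≤ -u by linarith) (by linarith) hm)
      have b1 := hD.bdd _ _ hm
      have b2 := hD.bdd _ _ hm''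
      have b3 := hD.nonneg _ _ hm3
      have l1 : w - v ≤ L := le_trans (by linarith [b1.1, b2.2]) (le_max_left _ _)
      have l2 : -u - -v ≤ L := le_trans (by linarith [b1.2, b2.1]) (le_max_left _ _)
      have n1 : 0 ≤ w - v := by linarith
      have n2 : 0 ≤ -u - -v := by linarith
      have hfB : |f (v, -v)| ≤ |B| := (hB _ _ hm'').trans (le_abs_self B)
      have r1 := Real.rpow_le_rpow n1 l1 he.κ_nonneg
      have r2 := Real.rpow_le_rpow n2 l2 he.κ'_nonneg
      have q1 := Real.rpow_nonneg n1 κ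
      have q2 := Real.rpow_nonneg n2 κ'
      have q3 := Real.rpow_nonneg n1 γ
      have q4 := Real.rpow_nonneg n2 γ'
      have hsum := rpow_mul_rpow_le n1 n2 (show w - v ≤ w - u by linarith)
        (show -u - -v ≤ w - u by linarith) he.γ_pos.le he.γ'_pos.le (by linarith [he.sum])
      calc |h u v w| ≤ _ := e
        _ ≤ youngConst (κ + γ) (κ' + γ') * X * (w - v) ^ γ * (-u - -v) ^ γ' *
            (|B| + A * L ^ κ + A * L ^ κ' + A * L ^ κ * L ^ κ') := by gcongr
        _ = K * ((w - v) ^ γ * (-u - -v) ^ γ') := by rw [hK]; ring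
        _ ≤ _ := mul_le_mul_of_nonneg_left hsum hK0
  obtain ⟨y, hy1, hy2⟩ := exists_sewing (S := fun u w => (w, -u) ∈ D) (R := R) he.sum hK0
    (fun a b u w hab h1 h2 h3 => hD.lower b (-a) w (-u) hab h3 (by linarith) (by linarith))
    (fun a b hab => ⟨by linarith [(hD.bdd _ _ hab).2], by linarith [hD.nonneg _ _ hab],
      (hD.bdd _ _ hab).1⟩) hcoc
  refine ⟨fun p => y (-p.2) p.1, ⟨fun a b c d h1 h2 h3 h4 => ?_,
    sewConst (γ + γ') * K, fun u v huv => ?_⟩⟩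
  · have e1 := hy1 (-d) a b (by linarith) h1 (by simpa using h4)
    have e2 := hy1 (-c) a b (by linarith) h1
      (by simpa using hD.mem_of_rect h3 h4 h1 le_rfl le_rfl h2)
    have e3 := yint_add_snd he hD hA hX hf hx h1 (show -a ≤ c by linarith) h2 (by linarith) h4
    have e : rectIncr (fun p => y (-p.2) p.1) a b c d = yint f x a b c d := by
      simp only [hh, neg_neg] at e1 e2
      simp only [rectIncr]
      linarith
    rw [e]
    exact hasYoungIntegral_yint he hD hA hX hf hx h1 h2 h3 h4
  · have := hy2 (-v) u (by simpa using huv)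
    simpa using this

end YoungDomain

/-! ### Scaled estimates for primitives -/

section Estimates

variable {D : Set (ℝ × ℝ)} {R κ κ' γ γ' h A X : ℝ} {ω Ω : ℝ → ℝ} {f x Y : ℝ × ℝ → ℝ}

lemma div_rpow_mul_rpow {r h κ : ℝ} (hr : 0 ≤ r) (hh : 0 < h) : r ^ κ = h ^ κ * (r / h) ^ κ := by
  rw [← Real.mul_rpow hh.le (div_nonneg hr hh.le), mul_div_cancel₀ _ hh.ne']

/-- At scales below `h` each of the four terms in the Young estimate is at most `A * ω (b + d)`,
because `ω` is monotone and `u + v` is largest at the upper right corner. This explains the factor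
`4`. -/
lemma CtrlDom.rect_estimate (he : YoungExp κ κ' γ γ') (hD : LowerDomain D R) (hh : 0 < h)
    (hA : 0 ≤ A) (hX : 0 ≤ X) (hω : Monotone ω) (hω0 : ∀ τ, 0 ≤ ω τ)
    (hf : CtrlDom D κ κ' h A ω f) (hx : RectDom D γ γ' X x) (hY : IsPrimitive D γ γ' f x Y)
    {a b c d : ℝ} (hab : a ≤ b) (hcd : c ≤ d) (hbah : b - a ≤ h) (hdch : d - c ≤ h)
    (hac : 0 ≤ a + c) (hbd : (b, d) ∈ D) :
    |rectIncr Y a b c d| ≤ 4 * youngConst (κ + γ) (κ' + γ') * X * A * ω (b + d) *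
      (b - a) ^ γ * (d - c) ^ γ' := by
  set W := A * ω (b + d) with hW
  have hW0 : 0 ≤ W := mul_nonneg hA (hω0 _)
  have wle : ∀ τ, τ ≤ b + d → A * ω τ ≤ W := fun τ hτ => mul_le_mul_of_nonneg_left (hω hτ) hA
  have hκ := Real.rpow_pos_of_pos hh κ
  have hκ' := Real.rpow_pos_of_pos hh κ'
  have hr : RectHolder f a b c d (W / h ^ κ) (W / h ^ κ') (W / (h ^ κ * h ^ κ')) κ κ' := by
    refine ⟨fun u u' v h1 h2 h3 h4 h5 => ?_, fun u v v' h1 h2 h3 h4 h5 => ?_,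
      fun u u' v v' h1 h2 h3 h4 h5 h6 => ?_⟩
    · have e := hf.fst u u' v h2 (by linarith) (hD.mem_of_rect hac hbd h1 (h2.trans h3) h4 h5)
        (hD.mem_of_rect hac hbd (h1.trans h2) h3 h4 h5)
      have n := sub_nonneg.2 h2
      rw [div_rpow_mul_rpow n hh, ← mul_assoc, div_mul_cancel₀ _ hκ.ne']
      exact e.trans (mul_le_mul_of_nonneg_right (wle _ (by linarith))
        (Real.rpow_nonneg (div_nonneg n hh.le) _))
    · have e := hf.snd u v v' h4 (by linarith) (hD.mem_of_rect hac hbd h1 h2 h3 (h4.trans h5))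
        (hD.mem_of_rect hac hbd h1 h2 (h3.trans h4) h5)
      have n := sub_nonneg.2 h4
      rw [div_rpow_mul_rpow n hh, ← mul_assoc, div_mul_cancel₀ _ hκ'.ne']
      exact e.trans (mul_le_mul_of_nonneg_right (wle _ (by linarith))
        (Real.rpow_nonneg (div_nonneg n hh.le) _))
    · have e := hf.rect u u' v v' h2 h5 (by linarith) (by linarith) (by linarith)
        (hD.mem_of_rect hac hbd (h1.trans h2) h3 (h4.trans h5) h6)
      have n := sub_nonneg.2 h2
      have n' := sub_nonneg.2 h5
      have e' : W / (h ^ κ * h ^ κ') * (u' - u) ^ κ * (v' - v) ^ κ' =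
          W * ((u' - u) / h) ^ κ * ((v' - v) / h) ^ κ' := by
        rw [div_rpow_mul_rpow n hh, div_rpow_mul_rpow n' hh]; field_simp
      rw [e']
      refine e.trans ?_
      have := Real.rpow_nonneg (div_nonneg n hh.le) κ
      have := Real.rpow_nonneg (div_nonneg n' hh.le) κ'
      have := wle (u' + v') (by linarith)
      gcongr
  have e := young_estimate he hab hcd (div_nonneg hW0 hκ.le) (div_nonneg hW0 hκ'.le)
    (div_nonneg hW0 (mul_pos hκ hκ').le) hX hr (hx.rectBound hD hac hbd)
    (hY.rect a b c d hab hcd hac hbd)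
  have nba := sub_nonneg.2 hab
  have ndc := sub_nonneg.2 hcd
  have s1 : (b - a) ^ κ ≤ h ^ κ := Real.rpow_le_rpow nba hbah he.κ_nonneg
  have s2 : (d - c) ^ κ' ≤ h ^ κ' := Real.rpow_le_rpow ndc hdch he.κ'_nonneg
  have n1 := Real.rpow_nonneg nba κ
  have n2 := Real.rpow_nonneg ndc κ'
  have t0 : |f (a, c)| ≤ W := (hf.sup a c (hD.mem_of_rect hac hbd le_rfl hab le_rfl hcd)).trans
    (wle _ (by linarith))
  have t1 : W / h ^ κ * (b - a) ^ κ ≤ W := by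
    rw [div_mul_eq_mul_div, div_le_iff₀ hκ]; gcongr
  have t2 : W / h ^ κ' * (d - c) ^ κ' ≤ W := by
    rw [div_mul_eq_mul_div, div_le_iff₀ hκ']; gcongr
  have t3 : W / (h ^ κ * h ^ κ') * (b - a) ^ κ * (d - c) ^ κ' ≤ W := by
    rw [div_mul_eq_mul_div, div_mul_eq_mul_div, div_le_iff₀ (mul_pos hκ hκ'), mul_assoc]; gcongr
  have hyc := youngConst_pos he.fst he.snd
  have n3 := Real.rpow_nonneg nba γ
  have n4 := Real.rpow_nonneg ndc γ'
  calc _ ≤ _ := e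
    _ ≤ youngConst (κ + γ) (κ' + γ') * X * (b - a) ^ γ * (d - c) ^ γ' * (4 * W) :=
        mul_le_mul_of_nonneg_left (by linarith) (by positivity)
    _ = _ := by rw [hW]; ring

/-- The decomposition of a triangle into two triangles and a rectangle: the corner `(v, -v)` of the
rectangle lies on the antidiagonal, where `Y` vanishes. -/
lemma IsPrimitive.coboundary (hY : IsPrimitive D γ γ' f x Y) (hγ : 0 < γ + γ') {u v w : ℝ}
    (hv : (v, -v) ∈ D) : Y (w, -u) = Y (v, -u) + Y (w, -v) + rectIncr Y v w (-v) (-u) := by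
  have := hY.diag hγ hv (by ring)
  rw [rectIncr, this]; ring

/-- The constant in the decay of a primitive is arbitrary, but the decay has order greater than one.
`abs_le_of_coboundary` therefore replaces it by the constant of the rectangle estimate. -/
lemma CtrlDom.triangle_estimate (he : YoungExp κ κ' γ γ') (hD : LowerDomain D R) (hh : 0 < h)
    (hA : 0 ≤ A) (hX : 0 ≤ X) (hω : Monotone ω) (hω0 : ∀ τ, 0 ≤ ω τ)
    (hf : CtrlDom D κ κ' h A ω f) (hx : RectDom D γ γ' X x) (hY : IsPrimitive D γ γ' f x Y)
    {a b : ℝ} (hab : a ≤ b) (hbah : b - a ≤ h) (hbd : (b, -a) ∈ D) :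
    |Y (b, -a)| ≤ sewConst (γ + γ') * (4 * youngConst (κ + γ) (κ' + γ') * X * A * ω (b - a)) *
      (b - a) ^ (γ + γ') := by
  have hyc := youngConst_pos he.fst he.snd
  have hγ : 0 < γ + γ' := by linarith [he.sum]
  set K := 4 * youngConst (κ + γ) (κ' + γ') * X * A * ω (b - a) with hK
  have hK0 : 0 ≤ K := mul_nonneg (by positivity) (hω0 _)
  have hmem : ∀ u w, a ≤ u → u ≤ w → w ≤ b → (w, -u) ∈ D := fun u w h1 h2 h3 =>
    hD.lower b (-a) w (-u) hbd h3 (by linarith) (by linarith)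
  have h0 : ∀ u, a ≤ u → u ≤ b → Y (u, -u) = 0 := fun u h1 h2 =>
    hY.diag hγ (hmem u u h1 le_rfl h2) (by ring)
  obtain ⟨C, hC⟩ := hY.bound
  refine abs_le_of_coboundary (y := fun u w => Y (w, -u)) (θ' := γ + γ') (C := C)
    (h := fun u v w => Y (w, -u) - Y (v, -u) - Y (w, -v))
    hab he.sum he.sum hK0 (isCocycle_of_germ (φ := fun u w => Y (w, -u)) h0
      fun u v w h1 h2 h3 h4 => ?_) (fun u v w h1 h2 h3 h4 => by ring)
      fun u w h1 h2 h3 => by simpa [sub_eq_add_neg] using hC w (-u) (hmem u w h1 h2 h3)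
  have e := hY.coboundary hγ (u := u) (w := w) (hmem v v (h1.trans h2) le_rfl (h3.trans h4))
  have e1 := hf.rect_estimate he hD hh hA hX hω hω0 hx hY h3 (show -v ≤ -u by linarith)
    (by linarith) (by linarith) (by linarith) (hmem u w h1 (h2.trans h3) h4)
  have e2 : Y (w, -u) - Y (v, -u) - Y (w, -v) = rectIncr Y v w (-v) (-u) := by rw [e]; ring
  change |Y (w, -u) - Y (v, -u) - Y (w, -v)| ≤ _
  rw [e2]
  have hsum := rpow_mul_rpow_le (p := w - v) (q := -u - -v) (r := w - u) (by linarith)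
    (by linarith) (by linarith) (by linarith) he.γ_pos.le he.γ'_pos.le hγ
  have n1 : 0 ≤ (w - v) ^ γ * (-u - -v) ^ γ' :=
    mul_nonneg (Real.rpow_nonneg (by linarith) _) (Real.rpow_nonneg (by linarith) _)
  have hωle : ω (w + -u) ≤ ω (b - a) := hω (by linarith)
  calc _ ≤ _ := e1
    _ = 4 * youngConst (κ + γ) (κ' + γ') * X * A * ω (w + -u) *
        ((w - v) ^ γ * (-u - -v) ^ γ') := by ring
    _ ≤ K * ((w - v) ^ γ * (-u - -v) ^ γ') := by rw [hK]; gcongr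
    _ ≤ _ := mul_le_mul_of_nonneg_left hsum hK0

/-- A weight `Ω` that dominates the sums of `ω` along steps of length `h`. -/
structure WeightSum (h : ℝ) (ω Ω : ℝ → ℝ) : Prop where
  mono : Monotone ω
  nonneg : ∀ τ, 0 ≤ ω τ
  le : ∀ τ, 0 ≤ τ → ω τ ≤ Ω τ
  add_le : ∀ τ, h ≤ τ → Ω (τ - h) + ω τ ≤ Ω τ

/-- Descend through the strip in steps of length `h` until the remaining height is at most `h`. The
weights of the pieces add up through `Ω (τ - h) + ω τ ≤ Ω τ`; `n` only bounds the number of steps.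
-/
lemma CtrlDom.strip_estimate (he : YoungExp κ κ' γ γ') (hD : LowerDomain D R) (hh : 0 < h)
    (hA : 0 ≤ A) (hX : 0 ≤ X) (hω : WeightSum h ω Ω)
    (hf : CtrlDom D κ κ' h A ω f) (hx : RectDom D γ γ' X x) (hY : IsPrimitive D γ γ' f x Y)
    {a b : ℝ} (hab : a ≤ b) (hbah : b - a ≤ h) (n : ℕ) :
    ∀ t, 0 ≤ a + t → a + t ≤ n * h → (b, t) ∈ D → |rectIncr Y a b (-a) t| ≤
      4 * youngConst (κ + γ) (κ' + γ') * X * A * (b - a) ^ γ * h ^ γ' * Ω (b + t) := by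
  have hyc := youngConst_pos he.fst he.snd
  have nba := Real.rpow_nonneg (sub_nonneg.2 hab) γ
  have hhγ := Real.rpow_nonneg hh.le γ'
  have piece : ∀ c t, c ≤ t → t - c ≤ h → 0 ≤ a + c → (b, t) ∈ D → |rectIncr Y a b c t| ≤
      4 * youngConst (κ + γ) (κ' + γ') * X * A * (b - a) ^ γ * h ^ γ' * ω (b + t) := by
    intro c t h1 h2 h3 h4
    have e := hf.rect_estimate he hD hh hA hX hω.mono hω.nonneg hx hY hab h1 hbah h2 h3 h4
    have r := Real.rpow_le_rpow (sub_nonneg.2 h1) h2 he.γ'_pos.le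
    have := hω.nonneg (b + t)
    calc _ ≤ _ := e
      _ ≤ 4 * youngConst (κ + γ) (κ' + γ') * X * A * ω (b + t) * (b - a) ^ γ * h ^ γ' := by gcongr
      _ = _ := by ring
  induction n with
  | zero =>
    intro t h1 h2 h3
    have ht : t = -a := by
      simp only [Nat.cast_zero, zero_mul] at h2; linarith
    subst ht
    have hΩ : 0 ≤ Ω (b + -a) := (hω.nonneg _).trans (hω.le _ (by linarith))
    have e : rectIncr Y a b (-a) (-a) = 0 := by rw [rectIncr]; ring
    rw [e, abs_zero]
    positivity
  | succ n ih =>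
    intro t h1 h2 h3
    rcases le_or_gt (a + t) h with hle | hlt
    · refine (piece (-a) t (by linarith) (by linarith) (by linarith) h3).trans ?_
      exact mul_le_mul_of_nonneg_left (hω.le _ (by linarith)) (by positivity)
    · have m : (b, t - h) ∈ D := hD.lower b t b (t - h) h3 le_rfl (by linarith) (by linarith)
      have e1 := ih (t - h) (by linarith) (by push_cast at h2; linarith) m
      have e2 := piece (t - h) t (by linarith) (by linarith) (by linarith) h3
      have e3 : rectIncr Y a b (-a) t = rectIncr Y a b (-a) (t - h) + rectIncr Y a b (t - h) t := by
        simp only [rectIncr]; ring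
      have e4 := hω.add_le (b + t) (by linarith)
      rw [e3]
      refine (abs_add_le _ _).trans ((add_le_add e1 e2).trans ?_)
      rw [← mul_add, show b + (t - h) = b + t - h by ring]
      exact mul_le_mul_of_nonneg_left e4 (by positivity)

/-- The cones with vertices `(a, t)` and `(b, t)` differ by the strip `[a, b] × [-a, t]` and the
triangle with vertex `(b, -a)` below it. -/
lemma CtrlDom.fst_estimate (he : YoungExp κ κ' γ γ') (hD : LowerDomain D R) (hh : 0 < h)
    (hA : 0 ≤ A) (hX : 0 ≤ X) (hω : WeightSum h ω Ω)
    (hf : CtrlDom D κ κ' h A ω f) (hx : RectDom D γ γ' X x) (hY : IsPrimitive D γ γ' f x Y)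
    {a b t : ℝ} (hab : a ≤ b) (hbah : b - a ≤ h) (hat : (a, t) ∈ D) (hbt : (b, t) ∈ D) :
    |Y (b, t) - Y (a, t)| ≤ (1 + sewConst (γ + γ')) * (4 * youngConst (κ + γ) (κ' + γ')) * X * A *
      (b - a) ^ γ * h ^ γ' * Ω (b + t) := by
  have hyc := youngConst_pos he.fst he.snd
  have hs := sewConst_pos he.sum
  have h0 := hD.nonneg _ _ hat
  have hm : (b, -a) ∈ D := hD.lower b t b (-a) hbt le_rfl (by linarith) (by linarith)
  have hma : (a, -a) ∈ D := hD.lower b t a (-a) hbt hab (by linarith) (by linarith)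
  obtain ⟨n, hn⟩ := exists_nat_ge ((a + t) / h)
  have e1 := hf.strip_estimate he hD hh hA hX hω hx hY hab hbah n t h0
    ((div_le_iff₀ hh).1 hn) hbt
  have e2 := hf.triangle_estimate he hD hh hA hX hω.mono hω.nonneg hx hY hab hbah hm
  have e3 := hY.diag (by linarith [he.sum]) hma (by ring)
  have e4 : Y (b, t) - Y (a, t) = Y (b, -a) + rectIncr Y a b (-a) t := by
    rw [rectIncr, e3]; ring
  rw [e4]
  refine (abs_add_le _ _).trans ((add_le_add e2 e1).trans ?_)
  have nba := sub_nonneg.2 hab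
  have r1 : (b - a) ^ (γ + γ') ≤ (b - a) ^ γ * h ^ γ' := by
    rw [Real.rpow_add' nba (by linarith [he.sum])]
    exact mul_le_mul_of_nonneg_left (Real.rpow_le_rpow nba hbah he.γ'_pos.le)
      (Real.rpow_nonneg nba _)
  have r2 : ω (b - a) ≤ Ω (b + t) :=
    (hω.mono (by linarith)).trans (hω.le (b + t) (by linarith))
  have n0 := hω.nonneg (b - a)
  have n1 := Real.rpow_nonneg nba γ
  have n2 := Real.rpow_nonneg nba (γ + γ')
  have n3 := Real.rpow_nonneg hh.le γ'
  have : sewConst (γ + γ') * (4 * youngConst (κ + γ) (κ' + γ') * X * A * ω (b - a)) *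
      (b - a) ^ (γ + γ') ≤ sewConst (γ + γ') * (4 * youngConst (κ + γ) (κ' + γ') * X * A *
      Ω (b + t)) * ((b - a) ^ γ * h ^ γ') := by
    have := n0.trans r2
    gcongr
  linarith

/-- The constant of the scaled estimates. -/
def primConst (κ κ' γ γ' : ℝ) : ℝ :=
  (1 + sewConst (γ + γ')) * (4 * youngConst (κ + γ) (κ' + γ'))

lemma primConst_pos (he : YoungExp κ κ' γ γ') : 0 < primConst κ κ' γ γ' :=
  mul_pos (by linarith [sewConst_pos he.sum]) (by linarith [youngConst_pos he.fst he.snd])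

lemma primConst_swap (κ κ' γ γ' : ℝ) : primConst κ' κ γ' γ = primConst κ κ' γ γ' := by
  simp only [primConst, youngConst, add_comm γ' γ]; ring

lemma scaled_rpow_le {r h κ γ : ℝ} (hr : 0 ≤ r) (hrh : r ≤ h) (hh : 0 < h) (hκ : 0 ≤ κ)
    (hκγ : κ ≤ γ) : r ^ γ ≤ h ^ γ * (r / h) ^ κ := by
  rw [div_rpow_mul_rpow hr hh]
  have h1 : r / h ≤ 1 := (div_le_one hh).2 hrh
  have := Real.rpow_nonneg hh.le γ
  refine mul_le_mul_of_nonneg_left ?_ this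
  rcases (div_nonneg hr hh.le).eq_or_lt with h0 | h0
  · rw [← h0]
    rcases hκ.eq_or_lt with rfl | hκ
    · rw [Real.rpow_zero]
      exact Real.rpow_le_one le_rfl zero_le_one hκγ
    · rw [Real.zero_rpow hκ.ne', Real.zero_rpow (hκ.trans_le hκγ).ne']
  · exact Real.rpow_le_rpow_of_exponent_ge h0 h1 hκγ

/-- Since `r / h ≤ 1`, lowering the exponents `γ, γ'` to `κ, κ'` at scale `h` is free. What remains
is the factor `h ^ (γ + γ')`, the source of smallness for the fixed point argument. -/
theorem CtrlDom.semiDom_primitive (he : YoungExp κ κ' γ γ') (hκγ : κ ≤ γ) (hκγ' : κ' ≤ γ')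
    (hD : LowerDomain D R) (hh : 0 < h) (hA : 0 ≤ A) (hX : 0 ≤ X) (hω : WeightSum h ω Ω)
    (hf : CtrlDom D κ κ' h A ω f) (hx : RectDom D γ γ' X x) (hY : IsPrimitive D γ γ' f x Y) :
    SemiDom D κ κ' h (primConst κ κ' γ γ' * X * A * h ^ (γ + γ')) Ω Y := by
  have hyc := youngConst_pos he.fst he.snd
  have hs := sewConst_pos he.sum
  have hC := primConst_pos he
  have hΩ : ∀ τ, 0 ≤ τ → 0 ≤ Ω τ := fun τ h => (hω.nonneg τ).trans (hω.le τ h)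
  have hγγ : h ^ (γ + γ') = h ^ γ * h ^ γ' := Real.rpow_add hh γ γ'
  have n1 := Real.rpow_nonneg hh.le γ
  have n2 := Real.rpow_nonneg hh.le γ'
  refine ⟨fun a b t h1 h2 h3 h4 => ?_, fun s c d h1 h2 h3 h4 => ?_,
    fun a b c d h1 h2 h3 h4 h5 h6 => ?_⟩
  · have e := hf.fst_estimate he hD hh hA hX hω hx hY h1 h2 h3 h4
    have r := scaled_rpow_le (sub_nonneg.2 h1) h2 hh he.κ_nonneg hκγ
    have := hΩ (b + t) (hD.nonneg _ _ h4)
    rw [hγγ]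
    calc _ ≤ primConst κ κ' γ γ' * X * A * (b - a) ^ γ * h ^ γ' * Ω (b + t) := e
      _ ≤ primConst κ κ' γ γ' * X * A * (h ^ γ * ((b - a) / h) ^ κ) * h ^ γ' * Ω (b + t) := by
        gcongr
      _ = _ := by ring
  · have e := hf.swap.fst_estimate he.swap hD.swap hh hA hX hω hx.swap hY.swap h1 h2
      (show (c, s) ∈ Prod.swap ⁻¹' D from h3) h4
    have r := scaled_rpow_le (sub_nonneg.2 h1) h2 hh he.κ'_nonneg hκγ'
    have := hΩ (s + d) (hD.nonneg _ _ h4)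
    rw [hγγ]
    calc _ ≤ primConst κ' κ γ' γ * X * A * (d - c) ^ γ' * h ^ γ * Ω (d + s) := e
      _ = primConst κ κ' γ γ' * X * A * (d - c) ^ γ' * h ^ γ * Ω (s + d) := by
        rw [primConst_swap, add_comm d s]
      _ ≤ primConst κ κ' γ γ' * X * A * (h ^ γ' * ((d - c) / h) ^ κ') * h ^ γ * Ω (s + d) := by
        gcongr
      _ = _ := by ring
  · have e := hf.rect_estimate he hD hh hA hX hω.mono hω.nonneg hx hY h1 h2 h3 h4 h5 h6
    have r := scaled_rpow_le (sub_nonneg.2 h1) h3 hh he.κ_nonneg hκγ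
    have r' := scaled_rpow_le (sub_nonneg.2 h2) h4 hh he.κ'_nonneg hκγ'
    have hτ := hD.nonneg _ _ h6
    have w1 := hω.le _ hτ
    have w2 := hω.nonneg (b + d)
    have w3 := hΩ _ hτ
    have q1 := Real.rpow_nonneg (sub_nonneg.2 h1) γ
    have q2 := Real.rpow_nonneg (sub_nonneg.2 h2) γ'
    have q3 := Real.rpow_nonneg (div_nonneg (sub_nonneg.2 h1) hh.le) κ
    have hc : 4 * youngConst (κ + γ) (κ' + γ') ≤ primConst κ κ' γ γ' := by
      rw [primConst]; exact le_mul_of_one_le_left (by positivity) (by linarith)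
    rw [hγγ]
    calc _ ≤ _ := e
      _ ≤ primConst κ κ' γ γ' * X * A * Ω (b + d) * (h ^ γ * ((b - a) / h) ^ κ) *
          (h ^ γ' * ((d - c) / h) ^ κ') := by gcongr
      _ = _ := by ring

end Estimates

/-! ### Functions without rectangular increments -/

/-- The rectangular increments of `W` vanish near `q`. -/
def Flat (W : ℝ × ℝ → ℝ) (q : ℝ × ℝ) : Prop :=
  ∃ r > 0, ∀ a b c d, a ≤ b → c ≤ d → (a, c) ∈ Metric.ball q r → (b, d) ∈ Metric.ball q r →
    rectIncr W a b c d = 0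

lemma mem_ball_prod {q : ℝ × ℝ} {u v r : ℝ} :
    (u, v) ∈ Metric.ball q r ↔ |u - q.1| < r ∧ |v - q.2| < r := by
  rw [Metric.mem_ball, Prod.dist_eq, max_lt_iff, Real.dist_eq, Real.dist_eq]

lemma isOpen_flat (W : ℝ × ℝ → ℝ) : IsOpen {q | Flat W q} := by
  rw [Metric.isOpen_iff]
  rintro q ⟨r, hr, h⟩
  refine ⟨r / 2, half_pos hr, fun q' hq' => ⟨r / 2, half_pos hr, fun a b c d h1 h2 h3 h4 => ?_⟩⟩
  have hsub : Metric.ball q' (r / 2) ⊆ Metric.ball q r :=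
    Metric.ball_subset_ball' (by linarith [Metric.mem_ball.1 hq'])
  exact h a b c d h1 h2 (hsub h3) (hsub h4)

lemma flat_swap {W : ℝ × ℝ → ℝ} {q : ℝ × ℝ} (h : Flat (W ∘ Prod.swap) q.swap) : Flat W q := by
  obtain ⟨r, hr, H⟩ := h
  refine ⟨r, hr, fun a b c d h1 h2 h3 h4 => ?_⟩
  rw [← rectIncr_swap]
  rw [mem_ball_prod] at h3 h4
  exact H c d a b h2 h1 (mem_ball_prod.2 h3.symm) (mem_ball_prod.2 h4.symm)

lemma sum_rectIncr (W : ℝ × ℝ → ℝ) (u v : ℕ → ℝ) (n m : ℕ) :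
    ∑ k ∈ Finset.range n, ∑ l ∈ Finset.range m, rectIncr W (u k) (u (k + 1)) (v l) (v (l + 1)) =
      rectIncr W (u 0) (u n) (v 0) (v m) := by
  have e1 : ∀ k, ∑ l ∈ Finset.range m, rectIncr W (u k) (u (k + 1)) (v l) (v (l + 1)) =
      (W (u (k + 1), v m) - W (u (k + 1), v 0)) - (W (u k, v m) - W (u k, v 0)) := by
    intro k
    have := Finset.sum_range_sub (fun l => W (u (k + 1), v l) - W (u k, v l)) m
    rw [show (W (u (k + 1), v m) - W (u (k + 1), v 0)) - (W (u k, v m) - W (u k, v 0)) =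
      W (u (k + 1), v m) - W (u k, v m) - (W (u (k + 1), v 0) - W (u k, v 0)) by ring, ← this]
    exact Finset.sum_congr rfl fun l _ => by rw [rectIncr]; ring
  rw [Finset.sum_congr rfl fun k _ => e1 k,
    Finset.sum_range_sub (fun k => W (u k, v m) - W (u k, v 0)) n, rectIncr]
  ring

/-- A Lebesgue number for the cover by balls of flatness yields a grid on which the increment over
every cell is zero; increments are additive over grids. -/
lemma rectIncr_eq_zero_of_flat {W : ℝ × ℝ → ℝ} {a b c d : ℝ} (hab : a ≤ b) (hcd : c ≤ d)
    (h : ∀ u v, a ≤ u → u ≤ b → c ≤ v → v ≤ d → Flat W (u, v)) : rectIncr W a b c d = 0 := by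
  have hK : IsCompact (Icc a b ×ˢ Icc c d) := isCompact_Icc.prod isCompact_Icc
  have hF : ∀ q : ↥(Icc a b ×ˢ Icc c d), ∃ r > 0, ∀ a' b' c' d', a' ≤ b' → c' ≤ d' →
      (a', c') ∈ Metric.ball q.1 r → (b', d') ∈ Metric.ball q.1 r →
      rectIncr W a' b' c' d' = 0 := fun q =>
    h q.1.1 q.1.2 q.2.1.1 q.2.1.2 q.2.2.1 q.2.2.2
  choose r hr hr' using hF
  obtain ⟨δ, hδ, hδ'⟩ := lebesgue_number_lemma_of_metric hK
    (c := fun q : ↥(Icc a b ×ˢ Icc c d) => Metric.ball q.1 (r q)) (fun q => Metric.isOpen_ball)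
    (fun q hq => mem_iUnion.2 ⟨⟨q, hq⟩, Metric.mem_ball_self (hr _)⟩)
  obtain ⟨n, h1, h2⟩ := ((eventually_isPartition hab hδ).and (eventually_isPartition hcd hδ)).exists
  have e := sum_rectIncr W (unifPart a b (n + 1)) (unifPart c d (n + 1)) (n + 1) (n + 1)
  rw [h1.1, h2.1, h1.2.1, h2.2.1] at e
  rw [← e]
  refine Finset.sum_eq_zero fun k hk => Finset.sum_eq_zero fun l hl => ?_
  have hk := Finset.mem_range.1 hk
  have hl := Finset.mem_range.1 hl
  obtain ⟨q, hq⟩ := hδ' (unifPart a b (n + 1) k, unifPart c d (n + 1) l)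
    ⟨h1.mem hk.le, h2.mem hl.le⟩
  refine hr' q _ _ _ _ (h1.2.2 k hk).1 (h2.2.2 l hl).1 (hq (Metric.mem_ball_self hδ))
    (hq (mem_ball_prod.2 ⟨?_, ?_⟩))
  · rw [abs_of_nonneg (sub_nonneg.2 (h1.2.2 k hk).1)]; exact (h1.2.2 k hk).2
  · rw [abs_of_nonneg (sub_nonneg.2 (h2.2.2 l hl).1)]; exact (h2.2.2 l hl).2

/-- A rectangle with a side on the line is a limit of rectangles off the line, and continuity passes
to the limit. A rectangle that crosses the line is cut along it. -/
lemma flat_of_flat_off_line {W : ℝ × ℝ → ℝ} {q : ℝ × ℝ} {r : ℝ} (hr : 0 < r)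
    (hW : ContinuousOn W (Metric.ball q r))
    (h : ∀ p ∈ Metric.ball q r, p.1 ≠ q.1 → Flat W p) : Flat W q := by
  have hopen : IsOpen (Metric.ball q r) := Metric.isOpen_ball
  have ball : ∀ {a b c d u v : ℝ}, (a, c) ∈ Metric.ball q r → (b, d) ∈ Metric.ball q r →
      a ≤ u → u ≤ b → c ≤ v → v ≤ d → (u, v) ∈ Metric.ball q r := by
    intro a b c d u v h1 h2 h3 h4 h5 h6
    rw [mem_ball_prod] at *
    simp only [abs_lt] at *
    exact ⟨⟨by linarith, by linarith⟩, ⟨by linarith, by linarith⟩⟩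
  have cont : ∀ u v, (u, v) ∈ Metric.ball q r →
      Filter.Tendsto (fun s => W (s, v)) (nhds u) (nhds (W (u, v))) := by
    intro u v huv
    have h1 : ContinuousAt W (u, v) := hW.continuousAt (hopen.mem_nhds huv)
    have h2 : ContinuousAt (fun s : ℝ => (s, v)) u := by fun_prop
    exact ContinuousAt.comp (f := fun s : ℝ => (s, v)) h1 h2
  have left : ∀ a b c d, a ≤ b → c ≤ d → b ≤ q.1 → (a, c) ∈ Metric.ball q r →
      (b, d) ∈ Metric.ball q r → rectIncr W a b c d = 0 := by
    intro a b c d hab hcd hb h1 h2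
    rcases hab.eq_or_lt with rfl | hlt
    · simp [rectIncr]
    have t : Filter.Tendsto (fun s => rectIncr W a s c d) (nhdsWithin b (Iio b))
        (nhds (rectIncr W a b c d)) := by
      have c1 := cont b c (ball h1 h2 hab le_rfl le_rfl hcd)
      have c2 := cont b d h2
      exact ((c1.const_sub (W (a, c) - W (a, d))).add c2).mono_left nhdsWithin_le_nhds
    refine tendsto_nhds_unique t ?_
    refine tendsto_const_nhds.congr' ?_
    filter_upwards [Ioo_mem_nhdsLT hlt] with s hs
    symm
    refine rectIncr_eq_zero_of_flat hs.1.le hcd fun u v i1 i2 i3 i4 => ?_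
    exact h _ (ball h1 h2 i1 (i2.trans hs.2.le) i3 i4) (by simp only; linarith [hs.2])
  have right : ∀ a b c d, a ≤ b → c ≤ d → q.1 ≤ a → (a, c) ∈ Metric.ball q r →
      (b, d) ∈ Metric.ball q r → rectIncr W a b c d = 0 := by
    intro a b c d hab hcd ha h1 h2
    rcases hab.eq_or_lt with rfl | hlt
    · simp [rectIncr]
    have t : Filter.Tendsto (fun s => rectIncr W s b c d) (nhdsWithin a (Ioi a))
        (nhds (rectIncr W a b c d)) := by
      have c1 := cont a c h1
      have c2 := cont a d (ball h1 h2 le_rfl hab hcd le_rfl)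
      exact (((c1.sub c2).sub_const _).add_const _).mono_left nhdsWithin_le_nhds
    refine tendsto_nhds_unique t ?_
    refine tendsto_const_nhds.congr' ?_
    filter_upwards [Ioo_mem_nhdsGT hlt] with s hs
    symm
    refine rectIncr_eq_zero_of_flat hs.2.le hcd fun u v i1 i2 i3 i4 => ?_
    exact h _ (ball h1 h2 (hs.1.le.trans i1) i2 i3 i4) (by simp only; linarith [hs.1])
  refine ⟨r, hr, fun a b c d hab hcd h1 h2 => ?_⟩
  rcases le_total b q.1 with hb | hb
  · exact left a b c d hab hcd hb h1 h2
  rcases le_total q.1 a with ha | ha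
  · exact right a b c d hab hcd ha h1 h2
  have e1 := left a q.1 c d ha hcd le_rfl h1 (ball h1 h2 ha hb hcd le_rfl)
  have e2 := right q.1 b c d hb hcd le_rfl (ball h1 h2 ha hb le_rfl hcd) h2
  simp only [rectIncr] at *
  linarith

/-- A continuous function whose rectangular increments vanish near each point outside countably
many horizontal and vertical lines has locally vanishing rectangular increments. -/
theorem flat_of_flat_off_lines {ι : Type*} [Countable ι] {O : Set (ℝ × ℝ)} (hO : IsOpen O)
    {W : ℝ × ℝ → ℝ} (hW : ContinuousOn W O) (α β : ι → ℝ)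
    (h : ∀ q ∈ O, Flat W q ∨ (∃ i, q.1 = α i) ∨ ∃ i, q.2 = β i) : ∀ q ∈ O, Flat W q := by
  by_contra! hne
  obtain ⟨q₁, hq₁, hq₁'⟩ := hne
  -- Baire category: the set `E` of bad points is locally closed in the plane, hence locally compact
  -- and a Baire space, and it is covered by countably many lines. One line contains a nonempty
  -- relatively open piece of `E`. Near a point of this piece all bad points lie on that line, so
  -- `flat_of_flat_off_line` gives a contradiction.
  set E : Set (ℝ × ℝ) := O ∩ {q | Flat W q}ᶜ with hE
  have hlc : IsLocallyClosed E :=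
    hO.isLocallyClosed.inter (isOpen_flat W).isClosed_compl.isLocallyClosed
  have : LocallyCompactSpace E := hlc.locallyCompactSpace
  have : Nonempty E := ⟨⟨q₁, hq₁, hq₁'⟩⟩
  obtain ⟨i, hi⟩ := nonempty_interior_of_iUnion_of_closed
    (f := fun i : ι ⊕ ι => Sum.elim (fun i => {e : E | e.1.1 = α i}) (fun i => {e : E | e.1.2 = β i}) i)
    (by
      rintro (i | i)
      · exact isClosed_eq (by fun_prop) continuous_const
      · exact isClosed_eq (by fun_prop) continuous_const)
    (by
      refine eq_univ_of_forall fun e => mem_iUnion.2 ?_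
      rcases h e.1 e.2.1 with h1 | ⟨i, h1⟩ | ⟨i, h1⟩
      · exact absurd h1 e.2.2
      · exact ⟨Sum.inl i, h1⟩
      · exact ⟨Sum.inr i, h1⟩)
  obtain ⟨e, he⟩ := hi
  obtain ⟨t, htsub, ht, het⟩ := mem_interior.1 he
  obtain ⟨U, hU, rfl⟩ := isOpen_induced_iff.1 ht
  obtain ⟨r, hr, hball⟩ := Metric.isOpen_iff.1 (hU.inter hO) e.1 ⟨het, e.2.1⟩
  have he0 := htsub het
  refine e.2.2 ?_
  rcases i with i | i
  · refine flat_of_flat_off_line hr (hW.mono fun p hp => (hball hp).2) fun p hp hne => ?_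
    by_contra hnf
    have h1 : (⟨p, (hball hp).2, hnf⟩ : E).1.1 = α i := htsub (hball hp).1
    have h2 : e.1.1 = α i := he0
    exact hne (by rw [h2]; exact h1)
  · refine flat_swap (flat_of_flat_off_line hr ?_ fun p hp hne => ?_)
    · refine hW.comp continuous_swap.continuousOn fun p hp => (hball ?_).2
      rw [← Prod.mk.eta (p := p), mem_ball_prod] at hp
      exact mem_ball_prod.2 hp.symm
    · have hp' : p.swap ∈ Metric.ball e.1 r := by
        rw [← Prod.mk.eta (p := p), mem_ball_prod] at hp
        exact mem_ball_prod.2 hp.symm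
      have hf : Flat W p.swap := by
        by_contra hnf
        have h1 : (⟨p.swap, (hball hp').2, hnf⟩ : E).1.2 = β i := htsub (hball hp').1
        have h2 : e.1.2 = β i := he0
        refine hne ?_
        change p.1 = e.1.2
        rw [h2]; exact h1
      refine flat_swap ?_
      have : (W ∘ Prod.swap) ∘ Prod.swap = W := by ext q; simp
      rw [this]
      exact hf

/-! ### Sums over families of rectangles filling a cone -/

/-- The point of `[a, b]` closest to `u`. -/
def clampTo (a b u : ℝ) : ℝ := max a (min b u)

lemma clampTo_mem {a b : ℝ} (hab : a ≤ b) (u : ℝ) : clampTo a b u ∈ Icc a b :=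
  ⟨le_max_left _ _, max_le hab (min_le_left _ _)⟩

lemma continuous_clampTo (a b : ℝ) : Continuous (clampTo a b) := by
  unfold clampTo; fun_prop

lemma clampTo_eq_right {a b u : ℝ} (hab : a ≤ b) (h : b ≤ u) : clampTo a b u = b := by
  rw [clampTo, min_eq_left h, max_eq_right hab]

lemma clampTo_eq_left {a b u : ℝ} (h : u ≤ a) : clampTo a b u = a :=
  max_eq_left ((min_le_right _ _).trans h)

lemma clampTo_sub_le {a b u : ℝ} (h : a ≤ u) : clampTo a b u - a ≤ u - a :=
  sub_le_sub_right (max_le h (min_le_right _ _)) _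

lemma clampTo_eq_self {a b u : ℝ} (h1 : a ≤ u) (h2 : u ≤ b) : clampTo a b u = u := by
  rw [clampTo, min_eq_right h2, max_eq_right h1]

lemma clampTo_eq_of_disjoint {a b u v : ℝ} (huv : u < v)
    (h : Disjoint (Ioo u v) (Ioo a b)) : clampTo a b u = clampTo a b v := by
  rw [Ioo_disjoint_Ioo] at h
  unfold clampTo
  rcases le_total a u with h1 | h1 <;> rcases le_total v b with h2 | h2 <;>
    rcases le_total b u with h3 | h3 <;> rcases le_total v a with h4 | h4 <;>
    simp_all <;> linarith

lemma abs_sum_le_of_single {s : Finset ℕ} {g : ℕ → ℝ} {B : ℝ} (hB : 0 ≤ B)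
    (h : ∀ i ∈ s, |g i| ≤ B) (h1 : ∀ i ∈ s, ∀ j ∈ s, g i ≠ 0 → g j ≠ 0 → i = j) :
    |∑ i ∈ s, g i| ≤ B := by
  by_cases h0 : ∀ i ∈ s, g i = 0
  · rw [Finset.sum_eq_zero h0, abs_zero]; exact hB
  · push Not at h0
    obtain ⟨i, hi, hgi⟩ := h0
    rw [Finset.sum_eq_single_of_mem i hi fun j hj hne => by
      by_contra hj'
      exact hne (h1 j hj i hi hj' hgi)]
    exact h i hi

lemma isOpen_openCone (p : ℝ × ℝ) : IsOpen (openCone p) := by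
  have h1 : IsOpen {q : ℝ × ℝ | q.1 < p.1} := isOpen_lt (by fun_prop) (by fun_prop)
  have h2 : IsOpen {q : ℝ × ℝ | q.2 < p.2} := isOpen_lt (by fun_prop) (by fun_prop)
  have h3 : IsOpen {q : ℝ × ℝ | 0 < q.1 + q.2} := isOpen_lt (by fun_prop) (by fun_prop)
  exact h1.inter (h2.inter h3)

/-- If the rectangular increments vanish locally in the open cone, they vanish on the rectangles
of the closed cone. -/
lemma rectIncr_eq_zero_of_flat_cone {W : ℝ × ℝ → ℝ} {p : ℝ × ℝ}
    (hW : ContinuousOn W (closedCone p)) (hflat : ∀ q ∈ openCone p, Flat W q) {a b c d : ℝ}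
    (hab : a ≤ b) (hcd : c ≤ d) (hac : 0 ≤ a + c) (hb : b ≤ p.1) (hd : d ≤ p.2) :
    rectIncr W a b c d = 0 := by
  rcases hab.eq_or_lt with rfl | hab
  · simp [rectIncr]
  rcases hcd.eq_or_lt with rfl | hcd
  · simp [rectIncr]
  have hsm : ∀ᶠ ε in nhdsWithin (0 : ℝ) (Ioi 0), 0 < ε ∧ ε < (b - a) / 2 ∧ ε < (d - c) / 2 := by
    filter_upwards [Ioo_mem_nhdsGT (show (0 : ℝ) < min ((b - a) / 2) ((d - c) / 2) from
      lt_min (by linarith) (by linarith))] with ε hε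
    exact ⟨hε.1, hε.2.trans_le (min_le_left _ _), hε.2.trans_le (min_le_right _ _)⟩
  have tend : ∀ (u v σ τ : ℝ), (u, v) ∈ closedCone p →
      (∀ᶠ ε in nhdsWithin (0 : ℝ) (Ioi 0), (u + σ * ε, v + τ * ε) ∈ closedCone p) →
      Filter.Tendsto (fun ε => W (u + σ * ε, v + τ * ε)) (nhdsWithin (0 : ℝ) (Ioi 0))
        (nhds (W (u, v))) := by
    intro u v σ τ huv hev
    refine (hW (u, v) huv).tendsto.comp (tendsto_nhdsWithin_iff.2 ⟨?_, hev⟩)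
    have : Continuous fun ε : ℝ => (u + σ * ε, v + τ * ε) := by fun_prop
    have t := (this.tendsto 0).mono_left (nhdsWithin_le_nhds (s := Ioi 0))
    simpa using t
  have t1 := tend a c 1 1 ⟨by simp only; linarith, by simp only; linarith, by simp only; linarith⟩
    (by
      filter_upwards [hsm] with ε hε
      exact ⟨by simp only; linarith [hε.2.1], by simp only; linarith [hε.2.2],
        by simp only; linarith [hε.1]⟩)
  have t2 := tend a d 1 (-1) ⟨by simp only; linarith, by simp only; linarith,
    by simp only; linarith⟩ (by
      filter_upwards [hsm] with ε hε
      exact ⟨by simp only; linarith [hε.2.1], by simp only; linarith [hε.1],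
        by simp only; linarith [hε.1]⟩)
  have t3 := tend b c (-1) 1 ⟨by simp only; linarith, by simp only; linarith,
    by simp only; linarith⟩ (by
      filter_upwards [hsm] with ε hε
      exact ⟨by simp only; linarith [hε.1], by simp only; linarith [hε.2.2],
        by simp only; linarith [hε.1]⟩)
  have t4 := tend b d (-1) (-1) ⟨by simp only; linarith, by simp only; linarith,
    by simp only; linarith⟩ (by
      filter_upwards [hsm] with ε hε
      exact ⟨by simp only; linarith [hε.1], by simp only; linarith [hε.1],
        by simp only; linarith [hε.1, hε.2.1, hε.2.2]⟩)
  refine tendsto_nhds_unique (((t1.sub t2).sub t3).add t4) (tendsto_const_nhds.congr' ?_)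
  filter_upwards [hsm] with ε hε
  have e := rectIncr_eq_zero_of_flat (W := W) (a := a + 1 * ε) (b := b + -1 * ε) (c := c + 1 * ε)
    (d := d + -1 * ε) (by linarith [hε.2.1]) (by linarith [hε.2.2])
    (fun u v h1 h2 h3 h4 => hflat _ ⟨by simp only; linarith [hε.1], by simp only; linarith [hε.1],
      by simp only; linarith [hε.1]⟩)
  rw [← e, rectIncr]

section ConeSum

variable {D : Set (ℝ × ℝ)} {R γ γ' C : ℝ} {Y : ℝ × ℝ → ℝ}

lemma IsConeFamily.corner {p : ℝ × ℝ} {s₁ s₂ t₁ t₂ : ℕ → ℝ}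
    (hF : IsConeFamily γ γ' p s₁ s₂ t₁ t₂) (n : ℕ) :
    0 ≤ s₁ n + t₁ n ∧ s₂ n ≤ p.1 ∧ t₂ n ≤ p.2 := by
  have h1 : (s₁ n, t₁ n) ∈ closedCone p := hF.subset (mem_iUnion.2
    ⟨n, ⟨⟨le_rfl, hF.le_fst n⟩, ⟨le_rfl, hF.le_snd n⟩⟩⟩)
  have h2 : (s₂ n, t₂ n) ∈ closedCone p := hF.subset (mem_iUnion.2
    ⟨n, ⟨⟨hF.le_fst n, le_rfl⟩, ⟨hF.le_snd n, le_rfl⟩⟩⟩)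
  exact ⟨h1.2.2, h2.1, h2.2.1⟩

/-- Countable additivity: a function on the domain that vanishes to superlinear order at the
antidiagonal is the sum of its rectangular increments over a family filling the cone. -/
theorem hasSum_rectIncr_cone (hD : LowerDomain D R) (hγ : 0 < γ) (hγ' : 0 < γ')
    (hγγ : 1 < γ + γ') (hC : 0 ≤ C) (hY : RectDom D γ γ' C Y) (hcont : ContinuousOn Y D)
    (hdiag : ∃ C', ∀ u v, (u, v) ∈ D → |Y (u, v)| ≤ C' * (u + v) ^ (γ + γ'))
    {p : ℝ × ℝ} (hp : p ∈ D) {s₁ s₂ t₁ t₂ : ℕ → ℝ} (hF : IsConeFamily γ γ' p s₁ s₂ t₁ t₂) :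
    HasSum (fun n => rectIncr Y (s₁ n) (s₂ n) (t₁ n) (t₂ n)) (Y p) := by
  obtain ⟨s, t⟩ := p
  have hst := hD.nonneg s t hp
  have hcone : closedCone (s, t) ⊆ D := fun q hq =>
    hD.lower s t q.1 q.2 hp hq.1 hq.2.1 hq.2.2
  have corner := hF.corner
  have memD : ∀ n u v, s₁ n ≤ u → u ≤ s₂ n → t₁ n ≤ v → v ≤ t₂ n → (u, v) ∈ D :=
    fun n u v h1 h2 h3 h4 => hcone ⟨h2.trans (corner n).2.1, h4.trans (corner n).2.2,
      by simp only; linarith [(corner n).1]⟩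
  -- The increment of `Y` over the part of the `n`-th rectangle to the left of and below `q`; at the
  -- vertex it is the whole rectangle. The Hölder bound of `Y` and the summable sizes make the
  -- series converge uniformly, so its sum is continuous.
  set V : ℕ → ℝ × ℝ → ℝ := fun n q =>
    rectIncr Y (s₁ n) (clampTo (s₁ n) (s₂ n) q.1) (t₁ n) (clampTo (t₁ n) (t₂ n) q.2) with hV
  have Vle : ∀ n q, |V n q| ≤ C * (clampTo (s₁ n) (s₂ n) q.1 - s₁ n) ^ γ *
      (clampTo (t₁ n) (t₂ n) q.2 - t₁ n) ^ γ' := fun n q => by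
    have m1 := clampTo_mem (hF.le_fst n) q.1
    have m2 := clampTo_mem (hF.le_snd n) q.2
    exact hY _ _ _ _ m1.1 m2.1 (corner n).1 (memD n _ _ m1.1 m1.2 m2.1 m2.2)
  have Vbound : ∀ n q, |V n q| ≤ C * ((s₂ n - s₁ n) ^ γ * (t₂ n - t₁ n) ^ γ') := fun n q => by
    have m1 := clampTo_mem (hF.le_fst n) q.1
    have m2 := clampTo_mem (hF.le_snd n) q.2
    refine (Vle n q).trans ?_
    rw [mul_assoc]
    have h1 := sub_nonneg.2 m1.1
    have h2 := sub_nonneg.2 m2.1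
    have h3 := m1.2
    have h4 := m2.2
    have h5 := sub_nonneg.2 (hF.le_fst n)
    gcongr
  have hsum : Summable fun n => C * ((s₂ n - s₁ n) ^ γ * (t₂ n - t₁ n) ^ γ') :=
    hF.summable.mul_left C
  have Vsum : ∀ q, Summable fun n => V n q := fun q =>
    Summable.of_norm_bounded hsum fun n => Vbound n q
  have Vcont : ∀ n, Continuous (V n) := by
    intro n
    have c1 := continuous_clampTo (s₁ n) (s₂ n)
    have c2 := continuous_clampTo (t₁ n) (t₂ n)
    have l1 := hF.le_fst n
    have l2 := hF.le_snd n
    have key : ∀ g₁ g₂ : ℝ × ℝ → ℝ, Continuous g₁ → Continuous g₂ →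
        (∀ q, g₁ q ∈ Icc (s₁ n) (s₂ n)) → (∀ q, g₂ q ∈ Icc (t₁ n) (t₂ n)) →
        Continuous fun q => Y (g₁ q, g₂ q) := fun g₁ g₂ h1 h2 h3 h4 =>
      hcont.comp_continuous (h1.prodMk h2)
        fun q => memD n _ _ (h3 q).1 (h3 q).2 (h4 q).1 (h4 q).2
    have k1 := key (fun _ => s₁ n) (fun _ => t₁ n) continuous_const continuous_const
      (fun _ => ⟨le_rfl, l1⟩) (fun _ => ⟨le_rfl, l2⟩)
    have k2 := key (fun _ => s₁ n) (fun q => clampTo (t₁ n) (t₂ n) q.2) continuous_const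
      (c2.comp continuous_snd) (fun _ => ⟨le_rfl, l1⟩) (fun _ => clampTo_mem l2 _)
    have k3 := key (fun q => clampTo (s₁ n) (s₂ n) q.1) (fun _ => t₁ n)
      (c1.comp continuous_fst) continuous_const (fun _ => clampTo_mem l1 _) (fun _ => ⟨le_rfl, l2⟩)
    have k4 := key (fun q => clampTo (s₁ n) (s₂ n) q.1) (fun q => clampTo (t₁ n) (t₂ n) q.2)
      (c1.comp continuous_fst) (c2.comp continuous_snd) (fun _ => clampTo_mem l1 _)
      (fun _ => clampTo_mem l2 _)
    exact ((k1.sub k2).sub k3).add k4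
  have hVcont : Continuous fun q => ∑' n, V n q := continuous_tsum Vcont hsum Vbound
  -- The claim is that `W` vanishes at the vertex. In the interior of the `n`-th rectangle the
  -- increments of `V n` are those of `Y` and the other terms have none, so `W` is flat off the
  -- lines that carry the sides.
  set W : ℝ × ℝ → ℝ := fun q => Y q - ∑' n, V n q with hW
  have Vincr : ∀ n a b c d, rectIncr (V n) a b c d =
      rectIncr Y (clampTo (s₁ n) (s₂ n) a) (clampTo (s₁ n) (s₂ n) b)
        (clampTo (t₁ n) (t₂ n) c) (clampTo (t₁ n) (t₂ n) d) := fun n a b c d => by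
    simp only [hV, rectIncr]; ring
  have Wincr : ∀ a b c d, rectIncr W a b c d = rectIncr Y a b c d - ∑' n, rectIncr (V n) a b c d := by
    intro a b c d
    have e : ∑' n, rectIncr (V n) a b c d = ∑' n, V n (a, c) - ∑' n, V n (a, d) -
        ∑' n, V n (b, c) + ∑' n, V n (b, d) := by
      simp only [rectIncr]
      rw [(((Vsum _).sub (Vsum _)).sub (Vsum _)).tsum_add (Vsum _),
        ((Vsum _).sub (Vsum _)).tsum_sub (Vsum _), (Vsum _).tsum_sub (Vsum _)]
    rw [e]
    simp only [hW, rectIncr]; ring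
  have Wcont : ContinuousOn W (closedCone (s, t)) := (hcont.mono hcone).sub hVcont.continuousOn
  have openSub : openCone (s, t) ⊆ closedCone (s, t) := fun q hq => ⟨hq.1.le, hq.2.1.le, hq.2.2.le⟩
  have hflat : ∀ q ∈ openCone (s, t), Flat W q := by
    refine flat_of_flat_off_lines (ι := ℕ ⊕ ℕ) (isOpen_openCone _) (Wcont.mono openSub)
      (Sum.elim s₁ s₂) (Sum.elim t₁ t₂) fun q hq => ?_
    obtain ⟨n, hn⟩ := mem_iUnion.1 (hF.covers hq)
    rcases hn.1.1.eq_or_lt with h1 | h1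
    · exact Or.inr (Or.inl ⟨Sum.inl n, h1.symm⟩)
    rcases hn.1.2.eq_or_lt with h2 | h2
    · exact Or.inr (Or.inl ⟨Sum.inr n, h2⟩)
    rcases hn.2.1.eq_or_lt with h3 | h3
    · exact Or.inr (Or.inr ⟨Sum.inl n, h3.symm⟩)
    rcases hn.2.2.eq_or_lt with h4 | h4
    · exact Or.inr (Or.inr ⟨Sum.inr n, h4⟩)
    refine Or.inl ?_
    obtain ⟨r, hr, hball⟩ := Metric.isOpen_iff.1 (isOpen_Ioo.prod isOpen_Ioo) q
      (show q ∈ Ioo (s₁ n) (s₂ n) ×ˢ Ioo (t₁ n) (t₂ n) from ⟨⟨h1, h2⟩, ⟨h3, h4⟩⟩)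
    refine ⟨r, hr, fun a b c d hab hcd hac hbd => ?_⟩
    rcases hab.eq_or_lt with rfl | hab
    · simp [rectIncr]
    rcases hcd.eq_or_lt with rfl | hcd
    · simp [rectIncr]
    obtain ⟨⟨a1, a2⟩, ⟨c1, c2⟩⟩ := hball hac
    obtain ⟨⟨b1, b2⟩, ⟨d1, d2⟩⟩ := hball hbd
    simp only at a1 a2 b1 b2 c1 c2 d1 d2
    rw [Wincr, tsum_eq_single n, Vincr, clampTo_eq_self a1.le a2.le, clampTo_eq_self b1.le b2.le,
      clampTo_eq_self c1.le c2.le, clampTo_eq_self d1.le d2.le, sub_self]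
    intro m hm
    have hdis : Disjoint (Ioo a b ×ˢ Ioo c d) (Ioo (s₁ m) (s₂ m) ×ˢ Ioo (t₁ m) (t₂ m)) :=
      (hF.disjoint hm.symm).mono_left (prod_mono (Ioo_subset_Ioo a1.le b2.le)
        (Ioo_subset_Ioo c1.le d2.le))
    rw [Vincr]
    rcases disjoint_prod.1 hdis with h | h
    · rw [clampTo_eq_of_disjoint hab h]; simp [rectIncr]
    · rw [clampTo_eq_of_disjoint hcd h]; simp [rectIncr]
  have hzero : ∀ {a b c d : ℝ}, a ≤ b → c ≤ d → 0 ≤ a + c → b ≤ s → d ≤ t →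
      rectIncr W a b c d = 0 := fun h1 h2 h3 h4 h5 =>
    rectIncr_eq_zero_of_flat_cone Wcont hflat h1 h2 h3 h4 h5
  have Vzero : ∀ n u v, V n (u, v) ≠ 0 → s₁ n < u ∧ t₁ n < v := by
    intro n u v h
    constructor
    · by_contra hu
      refine h ?_
      simp only [hV, clampTo_eq_left (not_lt.1 hu)]
      simp [rectIncr]
    · by_contra hv
      refine h ?_
      simp only [hV, clampTo_eq_left (not_lt.1 hv)]
      simp [rectIncr]
  obtain ⟨C', hC'⟩ := hdiag
  have Wdiag : ∀ u, -t ≤ u → u ≤ s → W (u, -u) = 0 := by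
    intro u h1 h2
    have m : (u, -u) ∈ D := hcone ⟨h2, by simp only; linarith, by simp⟩
    have e1 : Y (u, -u) = 0 := by
      have := hC' u (-u) m
      rw [add_neg_cancel, Real.zero_rpow (by linarith), mul_zero] at this
      exact abs_eq_zero.1 (le_antisymm this (abs_nonneg _))
    have e2 : ∀ n, V n (u, -u) = 0 := fun n => by
      by_contra h
      have := Vzero n _ _ h
      linarith [(corner n).1]
    simp only [hW, e1, e2, tsum_zero, sub_zero]
  have hts : -t ≤ s := by linarith
  -- For `W` the rectangles contribute nothing, so the splitting of triangles becomes exact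
  -- additivity, and the value at the vertex is a sum over `N` small triangles along the
  -- antidiagonal.
  have Wsum : ∀ N : ℕ, N ≠ 0 → W (s, t) = ∑ k ∈ Finset.range N,
      W (unifPart (-t) s N (k + 1), -unifPart (-t) s N k) := by
    intro N hN
    have := sum_additive (J := fun u w => W (w, -u)) (l := -t) (r := s)
      (fun u v w h1 h2 h3 h4 => by
        have e := hzero h3 (show -v ≤ -u by linarith) (by linarith) h4 (by linarith)
        have e' := Wdiag v (h1.trans h2) (h3.trans h4)
        rw [rectIncr, e'] at e
        linarith) (unifPart_monotone hts N) (unifPart_mem hts hN) N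
    simp only [unifPart_zero, unifPart_last (-t) s hN, neg_neg] at this
    exact this.symm
  have hl : 0 ≤ s - -t := by linarith
  have T1 : Filter.Tendsto (fun N : ℕ => ∑ k ∈ Finset.range N,
      Y (unifPart (-t) s N (k + 1), -unifPart (-t) s N k)) Filter.atTop (nhds 0) := by
    have lim := (tendsto_nat_mul_div_rpow (s - -t) hl hγγ).const_mul C'
    rw [mul_zero] at lim
    refine squeeze_zero_norm' ?_ lim
    filter_upwards [Filter.eventually_gt_atTop 0] with N hN
    rw [Real.norm_eq_abs]
    refine (Finset.abs_sum_le_sum_abs _ _).trans ?_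
    calc _ ≤ ∑ k ∈ Finset.range N, C' * ((s - -t) / N) ^ (γ + γ') := by
          refine Finset.sum_le_sum fun k hk => ?_
          have hm := unifPart_monotone hts N (Nat.le_succ k)
          have i1 := unifPart_mem hts hN.ne' k
          have i2 := unifPart_mem hts hN.ne' (k + 1)
          rw [← unifPart_succ_sub (-t) s (Finset.mem_range.1 hk), sub_eq_add_neg]
          exact hC' _ _ (hcone ⟨i2.2, by simp only; linarith [i1.1], by simp only; linarith⟩)
      _ = _ := by rw [Finset.sum_const, Finset.card_range, nsmul_eq_mul]; ring
  -- Let `q i` be the partition points. A nonzero value forces `q i < -t₁ n ≤ s₁ n < q (i + 1)`, so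
  -- the lower left corner of the rectangle determines the triangle.
  have single : ∀ (N n : ℕ), ∀ i ∈ Finset.range N, ∀ j ∈ Finset.range N,
      V n (unifPart (-t) s N (i + 1), -unifPart (-t) s N i) ≠ 0 →
      V n (unifPart (-t) s N (j + 1), -unifPart (-t) s N j) ≠ 0 → i = j := by
    intro N n i _ j _ hi hj
    have a1 := Vzero n _ _ hi
    have a2 := Vzero n _ _ hj
    have a3 := (corner n).1
    rcases lt_trichotomy i j with h | h | h
    · have := unifPart_monotone hts N (show i + 1 ≤ j from h)
      linarith [a1.1, a2.2]
    · exact h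
    · have := unifPart_monotone hts N (show j + 1 ≤ i from h)
      linarith [a2.1, a1.2]
  -- Dominated convergence over the rectangles. For fixed `n` at most one triangle contributes, and
  -- its contribution is bounded both by a quantity vanishing with `N` and by the summable size of
  -- the rectangle.
  have T2 : Filter.Tendsto (fun N : ℕ => ∑' n, ∑ k ∈ Finset.range N,
      V n (unifPart (-t) s N (k + 1), -unifPart (-t) s N k)) Filter.atTop
      (nhds (∑' _ : ℕ, (0 : ℝ))) := by
    refine tendsto_tsum_of_dominated_convergence hsum (fun n => ?_)
      (Filter.Eventually.of_forall fun N n => ?_)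
    · have lim : Filter.Tendsto (fun N : ℕ => C * (((s - -t) / (N : ℝ)) ^ γ * ((s - -t) / N) ^ γ'))
          Filter.atTop (nhds (C * (0 ^ γ * 0 ^ γ'))) := by
        have h0 := tendsto_const_div_atTop_nhds_zero_nat (s - -t)
        exact ((h0.rpow_const (Or.inr hγ.le)).mul (h0.rpow_const (Or.inr hγ'.le))).const_mul C
      rw [Real.zero_rpow hγ.ne', zero_mul, mul_zero] at lim
      refine squeeze_zero_norm' ?_ lim
      filter_upwards [Filter.eventually_gt_atTop 0] with N hN
      have hq : 0 ≤ (s - -t) / (N : ℝ) := div_nonneg hl (Nat.cast_nonneg N)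
      have hq1 := Real.rpow_nonneg hq γ
      have hq2 := Real.rpow_nonneg hq γ'
      refine abs_sum_le_of_single (by positivity) (fun k hk => ?_) (single N n)
      by_cases h : V n (unifPart (-t) s N (k + 1), -unifPart (-t) s N k) = 0
      · rw [h, abs_zero]; positivity
      · obtain ⟨z1, z2⟩ := Vzero n _ _ h
        have hs := unifPart_succ_sub (-t) s (Finset.mem_range.1 hk)
        have c0 := (corner n).1
        have m1 := sub_nonneg.2 (clampTo_mem (hF.le_fst n) (unifPart (-t) s N (k + 1))).1
        have m2 := sub_nonneg.2 (clampTo_mem (hF.le_snd n) (-unifPart (-t) s N k)).1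
        have l1 := clampTo_sub_le (b := s₂ n) z1.le
        have l2 := clampTo_sub_le (b := t₂ n) z2.le
        refine (Vle n _).trans ?_
        rw [mul_assoc]
        have l1' := l1.trans (show _ ≤ (s - -t) / (N : ℝ) by linarith)
        have l2' := l2.trans (show _ ≤ (s - -t) / (N : ℝ) by linarith)
        simp only
        gcongr
    · have h5 := Real.rpow_nonneg (sub_nonneg.2 (hF.le_fst n)) γ
      have h6 := Real.rpow_nonneg (sub_nonneg.2 (hF.le_snd n)) γ'
      exact abs_sum_le_of_single (by positivity) (fun k _ => Vbound n _) (single N n)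
  rw [tsum_zero] at T2
  have W0 : W (s, t) = 0 := by
    have T := T1.sub T2
    rw [sub_zero] at T
    refine tendsto_nhds_unique (tendsto_const_nhds.congr' ?_) T
    filter_upwards [Filter.eventually_gt_atTop 0] with N hN
    rw [Wsum N hN.ne', Summable.tsum_finsetSum fun k _ => Vsum _, ← Finset.sum_sub_distrib]
  have hfin : ∑' n, V n (s, t) = Y (s, t) := by
    have : Y (s, t) - ∑' n, V n (s, t) = 0 := W0
    linarith
  rw [← hfin]
  refine (Vsum (s, t)).hasSum.congr_fun fun n => ?_
  simp only [hV, clampTo_eq_right (hF.le_fst n) (corner n).2.1,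
    clampTo_eq_right (hF.le_snd n) (corner n).2.2]

end ConeSum

/-! ### Existence of families of rectangles filling a cone -/

/-- The dyadic squares filling the cone with vertex `(s, t)`: the square `j < 2 ^ k` of
generation `k` has its lower left corner on the antidiagonal. For other indices, the vertex. -/
def dyadicSquare (s t : ℝ) (i : ℕ × ℕ) : (ℝ × ℝ) × (ℝ × ℝ) :=
  if i.2 < 2 ^ i.1 then
    ((-t + (2 * i.2 + 1) * ((s + t) / 2 ^ (i.1 + 1)), -t + (2 * i.2 + 2) * ((s + t) / 2 ^ (i.1 + 1))),
      (t - (2 * i.2 + 1) * ((s + t) / 2 ^ (i.1 + 1)), t - 2 * i.2 * ((s + t) / 2 ^ (i.1 + 1))))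
  else ((s, s), (t, t))

/-- In units of the finer side `e'`, the lower left corner of the coarser square is at the even
number `2 * M`. A common point would give `2 * M < 2 * j' + 2` and `2 * j' < 2 * M`, impossible for
integers. -/
lemma dyadicSquare_disjoint_of_lt {s t : ℝ} {k j k' j' : ℕ} (hk : k < k')
    {q : ℝ × ℝ} (hj : j < 2 ^ k) (hj' : j' < 2 ^ k')
    (h : q ∈ Ioo (dyadicSquare s t (k, j)).1.1 (dyadicSquare s t (k, j)).1.2 ×ˢ
      Ioo (dyadicSquare s t (k, j)).2.1 (dyadicSquare s t (k, j)).2.2)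
    (h' : q ∈ Ioo (dyadicSquare s t (k', j')).1.1 (dyadicSquare s t (k', j')).1.2 ×ˢ
      Ioo (dyadicSquare s t (k', j')).2.1 (dyadicSquare s t (k', j')).2.2) : False := by
  simp only [dyadicSquare, hj, hj', if_true] at h h'
  obtain ⟨⟨h1, h2⟩, ⟨h3, h4⟩⟩ := h
  obtain ⟨⟨h1', h2'⟩, ⟨h3', h4'⟩⟩ := h'
  set e' := (s + t) / 2 ^ (k' + 1) with he'
  have hpos : 0 < e' := by linarith
  have he : (s + t) / 2 ^ (k + 1) = (2 ^ (k' - k) : ℕ) * e' := by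
    have h2 : (2 : ℝ) ^ (k' + 1) = 2 ^ (k' - k) * 2 ^ (k + 1) := by
      rw [← pow_add]; congr 1; omega
    rw [he', h2]; push_cast
    field_simp
  obtain ⟨m, hm⟩ : ∃ m : ℕ, k' - k = m + 1 := ⟨k' - k - 1, by omega⟩
  rw [he, hm] at h1 h3
  have e1 : (2 * (j : ℝ) + 1) * (((2 ^ (m + 1) : ℕ) : ℝ) * e') =
      2 * (((2 * j + 1) * 2 ^ m : ℕ) : ℝ) * e' := by push_cast; ring
  rw [e1] at h1 h3
  set M := (2 * j + 1) * 2 ^ m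
  have l1 : (2 * (M : ℝ)) * e' < (2 * j' + 2) * e' := by linarith
  have l2 : (2 * (j' : ℝ)) * e' < 2 * M * e' := by linarith
  have l1' : 2 * (M : ℝ) < 2 * j' + 2 := lt_of_mul_lt_mul_right l1 hpos.le
  have l2' : 2 * (j' : ℝ) < 2 * M := lt_of_mul_lt_mul_right l2 hpos.le
  have l3 : M < j' + 1 := by exact_mod_cast (by linarith : (M : ℝ) < j' + 1)
  have l4 : j' < M := by exact_mod_cast (by linarith : (j' : ℝ) < M)
  omega

lemma dyadicSquare_disjoint {s t : ℝ} {i i' : ℕ × ℕ} (hne : i ≠ i') :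
    Disjoint (Ioo (dyadicSquare s t i).1.1 (dyadicSquare s t i).1.2 ×ˢ
      Ioo (dyadicSquare s t i).2.1 (dyadicSquare s t i).2.2)
      (Ioo (dyadicSquare s t i').1.1 (dyadicSquare s t i').1.2 ×ˢ
      Ioo (dyadicSquare s t i').2.1 (dyadicSquare s t i').2.2) := by
  obtain ⟨k, j⟩ := i
  obtain ⟨k', j'⟩ := i'
  by_cases hj : j < 2 ^ k
  swap
  · simp [dyadicSquare, hj]
  by_cases hj' : j' < 2 ^ k'
  swap
  · simp [dyadicSquare, hj']
  rw [Set.disjoint_left]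
  intro q h h'
  rcases lt_trichotomy k k' with hk | rfl | hk
  · exact dyadicSquare_disjoint_of_lt hk hj hj' h h'
  · simp only [dyadicSquare, hj, hj', if_true] at h h'
    obtain ⟨⟨h1, h2⟩, -⟩ := h
    obtain ⟨⟨h1', h2'⟩, -⟩ := h'
    set e := (s + t) / 2 ^ (k + 1)
    have hpos : 0 < e := by linarith
    have l1 : 2 * (j : ℝ) + 1 < 2 * j' + 2 :=
      lt_of_mul_lt_mul_right (by linarith : (2 * (j : ℝ) + 1) * e < (2 * j' + 2) * e) hpos.le
    have l2 : 2 * (j' : ℝ) + 1 < 2 * j + 2 :=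
      lt_of_mul_lt_mul_right (by linarith : (2 * (j' : ℝ) + 1) * e < (2 * j + 2) * e) hpos.le
    have l3 : 2 * j + 1 < 2 * j' + 2 := by exact_mod_cast l1
    have l4 : 2 * j' + 1 < 2 * j + 2 := by exact_mod_cast l2
    exact hne (by rw [show j = j' by omega])
  · exact dyadicSquare_disjoint_of_lt hk hj' hj h' h

lemma dyadicSquare_le {s t : ℝ} (hst : 0 ≤ s + t) (i : ℕ × ℕ) :
    (dyadicSquare s t i).1.1 ≤ (dyadicSquare s t i).1.2 ∧
      (dyadicSquare s t i).2.1 ≤ (dyadicSquare s t i).2.2 ∧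
      0 ≤ (dyadicSquare s t i).1.1 + (dyadicSquare s t i).2.1 ∧
      (dyadicSquare s t i).1.2 ≤ s ∧ (dyadicSquare s t i).2.2 ≤ t := by
  obtain ⟨k, j⟩ := i
  by_cases hj : j < 2 ^ k
  · simp only [dyadicSquare, hj, if_true]
    have he : 0 ≤ (s + t) / 2 ^ (k + 1) := by positivity
    have h1 : 2 ^ (k + 1) * ((s + t) / 2 ^ (k + 1)) = s + t := by field_simp
    set e := (s + t) / 2 ^ (k + 1)
    have hj2 : (2 * (j : ℝ) + 2) ≤ 2 ^ (k + 1) := by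
      have : 2 * j + 2 ≤ 2 ^ (k + 1) := by rw [pow_succ]; omega
      exact_mod_cast this
    have hj3 := mul_le_mul_of_nonneg_right hj2 he
    have hj4 : 0 ≤ 2 * (j : ℝ) * e := by positivity
    refine ⟨by linarith, by linarith, by linarith, by linarith, by linarith⟩
  · simpa [dyadicSquare, hj] using hst

/-- Take the smallest generation `K` at which a multiple of `(s + t) / 2 ^ K` lies in `[t - q.2, q.1
+ t]`. This interval lies strictly between `0` and `s + t`, so `K > 0`. By minimality the multiple
is odd and the two neighbouring even ones lie outside, which places `q` in the square attached to
it. -/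
lemma dyadicSquare_covers {s t : ℝ} {q : ℝ × ℝ} (hq : q ∈ openCone (s, t)) :
    ∃ i, q ∈ Icc (dyadicSquare s t i).1.1 (dyadicSquare s t i).1.2 ×ˢ
      Icc (dyadicSquare s t i).2.1 (dyadicSquare s t i).2.2 := by
  obtain ⟨h1, h2, h3⟩ := hq
  simp only at h1 h2
  have hl : 0 < s + t := by linarith
  have hex : ∃ K : ℕ, ∃ m : ℕ, t - q.2 ≤ m * ((s + t) / 2 ^ K) ∧
      m * ((s + t) / 2 ^ K) ≤ q.1 + t := by
    obtain ⟨K, hK⟩ := pow_unbounded_of_one_lt ((s + t) / (q.1 + q.2)) (one_lt_two : (1 : ℝ) < 2)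
    have he : 0 < (s + t) / 2 ^ K := by positivity
    have he' : (s + t) / 2 ^ K ≤ q.1 + q.2 := by
      rw [div_lt_iff₀ h3] at hK
      rw [div_le_iff₀ (by positivity)]; linarith
    refine ⟨K, ⌈(t - q.2) / ((s + t) / 2 ^ K)⌉₊, ?_, ?_⟩
    · exact (div_le_iff₀ he).1 (Nat.le_ceil _)
    · have := Nat.ceil_lt_add_one (div_nonneg (by linarith : 0 ≤ t - q.2) he.le)
      have := mul_lt_mul_of_pos_right this he
      rw [add_mul, div_mul_cancel₀ _ he.ne'] at this
      linarith
  classical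
  obtain ⟨m, hm1, hm2⟩ := Nat.find_spec hex
  have hmin := fun K (hK : K < Nat.find hex) => Nat.find_min hex hK
  set K := Nat.find hex
  rcases Nat.eq_zero_or_eq_succ_pred K with h0 | hsucc
  · rw [h0] at hm1 hm2
    simp only [pow_zero, div_one] at hm1 hm2
    have a1 : 0 < m := by
      rcases Nat.eq_zero_or_pos m with h | h
      · rw [h] at hm1; simp at hm1; linarith
      · exact h
    have a2 : (1 : ℝ) ≤ m := by exact_mod_cast a1
    have := mul_le_mul_of_nonneg_right a2 hl.le
    linarith
  · obtain ⟨k, hk⟩ : ∃ k, K = k + 1 := ⟨_, hsucc⟩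
    have hmin' := hmin k (by omega)
    rw [hk] at hm1 hm2
    have hhalf : (s + t) / 2 ^ k = 2 * ((s + t) / 2 ^ (k + 1)) := by rw [pow_succ]; field_simp
    have hfull : 2 ^ (k + 1) * ((s + t) / 2 ^ (k + 1)) = s + t := by field_simp
    push Not at hmin'
    rw [hhalf] at hmin'
    have he : 0 < (s + t) / 2 ^ (k + 1) := by positivity
    set e := (s + t) / 2 ^ (k + 1)
    rcases Nat.even_or_odd m with ⟨j, hj⟩ | ⟨j, hj⟩
    · exfalso
      have := hmin' j (by rw [hj] at hm1; push_cast at hm1; linarith)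
      rw [hj] at hm2; push_cast at hm2; linarith
    · rw [hj] at hm1 hm2
      push_cast at hm1 hm2
      have hjk : j < 2 ^ k := by
        have : (2 * (j : ℝ) + 1) * e < 2 ^ (k + 1) * e := by linarith
        have := lt_of_mul_lt_mul_right this he.le
        have : 2 * j + 1 < 2 ^ (k + 1) := by exact_mod_cast this
        rw [pow_succ] at this; omega
      refine ⟨(k, j), ?_⟩
      simp only [dyadicSquare, hjk, if_true]
      refine ⟨⟨by linarith, ?_⟩, ⟨by linarith, ?_⟩⟩
      · by_contra hlt
        have := hmin' (j + 1) (by push_cast; linarith)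
        push_cast at this; linarith
      · by_contra hlt
        have := hmin' j (by linarith)
        linarith

/-- Generation `k` has `2 ^ k` squares of side `(s + t) / 2 ^ (k + 1)`, so the Hölder sizes form a
geometric series of ratio `2 ^ (1 - (γ + γ'))`. The unused indices give degenerate rectangles of
size zero. -/
theorem exists_isConeFamily {γ γ' : ℝ} (hγ : 0 < γ) (hγ' : 0 < γ') (hγγ : 1 < γ + γ') {p : ℝ × ℝ}
    (hp : 0 ≤ p.1 + p.2) : ∃ s₁ s₂ t₁ t₂ : ℕ → ℝ, IsConeFamily γ γ' p s₁ s₂ t₁ t₂ := by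
  obtain ⟨s, t⟩ := p
  simp only at hp
  set S : ℕ → (ℝ × ℝ) × (ℝ × ℝ) := fun n => dyadicSquare s t (Nat.unpair n) with hS
  refine ⟨fun n => (S n).1.1, fun n => (S n).1.2, fun n => (S n).2.1, fun n => (S n).2.2, ?_⟩
  refine ⟨fun n => (dyadicSquare_le hp _).1, fun n => (dyadicSquare_le hp _).2.1,
    fun n m hnm => dyadicSquare_disjoint fun h => hnm ?_, fun q hq => ?_, ?_, ?_⟩
  · have := congrArg (fun i => Nat.pair i.1 i.2) h
    simpa using this
  · obtain ⟨i, hi⟩ := dyadicSquare_covers hq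
    refine mem_iUnion.2 ⟨Nat.pair i.1 i.2, ?_⟩
    simpa only [hS, Nat.unpair_pair] using hi
  · refine iUnion_subset fun n q hq => ?_
    obtain ⟨-, -, h1, h2, h3⟩ := dyadicSquare_le hp (Nat.unpair n)
    exact ⟨hq.1.2.trans h2, hq.2.2.trans h3, h1.trans (add_le_add hq.1.1 hq.2.1)⟩
  · set F : ℕ × ℕ → ℝ := fun i => ((dyadicSquare s t i).1.2 - (dyadicSquare s t i).1.1) ^ γ *
      ((dyadicSquare s t i).2.2 - (dyadicSquare s t i).2.1) ^ γ' with hF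
    have hF0 : 0 ≤ F := fun i => mul_nonneg
      (Real.rpow_nonneg (sub_nonneg.2 (dyadicSquare_le hp i).1) _)
      (Real.rpow_nonneg (sub_nonneg.2 (dyadicSquare_le hp i).2.1) _)
    have hval : ∀ k j, F (k, j) = if j < 2 ^ k then ((s + t) / 2 ^ (k + 1)) ^ (γ + γ') else 0 := by
      intro k j
      have he : 0 ≤ (s + t) / 2 ^ (k + 1) := by positivity
      by_cases hj : j < 2 ^ k
      · simp only [hF, dyadicSquare, hj, if_true]
        rw [Real.rpow_add' he (by linarith)]
        congr 2 <;> ring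
      · simp [hF, dyadicSquare, hj, Real.zero_rpow hγ.ne']
    have hinner : ∀ k, HasSum (fun j => F (k, j))
        (2 ^ k * ((s + t) / 2 ^ (k + 1)) ^ (γ + γ')) := by
      intro k
      have : HasSum (fun j => F (k, j)) (∑ j ∈ Finset.range (2 ^ k), F (k, j)) :=
        hasSum_sum_of_ne_finset_zero fun j hj => by rw [hval, if_neg (by simpa using hj)]
      convert this using 1
      rw [Finset.sum_congr rfl fun j hj => by rw [hval, if_pos (Finset.mem_range.1 hj)],
        Finset.sum_const, Finset.card_range, nsmul_eq_mul]
      push_cast; ring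
    have hsum : Summable F := by
      rw [summable_prod_of_nonneg hF0]
      refine ⟨fun k => (hinner k).summable, ?_⟩
      simp only [fun k => (hinner k).tsum_eq]
      have hg : Summable fun k : ℕ => ((s + t) / 2) ^ (γ + γ') * ((2 : ℝ) ^ (1 - (γ + γ'))) ^ k :=
        (summable_geometric_of_lt_one (by positivity) (two_rpow_one_sub_lt hγγ)).mul_left _
      refine hg.congr fun k => ?_
      rw [pow_succ', ← div_div, Real.div_rpow (show 0 ≤ (s + t) / 2 by positivity) (by positivity),
        ← Real.rpow_pow_comm two_pos.le, Real.rpow_sub two_pos, Real.rpow_one, div_pow]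
      ring
    have := (Nat.pairEquiv.symm.summable_iff (f := F)).2 hsum
    exact this

/-! ### Continuity of primitives and cone integrals -/

section Primitive

variable {D : Set (ℝ × ℝ)} {R κ κ' γ γ' A B X : ℝ} {f x Y : ℝ × ℝ → ℝ}

lemma continuousOn_of_modulus {m : ℝ → ℝ} (hm : Filter.Tendsto m (nhdsWithin 0 (Ici 0)) (nhds 0))
    (h : ∀ u v u' v', (u, v) ∈ D → (u', v') ∈ D →
      |Y (u', v') - Y (u, v)| ≤ m |u' - u| + m |v' - v|) : ContinuousOn Y D := by
  intro p hp
  rw [ContinuousWithinAt, tendsto_iff_norm_sub_tendsto_zero]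
  have t1 : Filter.Tendsto (fun q : ℝ × ℝ => |q.1 - p.1|) (nhdsWithin p D)
      (nhdsWithin 0 (Ici 0)) := by
    refine tendsto_nhdsWithin_iff.2 ⟨?_, Filter.Eventually.of_forall fun q => mem_Ici.2 (abs_nonneg _)⟩
    have : Continuous fun q : ℝ × ℝ => |q.1 - p.1| := by fun_prop
    simpa using (this.tendsto p).mono_left (nhdsWithin_le_nhds (s := D))
  have t2 : Filter.Tendsto (fun q : ℝ × ℝ => |q.2 - p.2|) (nhdsWithin p D)
      (nhdsWithin 0 (Ici 0)) := by
    refine tendsto_nhdsWithin_iff.2 ⟨?_, Filter.Eventually.of_forall fun q => mem_Ici.2 (abs_nonneg _)⟩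
    have : Continuous fun q : ℝ × ℝ => |q.2 - p.2| := by fun_prop
    simpa using (this.tendsto p).mono_left (nhdsWithin_le_nhds (s := D))
  have t := (hm.comp t1).add (hm.comp t2)
  rw [add_zero] at t
  refine squeeze_zero' (Filter.Eventually.of_forall fun _ => norm_nonneg _) ?_ t
  filter_upwards [self_mem_nhdsWithin] with q hq
  exact h p.1 p.2 q.1 q.2 hp hq

/-- Hölder continuity in each variable and decay at the antidiagonal imply continuity. -/
lemma continuousOn_of_holder {θ C : ℝ} (hD : LowerDomain D R) (hκ : 0 < κ) (hκ' : 0 < κ')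
    (hθ : 0 < θ) (hA : 0 ≤ A) (hC : 0 ≤ C) (hf : HolderDom D κ κ' A Y)
    (hdiag : ∀ u v, (u, v) ∈ D → |Y (u, v)| ≤ C * (u + v) ^ θ) : ContinuousOn Y D := by
  set m : ℝ → ℝ := fun r => A * r ^ κ + A * r ^ κ' + C * r ^ θ with hm
  have hm0 : ∀ r, 0 ≤ r → 0 ≤ m r := fun r hr => by positivity
  have m1 : ∀ r, 0 ≤ r → A * r ^ κ ≤ m r := fun r hr => by
    have : 0 ≤ A * r ^ κ' := by positivity
    have : 0 ≤ C * r ^ θ := by positivity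
    simp only [hm]; linarith
  have m2 : ∀ r, 0 ≤ r → A * r ^ κ' ≤ m r := fun r hr => by
    have : 0 ≤ A * r ^ κ := by positivity
    have : 0 ≤ C * r ^ θ := by positivity
    simp only [hm]; linarith
  have m3 : ∀ r, 0 ≤ r → C * r ^ θ ≤ m r := fun r hr => by
    have : 0 ≤ A * r ^ κ := by positivity
    have : 0 ≤ A * r ^ κ' := by positivity
    simp only [hm]; linarith
  -- the case of comparable points
  have comp : ∀ u v u' v', (u, v) ∈ D → (u', v') ∈ D → u ≤ u' → v ≤ v' →
      |Y (u', v') - Y (u, v)| ≤ m (u' - u) + m (v' - v) := by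
    intro u v u' v' h h' hu hv
    have hmid : (u', v) ∈ D := hD.lower u' v' u' v h' le_rfl hv (by linarith [hD.nonneg _ _ h])
    have e1 := hf.fst u u' v hu h hmid
    have e2 := hf.snd u' v v' hv hmid h'
    have e3 := abs_add_le (Y (u', v) - Y (u, v)) (Y (u', v') - Y (u', v))
    rw [sub_add_sub_cancel'] at e3
    linarith [m1 (u' - u) (by linarith), m2 (v' - v) (by linarith)]
  -- the case of points in opposite directions
  have opp : ∀ u v u' v', (u, v) ∈ D → (u', v') ∈ D → u ≤ u' → v' ≤ v →
      |Y (u', v') - Y (u, v)| ≤ m (u' - u) + m (v - v') := by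
    intro u v u' v' h h' hu hv
    by_cases h0 : 0 ≤ u + v'
    · have hmid : (u, v') ∈ D := hD.lower u v u v' h le_rfl hv h0
      have e1 := hf.fst u u' v' hu hmid h'
      have e2 := hf.snd u v' v hv hmid h
      have e3 := abs_sub (Y (u', v') - Y (u, v')) (Y (u, v) - Y (u, v'))
      rw [sub_sub_sub_cancel_right] at e3
      linarith [m1 (u' - u) (by linarith), m2 (v - v') (by linarith)]
    -- The intermediate corner falls below the antidiagonal. Then `u + v ≤ v - v'` and `u' + v' ≤ u'
    -- - u`, and the decay of `Y` replaces the Hölder bounds.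
    · push Not at h0
      have e1 := hdiag u v h
      have e2 := hdiag u' v' h'
      have r1 := Real.rpow_le_rpow (hD.nonneg _ _ h) (show u + v ≤ v - v' by linarith) hθ.le
      have r2 := Real.rpow_le_rpow (hD.nonneg _ _ h') (show u' + v' ≤ u' - u by linarith) hθ.le
      have s1 := mul_le_mul_of_nonneg_left r1 hC
      have s2 := mul_le_mul_of_nonneg_left r2 hC
      have e3 := abs_sub (Y (u', v')) (Y (u, v))
      linarith [m3 (u' - u) (by linarith), m3 (v - v') (by linarith)]
  refine continuousOn_of_modulus (m := m) ?_ fun u v u' v' h h' => ?_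
  · have hc : Continuous m := by
      have c : ∀ ρ : ℝ, 0 < ρ → Continuous fun r : ℝ => r ^ ρ := fun ρ hρ =>
        Real.continuous_rpow_const hρ.le
      exact (((c κ hκ).const_mul A).add ((c κ' hκ').const_mul A)).add ((c θ hθ).const_mul C)
    have : m 0 = 0 := by
      simp [hm, Real.zero_rpow hκ.ne', Real.zero_rpow hκ'.ne', Real.zero_rpow hθ.ne']
    have t := (hc.tendsto 0).mono_left (nhdsWithin_le_nhds (s := Ici 0))
    rwa [this] at t
  · rcases le_total u u' with hu | hu <;> rcases le_total v v' with hv | hv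
    · rw [abs_of_nonneg (sub_nonneg.2 hu), abs_of_nonneg (sub_nonneg.2 hv)]
      exact comp u v u' v' h h' hu hv
    · rw [abs_of_nonneg (sub_nonneg.2 hu), abs_of_nonpos (sub_nonpos.2 hv), neg_sub]
      exact opp u v u' v' h h' hu hv
    · rw [abs_of_nonpos (sub_nonpos.2 hu), abs_of_nonneg (sub_nonneg.2 hv), neg_sub,
        abs_sub_comm]
      exact opp u' v' u v h' h hu hv
    · rw [abs_of_nonpos (sub_nonpos.2 hu), abs_of_nonpos (sub_nonpos.2 hv), neg_sub, neg_sub,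
        abs_sub_comm]
      exact comp u' v' u v h' h hu hv

lemma weightSum_one {h : ℝ} (hh : 0 < h) : WeightSum h (fun _ => 1) (fun τ => 1 + τ / h) where
  mono := monotone_const
  nonneg _ := zero_le_one
  le τ hτ := by have := div_nonneg hτ hh.le; linarith
  add_le τ _ := by rw [sub_div, div_self hh.ne']; linarith

/-- A primitive of a Hölder function has the Hölder exponents of the integrator. -/
theorem IsPrimitive.holderDom (he : YoungExp κ κ' γ γ') (hD : LowerDomain D R) (hA : 0 ≤ A)
    (hX : 0 ≤ X) (hf : HolderDom D κ κ' A f) (hB : ∀ u v, (u, v) ∈ D → |f (u, v)| ≤ B)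
    (hx : RectDom D γ γ' X x) (hY : IsPrimitive D γ γ' f x Y) :
    ∃ A', 0 ≤ A' ∧ HolderDom D γ γ' A' Y := by
  -- at the scale of the diameter there is no restriction on the increments
  set h := max (2 * R) 1 with hh
  have h1 : 1 ≤ h := le_max_right _ _
  have h0 : 0 < h := by linarith
  set Q := |B| + A * h ^ κ + A * h ^ κ' + A * h ^ κ * h ^ κ' with hQ
  have n1 := Real.rpow_nonneg h0.le κ
  have n2 := Real.rpow_nonneg h0.le κ'
  have q0 := abs_nonneg B
  have q1 : 0 ≤ A * h ^ κ := by positivity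
  have q2 : 0 ≤ A * h ^ κ' := by positivity
  have q3 : 0 ≤ A * h ^ κ * h ^ κ' := by positivity
  have hQ0 : 0 ≤ Q := by positivity
  have hctrl : CtrlDom D κ κ' h Q (fun _ => 1) f := by
    refine ⟨⟨fun a b t i1 i2 i3 i4 => ?_, fun s c d i1 i2 i3 i4 => ?_,
      fun a b c d i1 i2 i3 i4 i5 i6 => ?_⟩, fun u v huv => ?_⟩
    · have n := sub_nonneg.2 i1
      refine (hf.fst a b t i1 i3 i4).trans ?_
      rw [div_rpow_mul_rpow n h0, mul_one, ← mul_assoc]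
      exact mul_le_mul_of_nonneg_right (by linarith) (Real.rpow_nonneg (div_nonneg n h0.le) _)
    · have n := sub_nonneg.2 i1
      refine (hf.snd s c d i1 i3 i4).trans ?_
      rw [div_rpow_mul_rpow n h0, mul_one, ← mul_assoc]
      exact mul_le_mul_of_nonneg_right (by linarith) (Real.rpow_nonneg (div_nonneg n h0.le) _)
    · have n := sub_nonneg.2 i1
      have n' := sub_nonneg.2 i2
      refine (hf.rect a b c d i1 i2 i5 i6).trans ?_
      rw [div_rpow_mul_rpow n h0, div_rpow_mul_rpow n' h0, mul_one,
        show A * (h ^ κ * ((b - a) / h) ^ κ) * (h ^ κ' * ((d - c) / h) ^ κ') =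
          A * h ^ κ * h ^ κ' * ((b - a) / h) ^ κ * ((d - c) / h) ^ κ' by ring]
      have := Real.rpow_nonneg (div_nonneg n h0.le) κ
      have := Real.rpow_nonneg (div_nonneg n' h0.le) κ'
      have : A * h ^ κ * h ^ κ' ≤ Q := by linarith
      gcongr
    · have := (hB u v huv).trans (le_abs_self B)
      rw [mul_one]; linarith
  have hω := weightSum_one h0
  have side : ∀ a b t, (a, t) ∈ D → (b, t) ∈ D → b - a ≤ h := fun a b t i1 i2 =>
    le_trans (by linarith [(hD.bdd _ _ i2).1, (hD.bdd _ _ i1).2, hD.nonneg _ _ i1])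
      (le_max_left _ _)
  have side' : ∀ s c d, (s, c) ∈ D → (s, d) ∈ D → d - c ≤ h := fun s c d i1 i2 =>
    le_trans (by linarith [(hD.bdd _ _ i2).2, (hD.bdd _ _ i1).1, hD.nonneg _ _ i1])
      (le_max_left _ _)
  have wt : ∀ u v, (u, v) ∈ D → 1 + (u + v) / h ≤ 2 := fun u v i => by
    have : (u + v) / h ≤ 1 := (div_le_one h0).2
      (le_trans (by linarith [(hD.bdd _ _ i).1, (hD.bdd _ _ i).2]) (le_max_left _ _))
    linarith
  have hC := primConst_pos he
  have hyc := youngConst_pos he.fst he.snd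
  have hs := sewConst_pos he.sum
  have g1 := Real.one_le_rpow h1 he.γ_pos.le
  have g2 := Real.one_le_rpow h1 he.γ'_pos.le
  set A' := primConst κ κ' γ γ' * X * Q * h ^ γ * h ^ γ' * 2 with hA'
  have hP0 : 0 ≤ primConst κ κ' γ γ' * X * Q := by positivity
  have hA'0 : 0 ≤ A' := by positivity
  refine ⟨A', hA'0, fun a b t i1 i3 i4 => ?_, fun s c d i1 i3 i4 => ?_,
    fun a b c d i1 i2 i5 i6 => ?_⟩
  · have e := hctrl.fst_estimate he hD h0 hQ0 hX hω hx hY i1 (side a b t i3 i4) i3 i4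
    have n := Real.rpow_nonneg (sub_nonneg.2 i1) γ
    have w := wt b t i4
    calc _ ≤ primConst κ κ' γ γ' * X * Q * (b - a) ^ γ * h ^ γ' * (1 + (b + t) / h) := e
      _ ≤ primConst κ κ' γ γ' * X * Q * (b - a) ^ γ * h ^ γ' * 2 := by gcongr
      _ = 1 * (primConst κ κ' γ γ' * X * Q * (b - a) ^ γ * h ^ γ' * 2) := by ring
      _ ≤ h ^ γ * (primConst κ κ' γ γ' * X * Q * (b - a) ^ γ * h ^ γ' * 2) := by gcongr
      _ = _ := by rw [hA']; ring
  · have e := hctrl.swap.fst_estimate he.swap hD.swap h0 hQ0 hX hω hx.swap hY.swap i1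
      (side' s c d i3 i4) (show (c, s) ∈ Prod.swap ⁻¹' D from i3) i4
    have n := Real.rpow_nonneg (sub_nonneg.2 i1) γ'
    have w := wt s d i4
    rw [add_comm s d] at w
    calc _ ≤ primConst κ' κ γ' γ * X * Q * (d - c) ^ γ' * h ^ γ * (1 + (d + s) / h) := e
      _ = primConst κ κ' γ γ' * X * Q * (d - c) ^ γ' * h ^ γ * (1 + (d + s) / h) := by
        rw [primConst_swap]
      _ ≤ primConst κ κ' γ γ' * X * Q * (d - c) ^ γ' * h ^ γ * 2 := by gcongr
      _ = 1 * (primConst κ κ' γ γ' * X * Q * (d - c) ^ γ' * h ^ γ * 2) := by ring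
      _ ≤ h ^ γ' * (primConst κ κ' γ γ' * X * Q * (d - c) ^ γ' * h ^ γ * 2) := by gcongr
      _ = _ := by rw [hA']; ring
  · have m1 := hD.mem_of_rect i5 i6 le_rfl i1 i2 le_rfl
    have m2 := hD.mem_of_rect i5 i6 i1 le_rfl le_rfl i2
    have e := hctrl.rect_estimate he hD h0 hQ0 hX hω.mono hω.nonneg hx hY i1 i2
      (side a b d m1 i6) (side' b c d m2 i6) i5 i6
    have n := Real.rpow_nonneg (sub_nonneg.2 i1) γ
    have n' := Real.rpow_nonneg (sub_nonneg.2 i2) γ'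
    have hc : 4 * youngConst (κ + γ) (κ' + γ') ≤ primConst κ κ' γ γ' := by
      rw [primConst]; exact le_mul_of_one_le_left (by positivity) (by linarith)
    refine e.trans ?_
    rw [mul_one]
    have : 4 * youngConst (κ + γ) (κ' + γ') * X * Q ≤ A' := by
      calc _ ≤ primConst κ κ' γ γ' * X * Q := by gcongr
        _ = primConst κ κ' γ γ' * X * Q * 1 * 1 * 1 := by ring
        _ ≤ _ := by rw [hA']; gcongr; norm_num
    gcongr

/-- A primitive is the cone integral. -/
theorem IsPrimitive.hasConeIntegral (he : YoungExp κ κ' γ γ') (hD : LowerDomain D R) (hA : 0 ≤ A)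
    (hX : 0 ≤ X) (hf : HolderDom D κ κ' A f) (hB : ∀ u v, (u, v) ∈ D → |f (u, v)| ≤ B)
    (hx : RectDom D γ γ' X x) (hY : IsPrimitive D γ γ' f x Y) {p : ℝ × ℝ} (hp : p ∈ D) :
    HasConeIntegral γ γ' f x p (Y p) := by
  have hγγ : 0 < γ + γ' := by linarith [he.sum]
  obtain ⟨A', hA', hol⟩ := hY.holderDom he hD hA hX hf hB hx
  obtain ⟨C, hC⟩ := hY.bound
  have hcont : ContinuousOn Y D := continuousOn_of_holder (C := |C|) hD he.γ_pos he.γ'_pos hγγ hA'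
    (abs_nonneg C) hol fun u v h => (hC u v h).trans (mul_le_mul_of_nonneg_right (le_abs_self C)
      (Real.rpow_nonneg (hD.nonneg _ _ h) _))
  refine ⟨exists_isConeFamily he.γ_pos he.γ'_pos he.sum (hD.nonneg _ _ hp),
    fun s₁ s₂ t₁ t₂ hF => ⟨fun n => rectIncr Y (s₁ n) (s₂ n) (t₁ n) (t₂ n), fun n => ?_, ?_⟩⟩
  · obtain ⟨h1, h2, h3⟩ := hF.corner n
    exact hY.rect _ _ _ _ (hF.le_fst n) (hF.le_snd n) h1
      (hD.lower p.1 p.2 _ _ hp h2 h3 (by linarith [hF.le_fst n, hF.le_snd n]))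
  · exact hasSum_rectIncr_cone hD he.γ_pos he.γ'_pos he.sum hA' hol.rect hcont hY.bound hp hF

/-- Uniqueness rests on the existence of one family, which is part of the definition: without it
every number would be an integral vacuously. -/
lemma HasConeIntegral.unique {p : ℝ × ℝ} {I I' : ℝ} (h : HasConeIntegral γ γ' f x p I)
    (h' : HasConeIntegral γ γ' f x p I') : I = I' := by
  obtain ⟨s₁, s₂, t₁, t₂, hF⟩ := h.1
  obtain ⟨z, hz, hs⟩ := h.2 _ _ _ _ hF
  obtain ⟨z', hz', hs'⟩ := h'.2 _ _ _ _ hF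
  have : z = z' := funext fun n => (hz n).unique (hF.le_fst n) (hF.le_snd n) (hz' n)
  exact hs.unique (this ▸ hs')

end Primitive

/-! ### Composition with a function that has bounded derivatives -/

/-- Bounds for a function, its first and its second differences. -/
structure RegFun (B : ℝ) (τ : ℝ → ℝ) : Prop where
  bdd : ∀ r, |τ r| ≤ B
  lip : ∀ p q, |τ p - τ q| ≤ B * |p - q|
  snd : ∀ p α β, |τ (p + α + β) - τ (p + α) - τ (p + β) + τ p| ≤ B * |α| * |β|

lemma RegFun.nonneg {B : ℝ} {τ : ℝ → ℝ} (h : RegFun B τ) : 0 ≤ B := (abs_nonneg _).trans (h.bdd 0)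

lemma abs_sub_le_of_abs_deriv_le {g : ℝ → ℝ} {B : ℝ} (hg : Differentiable ℝ g)
    (hB : ∀ r, |deriv g r| ≤ B) (p q : ℝ) : |g p - g q| ≤ B * |p - q| :=
  convex_univ.norm_image_sub_le_of_norm_deriv_le (fun r _ => hg r) (fun r _ => hB r)
    (mem_univ q) (mem_univ p)

lemma regFun_of_deriv_le {τ : ℝ → ℝ} {B : ℝ} (h1 : Differentiable ℝ τ)
    (h2 : Differentiable ℝ (deriv τ)) (b0 : ∀ r, |τ r| ≤ B) (b1 : ∀ r, |deriv τ r| ≤ B)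
    (b2 : ∀ r, |deriv (deriv τ) r| ≤ B) : RegFun B τ where
  bdd := b0
  lip := abs_sub_le_of_abs_deriv_le h1 b1
  snd p α β := by
    have hd : ∀ s, HasDerivAt (fun s => τ (p + α + s) - τ (p + s))
        (deriv τ (p + α + s) - deriv τ (p + s)) s := fun s =>
      ((h1 _).hasDerivAt.comp_const_add (p + α) s).sub ((h1 _).hasDerivAt.comp_const_add p s)
    have e := abs_sub_le_of_abs_deriv_le (g := fun s => τ (p + α + s) - τ (p + s)) (B := B * |α|)
      (fun s => (hd s).differentiableAt) (fun s => by
        rw [(hd s).deriv]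
        have := abs_sub_le_of_abs_deriv_le h2 b2 (p + α + s) (p + s)
        rwa [show p + α + s - (p + s) = α by ring] at this) β 0
    simp only [add_zero, sub_zero] at e
    rwa [show τ (p + α + β) - τ (p + α) - τ (p + β) + τ p =
      τ (p + α + β) - τ (p + β) - (τ (p + α) - τ p) by ring]

section Ctrl

variable {D : Set (ℝ × ℝ)} {R κ κ' γ γ' h A B X : ℝ} {ω Ω : ℝ → ℝ} {f g x y y₁ y₂ Y : ℝ × ℝ → ℝ}

/-- Complete `y (a, c)`, `y (b, c)`, `y (a, d)` to a parallelogram. Its fourth corner differs from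
`y (b, d)` by the rectangular increment, handled by the Lipschitz bound, and the parallelogram
itself gives a second difference of `τ`. Each part costs `B`, hence `2 * B`. -/
theorem RegFun.ctrlDom_comp {τ : ℝ → ℝ} (hτ : RegFun B τ) (hD : LowerDomain D R) (hh : 0 < h)
    (hy : SemiDom D κ κ' h 1 (fun _ => 1) y) : CtrlDom D κ κ' h (2 * B) (fun _ => 1) (τ ∘ y) := by
  have hB := hτ.nonneg
  refine ⟨⟨fun a b t h1 h2 h3 h4 => ?_, fun s c d h1 h2 h3 h4 => ?_,
    fun a b c d h1 h2 h3 h4 h5 h6 => ?_⟩, fun u v _ => ?_⟩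
  · have e := hy.fst a b t h1 h2 h3 h4
    have n := Real.rpow_nonneg (div_nonneg (sub_nonneg.2 h1) hh.le) κ
    refine (hτ.lip _ _).trans ((mul_le_mul_of_nonneg_left e hB).trans ?_)
    nlinarith [mul_nonneg hB n]
  · have e := hy.snd s c d h1 h2 h3 h4
    have n := Real.rpow_nonneg (div_nonneg (sub_nonneg.2 h1) hh.le) κ'
    refine (hτ.lip _ _).trans ((mul_le_mul_of_nonneg_left e hB).trans ?_)
    nlinarith [mul_nonneg hB n]
  · have n := Real.rpow_nonneg (div_nonneg (sub_nonneg.2 h1) hh.le) κ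
    have n' := Real.rpow_nonneg (div_nonneg (sub_nonneg.2 h2) hh.le) κ'
    have m1 := hD.mem_of_rect h5 h6 le_rfl h1 le_rfl h2
    have m2 := hD.mem_of_rect h5 h6 h1 le_rfl le_rfl h2
    have m3 := hD.mem_of_rect h5 h6 le_rfl h1 h2 le_rfl
    have e1 := hy.fst a b c h1 h3 m1 m2
    have e2 := hy.snd a c d h2 h4 m1 m3
    have e3 := hy.rect a b c d h1 h2 h3 h4 h5 h6
    simp only [mul_one, one_mul] at e1 e2 e3
    set P := ((b - a) / h) ^ κ
    set Q := ((d - c) / h) ^ κ'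
    have l1 := hτ.lip (y (b, d)) (y (a, c) + (y (b, c) - y (a, c)) + (y (a, d) - y (a, c)))
    have l2 := hτ.snd (y (a, c)) (y (b, c) - y (a, c)) (y (a, d) - y (a, c))
    rw [show y (b, d) - (y (a, c) + (y (b, c) - y (a, c)) + (y (a, d) - y (a, c))) =
      rectIncr y a b c d by rw [rectIncr]; ring] at l1
    have l3 : B * |rectIncr y a b c d| ≤ B * (P * Q) := mul_le_mul_of_nonneg_left e3 hB
    have l4 : B * |y (b, c) - y (a, c)| * |y (a, d) - y (a, c)| ≤ B * (P * Q) := by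
      rw [mul_assoc]
      exact mul_le_mul_of_nonneg_left (mul_le_mul e1 e2 (abs_nonneg _) n) hB
    have e : rectIncr (τ ∘ y) a b c d =
        (τ (y (b, d)) - τ (y (a, c) + (y (b, c) - y (a, c)) + (y (a, d) - y (a, c)))) +
        (τ (y (a, c) + (y (b, c) - y (a, c)) + (y (a, d) - y (a, c))) -
          τ (y (a, c) + (y (b, c) - y (a, c))) - τ (y (a, c) + (y (a, d) - y (a, c))) +
          τ (y (a, c))) := by
      simp only [rectIncr, Function.comp, add_sub_cancel]; ring
    rw [e]
    refine (abs_add_le _ _).trans ((add_le_add l1 l2).trans ?_)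
    linarith
  · have := hτ.bdd (y (u, v))
    simp only [Function.comp, mul_one]; linarith

/-- The discrete product rule: the rectangular increment of a product has four terms, and
monotonicity moves every weight to the upper right corner. -/
theorem CtrlDom.mul (hD : LowerDomain D R) (hh : 0 < h) (hA : 0 ≤ A) (hB : 0 ≤ B)
    (hω : Monotone ω) (hω0 : ∀ τ, 0 ≤ ω τ) (hf : CtrlDom D κ κ' h A ω f)
    (hg : CtrlDom D κ κ' h B (fun _ => 1) g) : CtrlDom D κ κ' h (4 * (A * B)) ω (f * g) := by
  have bound : ∀ {p q P Q : ℝ}, |p| ≤ P → |q| ≤ Q → |p * q| ≤ P * Q := fun hp hq => by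
    rw [abs_mul]
    exact mul_le_mul hp hq (abs_nonneg _) ((abs_nonneg _).trans hp)
  refine ⟨⟨fun a b t h1 h2 h3 h4 => ?_, fun s c d h1 h2 h3 h4 => ?_,
    fun a b c d h1 h2 h3 h4 h5 h6 => ?_⟩, fun u v h1 => ?_⟩
  · have n := Real.rpow_nonneg (div_nonneg (sub_nonneg.2 h1) hh.le) κ
    have e1 := bound (hf.fst a b t h1 h2 h3 h4) (hg.sup b t h4)
    have e2 := bound (hf.sup a t h3) (hg.fst a b t h1 h2 h3 h4)
    have w : ω (a + t) ≤ ω (b + t) := hω (by linarith)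
    have w0 := hω0 (b + t)
    set P := ((b - a) / h) ^ κ
    have e : (f * g) (b, t) - (f * g) (a, t) = (f (b, t) - f (a, t)) * g (b, t) +
        f (a, t) * (g (b, t) - g (a, t)) := by simp only [Pi.mul_apply]; ring
    rw [e]
    have e3 : A * ω (a + t) * (B * 1 * P) ≤ A * ω (b + t) * (B * 1 * P) := by gcongr
    have e4 : 0 ≤ A * ω (b + t) * (B * 1 * P) := by positivity
    refine (abs_add_le _ _).trans ((add_le_add e1 e2).trans ?_)
    linarith
  · have n := Real.rpow_nonneg (div_nonneg (sub_nonneg.2 h1) hh.le) κ'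
    have e1 := bound (hf.snd s c d h1 h2 h3 h4) (hg.sup s d h4)
    have e2 := bound (hf.sup s c h3) (hg.snd s c d h1 h2 h3 h4)
    have w : ω (s + c) ≤ ω (s + d) := hω (by linarith)
    have w0 := hω0 (s + d)
    set P := ((d - c) / h) ^ κ'
    have e : (f * g) (s, d) - (f * g) (s, c) = (f (s, d) - f (s, c)) * g (s, d) +
        f (s, c) * (g (s, d) - g (s, c)) := by simp only [Pi.mul_apply]; ring
    rw [e]
    have e3 : A * ω (s + c) * (B * 1 * P) ≤ A * ω (s + d) * (B * 1 * P) := by gcongr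
    have e4 : 0 ≤ A * ω (s + d) * (B * 1 * P) := by positivity
    refine (abs_add_le _ _).trans ((add_le_add e1 e2).trans ?_)
    linarith
  · have n := Real.rpow_nonneg (div_nonneg (sub_nonneg.2 h1) hh.le) κ
    have n' := Real.rpow_nonneg (div_nonneg (sub_nonneg.2 h2) hh.le) κ'
    have m1 := hD.mem_of_rect h5 h6 le_rfl h1 le_rfl h2
    have m2 := hD.mem_of_rect h5 h6 h1 le_rfl le_rfl h2
    have m3 := hD.mem_of_rect h5 h6 le_rfl h1 h2 le_rfl
    have e1 := bound (hf.rect a b c d h1 h2 h3 h4 h5 h6) (hg.sup b d h6)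
    have e2 := bound (hf.snd a c d h2 h4 m1 m3) (hg.fst a b d h1 h3 m3 h6)
    have e3 := bound (hf.fst a b c h1 h3 m1 m2) (hg.snd b c d h2 h4 m2 h6)
    have e4 := bound (hf.sup a c m1) (hg.rect a b c d h1 h2 h3 h4 h5 h6)
    have w1 : ω (a + d) ≤ ω (b + d) := hω (by linarith)
    have w2 : ω (b + c) ≤ ω (b + d) := hω (by linarith)
    have w3 : ω (a + c) ≤ ω (b + d) := hω (by linarith)
    have w0 := hω0 (b + d)
    set P := ((b - a) / h) ^ κ
    set Q := ((d - c) / h) ^ κ'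
    have e : rectIncr (f * g) a b c d = rectIncr f a b c d * g (b, d) +
        (f (a, d) - f (a, c)) * (g (b, d) - g (a, d)) +
        (f (b, c) - f (a, c)) * (g (b, d) - g (b, c)) + f (a, c) * rectIncr g a b c d := by
      simp only [rectIncr, Pi.mul_apply]; ring
    have f2 : A * ω (a + d) * Q * (B * 1 * P) ≤ A * ω (b + d) * Q * (B * 1 * P) := by gcongr
    have f3 : A * ω (b + c) * P * (B * 1 * Q) ≤ A * ω (b + d) * P * (B * 1 * Q) := by gcongr
    have f4 : A * ω (a + c) * (B * 1 * P * Q) ≤ A * ω (b + d) * (B * 1 * P * Q) := by gcongr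
    rw [e]
    refine (abs_add_le _ _).trans ((add_le_add ((abs_add_le _ _).trans
      (add_le_add ((abs_add_le _ _).trans (add_le_add e1 e2)) e3)) e4).trans ?_)
    linarith
  · have e := bound (hf.sup u v h1) (hg.sup u v h1)
    have : 0 ≤ A * ω (u + v) * B := mul_nonneg (mul_nonneg hA (hω0 _)) hB
    refine e.trans ?_
    linarith

lemma SemiDom.convex (h₁ : SemiDom D κ κ' h A ω y₁) (h₂ : SemiDom D κ κ' h A ω y₂) {θ : ℝ}
    (hθ : θ ∈ Icc (0 : ℝ) 1) : SemiDom D κ κ' h A ω (fun q => y₂ q + θ * (y₁ q - y₂ q)) := by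
  have key : ∀ {p q P : ℝ}, |p| ≤ P → |q| ≤ P → |q + θ * (p - q)| ≤ P := by
    intro p q P hp hq
    rw [abs_le] at *
    constructor <;> nlinarith [hθ.1, hθ.2]
  refine ⟨fun a b t i1 i2 i3 i4 => ?_, fun s c d i1 i2 i3 i4 => ?_,
    fun a b c d i1 i2 i3 i4 i5 i6 => ?_⟩
  · have := key (h₁.fst a b t i1 i2 i3 i4) (h₂.fst a b t i1 i2 i3 i4)
    convert this using 2; ring
  · have := key (h₁.snd s c d i1 i2 i3 i4) (h₂.snd s c d i1 i2 i3 i4)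
    convert this using 2; ring
  · have := key (h₁.rect a b c d i1 i2 i3 i4 i5 i6) (h₂.rect a b c d i1 i2 i3 i4 i5 i6)
    convert this using 2; simp only [rectIncr]; ring

lemma abs_sub_le_of_hasDerivAt {F F' : ℝ → ℝ} {c : ℝ} (hF : ∀ θ, HasDerivAt F (F' θ) θ)
    (hc : ∀ θ ∈ Icc (0 : ℝ) 1, |F' θ| ≤ c) : |F 1 - F 0| ≤ c := by
  have := (convex_Icc (0 : ℝ) 1).norm_image_sub_le_of_norm_hasDerivWithin_le
    (fun θ _ => (hF θ).hasDerivWithinAt) (fun θ hθ => hc θ hθ)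
    (left_mem_Icc.2 zero_le_one) (right_mem_Icc.2 zero_le_one)
  simpa using this

/-- All the quantities to be bounded are linear in the function. The mean value inequality along the
segment from `y₂` to `y₁` therefore transfers a bound for the derivative in `θ`, which is a product
and needs only `CtrlDom.mul` and `RegFun.ctrlDom_comp`. -/
theorem CtrlDom.comp_sub_comp {τ : ℝ → ℝ} (hτ : Differentiable ℝ τ)
    (hc : ∀ θ ∈ Icc (0 : ℝ) 1, CtrlDom D κ κ' h A ω
      ((y₁ - y₂) * (deriv τ ∘ fun q => y₂ q + θ * (y₁ q - y₂ q)))) :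
    CtrlDom D κ κ' h A ω (τ ∘ y₁ - τ ∘ y₂) := by
  have hd : ∀ q θ, HasDerivAt (fun θ => τ (y₂ q + θ * (y₁ q - y₂ q)))
      (((y₁ - y₂) * (deriv τ ∘ fun q => y₂ q + θ * (y₁ q - y₂ q))) q) θ := by
    intro q θ
    have h1 : HasDerivAt (fun θ => y₂ q + θ * (y₁ q - y₂ q)) (y₁ q - y₂ q) θ := by
      simpa using ((hasDerivAt_id θ).mul_const (y₁ q - y₂ q)).const_add (y₂ q)
    have := (hτ (y₂ q + θ * (y₁ q - y₂ q))).hasDerivAt.comp θ h1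
    simpa [mul_comm, Function.comp_def] using this
  refine ⟨⟨fun a b t i1 i2 i3 i4 => ?_, fun s c d i1 i2 i3 i4 => ?_,
    fun a b c d i1 i2 i3 i4 i5 i6 => ?_⟩, fun u v i1 => ?_⟩
  · have := abs_sub_le_of_hasDerivAt (fun θ => (hd (b, t) θ).sub (hd (a, t) θ))
      fun θ hθ => (hc θ hθ).fst a b t i1 i2 i3 i4
    convert this using 2
    simp only [Pi.sub_apply, Function.comp_apply]; ring_nf
  · have := abs_sub_le_of_hasDerivAt (fun θ => (hd (s, d) θ).sub (hd (s, c) θ))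
      fun θ hθ => (hc θ hθ).snd s c d i1 i2 i3 i4
    convert this using 2
    simp only [Pi.sub_apply, Function.comp_apply]; ring_nf
  · have := abs_sub_le_of_hasDerivAt
      (fun θ => (((hd (a, c) θ).sub (hd (a, d) θ)).sub (hd (b, c) θ)).add (hd (b, d) θ))
      fun θ hθ => (hc θ hθ).rect a b c d i1 i2 i3 i4 i5 i6
    convert this using 2
    simp only [rectIncr, Pi.sub_apply, Pi.add_apply, Function.comp_apply]; ring_nf
  · have := abs_sub_le_of_hasDerivAt (fun θ => hd (u, v) θ) fun θ hθ => (hc θ hθ).sup u v i1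
    convert this using 2
    simp only [Pi.sub_apply, Function.comp_apply]; ring_nf

/-! ### The contraction estimate -/

/-- Walk from the antidiagonal to the point in horizontal steps of length at most `h`; the weights
add up as in `CtrlDom.strip_estimate`. -/
lemma SemiDom.abs_le (hD : LowerDomain D R) (hκ : 0 ≤ κ) (hh : 0 < h) (hA : 0 ≤ A)
    (hω : WeightSum h ω Ω) (hY : SemiDom D κ κ' h A ω Y)
    (hdiag : ∀ u v, (u, v) ∈ D → u + v = 0 → Y (u, v) = 0) {u v : ℝ} (huv : (u, v) ∈ D) :
    |Y (u, v)| ≤ A * Ω (u + v) := by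
  obtain ⟨n, hn⟩ := exists_nat_ge ((u + v) / h)
  rw [div_le_iff₀ hh] at hn
  have one : ∀ {r : ℝ}, 0 ≤ r → r ≤ h → (r / h) ^ κ ≤ 1 := fun h0 h1 =>
    Real.rpow_le_one (div_nonneg h0 hh.le) ((div_le_one hh).2 h1) hκ
  induction n generalizing u with
  | zero =>
    have h0 := hD.nonneg _ _ huv
    have : u + v = 0 := by simp only [Nat.cast_zero, zero_mul] at hn; linarith
    rw [hdiag u v huv this, abs_zero]
    exact mul_nonneg hA ((hω.nonneg _).trans (hω.le _ h0))
  | succ n ih =>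
    have h0 := hD.nonneg _ _ huv
    have w0 := mul_nonneg hA (hω.nonneg (u + v))
    rcases le_or_gt (u + v) h with hle | hlt
    · have m : (-v, v) ∈ D := hD.lower u v (-v) v huv (by linarith) le_rfl (by simp)
      have e := hY.fst (-v) u v (by linarith) (by linarith) m huv
      rw [hdiag _ _ m (by ring), sub_zero] at e
      refine e.trans ((mul_le_of_le_one_right w0 (one (by linarith) (by linarith))).trans ?_)
      exact mul_le_mul_of_nonneg_left (hω.le _ h0) hA
    · have m : (u - h, v) ∈ D := hD.lower u v (u - h) v huv (by linarith) le_rfl (by linarith)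
      have e := hY.fst (u - h) u v (by linarith) (by linarith) m huv
      have e2 := ih m (by push_cast at hn; linarith)
      have e3 := e.trans (mul_le_of_le_one_right w0 (one (by linarith) (by linarith)))
      have e4 := mul_le_mul_of_nonneg_left (hω.add_le (u + v) hlt.le) hA
      have e5 := abs_add_le (Y (u - h, v)) (Y (u, v) - Y (u - h, v))
      rw [add_sub_cancel] at e5
      rw [show u - h + v = u + v - h by ring] at e2
      linarith

lemma two_mul_exp_neg_one_le : 2 * Real.exp (-1) ≤ 1 := by
  have := Real.add_one_le_exp (1 : ℝ)
  have h : Real.exp (-1) * Real.exp 1 = 1 := by rw [← Real.exp_add]; simp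
  nlinarith [Real.exp_pos (-1)]

/-- A geometric series of ratio `exp (-1)` sums to less than `2`, however many steps there are. This
makes the contraction valid on the whole domain. -/
lemma weightSum_exp (hh : 0 < h) :
    WeightSum h (fun τ => Real.exp (τ / h)) (fun τ => 2 * Real.exp (τ / h)) where
  mono := fun τ τ' hτ => Real.exp_le_exp.2 (div_le_div_of_nonneg_right hτ hh.le)
  nonneg τ := (Real.exp_pos _).le
  le τ _ := by linarith [Real.exp_pos (τ / h)]
  add_le τ _ := by
    rw [sub_div, div_self hh.ne', sub_eq_add_neg, Real.exp_add]
    nlinarith [Real.exp_pos (τ / h), two_mul_exp_neg_one_le]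

/-- The primitives of `σ ∘ y₁` and `σ ∘ y₂` are twice as close as `y₁` and `y₂`. -/
theorem CtrlDom.contraction {σ : ℝ → ℝ} {Y₁ Y₂ : ℝ × ℝ → ℝ} (he : YoungExp κ κ' γ γ')
    (hκγ : κ ≤ γ) (hκγ' : κ' ≤ γ') (hD : LowerDomain D R) (hh : 0 < h) (hA : 0 ≤ A) (hX : 0 ≤ X)
    (hx : RectDom D γ γ' X x) (hσ : Differentiable ℝ σ) (hσ' : RegFun B (deriv σ))
    (hsmall : 64 * primConst κ κ' γ γ' * X * B * h ^ (γ + γ') ≤ 1)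
    (hy₁ : SemiDom D κ κ' h 1 (fun _ => 1) y₁) (hy₂ : SemiDom D κ κ' h 1 (fun _ => 1) y₂)
    (hz : CtrlDom D κ κ' h A (fun τ => Real.exp (τ / h)) (y₁ - y₂))
    (hY₁ : IsPrimitive D γ γ' (σ ∘ y₁) x Y₁) (hY₂ : IsPrimitive D γ γ' (σ ∘ y₂) x Y₂) :
    CtrlDom D κ κ' h (A / 2) (fun τ => Real.exp (τ / h)) (Y₁ - Y₂) := by
  have hB := hσ'.nonneg
  have hω := weightSum_exp hh
  have c1 : CtrlDom D κ κ' h (4 * (A * (2 * B))) (fun τ => Real.exp (τ / h))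
      (σ ∘ y₁ - σ ∘ y₂) :=
    CtrlDom.comp_sub_comp hσ fun θ hθ => hz.mul hD hh hA (by linarith) hω.mono hω.nonneg
      (hσ'.ctrlDom_comp hD hh (hy₁.convex hy₂ hθ))
  have hp := hY₁.sub hY₂
  have hP := primConst_pos he
  have hhγ := Real.rpow_nonneg hh.le (γ + γ')
  have s1 := c1.semiDom_primitive he hκγ hκγ' hD hh (by positivity) hX hω hx hp
  set A' := primConst κ κ' γ γ' * X * (4 * (A * (2 * B))) * h ^ (γ + γ') with hA'
  have hA'0 : 0 ≤ A' := by positivity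
  -- The factor `64` in `hsmall` is made of `4` for the product, `2` for the composition, `2` twice
  -- for the exponential weight (increments of the primitive, then its supremum) and `2` for the
  -- halving.
  have hle : A' * 4 ≤ A / 2 := by
    have := mul_le_mul_of_nonneg_right hsmall (by linarith : 0 ≤ A / 2)
    have e : A' * 4 = 64 * primConst κ κ' γ γ' * X * B * h ^ (γ + γ') * (A / 2) := by
      rw [hA']; ring
    linarith
  have s2 : SemiDom D κ κ' h (A' * 2) (fun τ => Real.exp (τ / h)) (Y₁ - Y₂) :=
    ⟨fun a b t i1 i2 i3 i4 => (s1.fst a b t i1 i2 i3 i4).trans_eq (by ring),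
      fun s c d i1 i2 i3 i4 => (s1.snd s c d i1 i2 i3 i4).trans_eq (by ring),
      fun a b c d i1 i2 i3 i4 i5 i6 => (s1.rect a b c d i1 i2 i3 i4 i5 i6).trans_eq (by ring)⟩
  refine ⟨⟨fun a b t i1 i2 i3 i4 => (s2.fst a b t i1 i2 i3 i4).trans ?_,
    fun s c d i1 i2 i3 i4 => (s2.snd s c d i1 i2 i3 i4).trans ?_,
    fun a b c d i1 i2 i3 i4 i5 i6 => (s2.rect a b c d i1 i2 i3 i4 i5 i6).trans ?_⟩,
    fun u v i => (s2.abs_le hD he.κ_nonneg hh (by linarith) hω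
      (fun u v i j => hp.diag (by linarith [he.sum]) i j) i).trans ?_⟩
  · have n := Real.rpow_nonneg (div_nonneg (sub_nonneg.2 i1) hh.le) κ
    have := (Real.exp_pos ((b + t) / h)).le
    gcongr
    linarith
  · have n := Real.rpow_nonneg (div_nonneg (sub_nonneg.2 i1) hh.le) κ'
    have := (Real.exp_pos ((s + d) / h)).le
    gcongr
    linarith
  · have n := Real.rpow_nonneg (div_nonneg (sub_nonneg.2 i1) hh.le) κ
    have n' := Real.rpow_nonneg (div_nonneg (sub_nonneg.2 i2) hh.le) κ'
    have := (Real.exp_pos ((b + d) / h)).le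
    gcongr
    linarith
  · have := Real.exp_pos ((u + v) / h)
    rw [show A' * 2 * (2 * Real.exp ((u + v) / h)) = A' * 4 * Real.exp ((u + v) / h) by ring]
    gcongr

/-! ### Change of scale -/

lemma HolderDom.semiDom (hy : HolderDom D κ κ' A y) (hh : 0 < h)
    (h1 : A * h ^ κ ≤ 1) (h2 : A * h ^ κ' ≤ 1) (h3 : A * h ^ κ * h ^ κ' ≤ 1) :
    SemiDom D κ κ' h 1 (fun _ => 1) y := by
  refine ⟨fun a b t i1 i2 i3 i4 => ?_, fun s c d i1 i2 i3 i4 => ?_,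
    fun a b c d i1 i2 i3 i4 i5 i6 => ?_⟩
  · have n := sub_nonneg.2 i1
    refine (hy.fst a b t i1 i3 i4).trans ?_
    rw [div_rpow_mul_rpow n hh, mul_one, ← mul_assoc]
    exact mul_le_mul_of_nonneg_right h1 (Real.rpow_nonneg (div_nonneg n hh.le) _)
  · have n := sub_nonneg.2 i1
    refine (hy.snd s c d i1 i3 i4).trans ?_
    rw [div_rpow_mul_rpow n hh, mul_one, ← mul_assoc]
    exact mul_le_mul_of_nonneg_right h2 (Real.rpow_nonneg (div_nonneg n hh.le) _)
  · have n := sub_nonneg.2 i1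
    have n' := sub_nonneg.2 i2
    refine (hy.rect a b c d i1 i2 i5 i6).trans ?_
    rw [div_rpow_mul_rpow n hh, div_rpow_mul_rpow n' hh, mul_one,
      show A * (h ^ κ * ((b - a) / h) ^ κ) * (h ^ κ' * ((d - c) / h) ^ κ') =
        A * h ^ κ * h ^ κ' * ((b - a) / h) ^ κ * ((d - c) / h) ^ κ' by ring]
    have := Real.rpow_nonneg (div_nonneg n hh.le) κ
    have := Real.rpow_nonneg (div_nonneg n' hh.le) κ'
    gcongr

lemma sum_unifPart_le {φ : ℝ → ℝ → ℝ} {a b K : ℝ} (hab : a ≤ b) {N : ℕ} (hN : N ≠ 0)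
    (hadd : ∀ u v w, a ≤ u → u ≤ v → v ≤ w → w ≤ b → φ u w = φ u v + φ v w)
    (hφ : ∀ u w, a ≤ u → u ≤ w → w ≤ b → w - u = (b - a) / N → |φ u w| ≤ K) :
    |φ a b| ≤ N * K := by
  have e := sum_additive hadd (unifPart_monotone hab N) (unifPart_mem hab hN) N
  rw [unifPart_zero, unifPart_last a b hN] at e
  rw [← e]
  refine (Finset.abs_sum_le_sum_abs _ _).trans ?_
  calc _ ≤ ∑ k ∈ Finset.range N, K := Finset.sum_le_sum fun k hk =>
        hφ _ _ (unifPart_mem hab hN k).1 (unifPart_monotone hab N (Nat.le_succ k))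
          (unifPart_mem hab hN _).2 (unifPart_succ_sub a b (Finset.mem_range.1 hk))
    _ = _ := by rw [Finset.sum_const, Finset.card_range, nsmul_eq_mul]

/-- Cutting each side into `N` equal pieces of length at most `h` removes the restriction on scales.
The constant is uniform over all `y`, which the Picard iteration needs. -/
lemma SemiDom.holderDom (hD : LowerDomain D R) (hκ : 0 ≤ κ) (hκ' : 0 ≤ κ') (hh : 0 < h)
    (hh1 : h ≤ 1) (hA : 0 ≤ A) :
    ∃ A', 0 ≤ A' ∧ ∀ y, SemiDom D κ κ' h A (fun _ => 1) y → HolderDom D κ κ' A' y := by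
  obtain ⟨N, hN⟩ := exists_nat_ge (max (2 * R / h) 1)
  have hN1 : (1 : ℝ) ≤ N := (le_max_right _ _).trans hN
  have hN0 : N ≠ 0 := by rintro rfl; norm_num at hN1
  have hNR : 2 * R ≤ N * h := (div_le_iff₀ hh).1 ((le_max_left _ _).trans hN)
  have hNp : (0 : ℝ) < N := by linarith
  have small : ∀ {r : ℝ}, r ≤ 2 * R → r / N ≤ h := fun hr => by
    rw [div_le_iff₀ hNp]; linarith
  have k1 : 0 < h ^ κ := Real.rpow_pos_of_pos hh κ
  have k2 : 0 < h ^ κ' := Real.rpow_pos_of_pos hh κ'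
  have k1' : h ^ κ ≤ 1 := Real.rpow_le_one hh.le hh1 hκ
  have k2' : h ^ κ' ≤ 1 := Real.rpow_le_one hh.le hh1 hκ'
  have cmp : ∀ {r ρ : ℝ}, 0 ≤ r → 0 ≤ ρ → (r / N / h) ^ ρ ≤ r ^ ρ / h ^ ρ := by
    intro r ρ hr hρ
    rw [← Real.div_rpow hr hh.le]
    have : r / N ≤ r := div_le_self hr hN1
    gcongr
  set A' := N * (N * (A / (h ^ κ * h ^ κ'))) with hA'
  have hq : 0 ≤ A / (h ^ κ * h ^ κ') := by positivity
  have hA'0 : 0 ≤ A' := by positivity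
  have hq' : N * (A / (h ^ κ * h ^ κ')) ≤ A' := le_mul_of_one_le_left (by positivity) hN1
  have q1 : A / h ^ κ ≤ A / (h ^ κ * h ^ κ') :=
    div_le_div_of_nonneg_left hA (by positivity) (mul_le_of_le_one_right k1.le k2')
  have q2 : A / h ^ κ' ≤ A / (h ^ κ * h ^ κ') :=
    div_le_div_of_nonneg_left hA (by positivity) (mul_le_of_le_one_left k2.le k1')
  refine ⟨A', hA'0, fun y hy => ⟨fun a b t i1 i3 i4 => ?_, fun s c d i1 i3 i4 => ?_,
    fun a b c d i1 i2 i5 i6 => ?_⟩⟩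
  · have n := sub_nonneg.2 i1
    have l : b - a ≤ 2 * R := by
      linarith [(hD.bdd _ _ i4).1, (hD.bdd _ _ i3).2, hD.nonneg _ _ i3]
    have e := sum_unifPart_le (φ := fun u w => y (w, t) - y (u, t))
      (K := A / h ^ κ * (b - a) ^ κ) i1 hN0 (fun u v w _ _ _ _ => by ring)
      fun u w j1 j2 j3 j4 => by
        have mu : (u, t) ∈ D := hD.lower b t u t i4 (j2.trans j3) le_rfl
          (by linarith [hD.nonneg _ _ i3])
        have mw : (w, t) ∈ D := hD.lower b t w t i4 j3 le_rfl (by linarith [hD.nonneg _ _ i3])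
        have := hy.fst u w t j2 (by rw [j4]; exact small l) mu mw
        rw [j4, mul_one] at this
        refine this.trans ?_
        rw [div_mul_eq_mul_div, ← mul_div_assoc']
        exact mul_le_mul_of_nonneg_left (cmp n hκ) hA
    refine e.trans ?_
    have := Real.rpow_nonneg n κ
    rw [← mul_assoc]
    refine mul_le_mul_of_nonneg_right (le_trans ?_ hq') this
    gcongr
  · have n := sub_nonneg.2 i1
    have l : d - c ≤ 2 * R := by
      linarith [(hD.bdd _ _ i4).2, (hD.bdd _ _ i3).1, hD.nonneg _ _ i3]
    have e := sum_unifPart_le (φ := fun u w => y (s, w) - y (s, u))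
      (K := A / h ^ κ' * (d - c) ^ κ') i1 hN0 (fun u v w _ _ _ _ => by ring)
      fun u w j1 j2 j3 j4 => by
        have mu : (s, u) ∈ D := hD.lower s d s u i4 le_rfl (j2.trans j3)
          (by linarith [hD.nonneg _ _ i3])
        have mw : (s, w) ∈ D := hD.lower s d s w i4 le_rfl j3 (by linarith [hD.nonneg _ _ i3])
        have := hy.snd s u w j2 (by rw [j4]; exact small l) mu mw
        rw [j4, mul_one] at this
        refine this.trans ?_
        rw [div_mul_eq_mul_div, ← mul_div_assoc']
        exact mul_le_mul_of_nonneg_left (cmp n hκ') hA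
    refine e.trans ?_
    have := Real.rpow_nonneg n κ'
    rw [← mul_assoc]
    refine mul_le_mul_of_nonneg_right (le_trans ?_ hq') this
    gcongr
  · have n := sub_nonneg.2 i1
    have n' := sub_nonneg.2 i2
    have m1 := hD.mem_of_rect i5 i6 le_rfl i1 i2 le_rfl
    have m2 := hD.mem_of_rect i5 i6 i1 le_rfl le_rfl i2
    have l : b - a ≤ 2 * R := by
      linarith [(hD.bdd _ _ i6).1, (hD.bdd _ _ m1).2, hD.nonneg _ _ m1]
    have l' : d - c ≤ 2 * R := by
      linarith [(hD.bdd _ _ i6).2, (hD.bdd _ _ m2).1, hD.nonneg _ _ m2]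
    have e := sum_unifPart_le (φ := fun u w => rectIncr y u w c d)
      (K := N * (A / (h ^ κ * h ^ κ') * (b - a) ^ κ * (d - c) ^ κ')) i1 hN0
      (fun u v w _ _ _ _ => by simp only [rectIncr]; ring)
      fun u w j1 j2 j3 j4 => by
        refine sum_unifPart_le (φ := fun v v' => rectIncr y u w v v') i2 hN0
          (fun _ _ _ _ _ _ _ => by simp only [rectIncr]; ring) fun v v' j5 j6 j7 j8 => ?_
        have := hy.rect u w v v' j2 j6 (by rw [j4]; exact small l) (by rw [j8]; exact small l')
          (by linarith) (hD.mem_of_rect i5 i6 (j1.trans j2) j3 (j5.trans j6) j7)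
        rw [j4, j8, mul_one] at this
        refine this.trans ?_
        have p1 := cmp n hκ
        have p2 := cmp n' hκ'
        have z1 := Real.rpow_nonneg n κ
        have z2 : 0 ≤ ((d - c) / N / h) ^ κ' := by positivity
        calc A * ((b - a) / N / h) ^ κ * ((d - c) / N / h) ^ κ' ≤
            A * ((b - a) ^ κ / h ^ κ) * ((d - c) ^ κ' / h ^ κ') := by gcongr
          _ = _ := by field_simp
    refine e.trans (le_of_eq ?_)
    rw [hA']; ring

end Ctrl

/-! ### Existence and uniqueness of fixed points -/

/-- A function of class `C³` coincides on a bounded interval with one whose derivatives are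
bounded. -/
lemma exists_cutoff {σ : ℝ → ℝ} (hσ : ContDiff ℝ 3 σ) (B₀ : ℝ) :
    ∃ (τ : ℝ → ℝ) (B : ℝ), Differentiable ℝ τ ∧ RegFun B (deriv τ) ∧ ∀ r, |r| ≤ B₀ → τ r = σ r := by
  set b : ContDiffBump (0 : ℝ) :=
    ⟨|B₀| + 1, |B₀| + 2, by positivity, by linarith⟩ with hb
  set τ : ℝ → ℝ := fun r => b r * σ r with hτ
  have hc : HasCompactSupport τ := b.hasCompactSupport.mul_right
  have hd3 : ContDiff ℝ 3 τ := b.contDiff.mul hσ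
  have hd2 : ContDiff ℝ 2 (deriv τ) := (contDiff_succ_iff_deriv (n := 2).1 hd3).2.2
  have hd1 : ContDiff ℝ 1 (deriv (deriv τ)) := (contDiff_succ_iff_deriv (n := 1).1 hd2).2.2
  have hd0 : ContDiff ℝ 0 (deriv (deriv (deriv τ))) :=
    (contDiff_succ_iff_deriv (n := 0).1 hd1).2.2
  obtain ⟨C₁, h1⟩ := hd2.continuous.bounded_above_of_compact_support hc.deriv
  obtain ⟨C₂, h2⟩ := hd1.continuous.bounded_above_of_compact_support hc.deriv.deriv
  obtain ⟨C₃, h3⟩ := hd0.continuous.bounded_above_of_compact_support hc.deriv.deriv.deriv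
  refine ⟨τ, max C₁ (max C₂ C₃), hd3.differentiable (by norm_num), ?_, fun r hr => ?_⟩
  · exact regFun_of_deriv_le (hd2.differentiable (by norm_num)) (hd1.differentiable (by norm_num))
      (fun r => (h1 r).trans (le_max_left _ _))
      (fun r => (h2 r).trans ((le_max_left _ _).trans (le_max_right _ _)))
      (fun r => (h3 r).trans ((le_max_right _ _).trans (le_max_right _ _)))
  · have : b r = 1 := b.one_of_mem_closedBall (by
      rw [Metric.mem_closedBall, dist_zero_right, Real.norm_eq_abs]
      change |r| ≤ |B₀| + 1
      linarith [le_abs_self B₀])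
    simp [hτ, this]

lemma eventually_mul_rpow_le (M : ℝ) {ρ ε : ℝ} (hρ : 0 < ρ) (hε : 0 < ε) :
    ∀ᶠ h in nhdsWithin (0 : ℝ) (Ioi 0), M * h ^ ρ ≤ ε := by
  have t : Filter.Tendsto (fun h : ℝ => M * h ^ ρ) (nhdsWithin 0 (Ioi 0)) (nhds (M * 0 ^ ρ)) :=
    ((tendsto_nhdsWithin_of_tendsto_nhds Filter.tendsto_id).rpow_const (Or.inr hρ.le)).const_mul _
  rw [Real.zero_rpow hρ.ne', mul_zero] at t
  exact (t.eventually_lt_const hε).mono fun h hh => hh.le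

section FixedPoint

variable {D : Set (ℝ × ℝ)} {R κ κ' γ γ' A B₀ X : ℝ} {x : ℝ × ℝ → ℝ}

/-- Functions with given bounds on their size and Hölder constants. -/
def GoodDom (D : Set (ℝ × ℝ)) (κ κ' A B₀ : ℝ) (y : ℝ × ℝ → ℝ) : Prop :=
  HolderDom D κ κ' A y ∧ ∀ u v, (u, v) ∈ D → |y (u, v)| ≤ B₀

/-- The contraction needs bounds for the first three derivatives, which are not available globally
for a function of class `C³`. The values of the functions considered stay in `[-B₀, B₀]`, so `σ` may
be cut off there. The scale is then chosen so small that the Hölder constants at that scale are at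
most `1` and the smallness condition holds. -/
theorem exists_contraction_scale (he : YoungExp κ κ' γ γ') (hκ : 0 < κ) (hκ' : 0 < κ')
    (hκγ : κ ≤ γ) (hκγ' : κ' ≤ γ') (hD : LowerDomain D R) (hX : 0 ≤ X) (hx : RectDom D γ γ' X x)
    {σ : ℝ → ℝ} (hσ : ContDiff ℝ 3 σ) (A B₀ : ℝ) :
    ∃ h > 0, ∃ A₀, 0 ≤ A₀ ∧
      (∀ y₁ y₂, GoodDom D κ κ' A B₀ y₁ → GoodDom D κ κ' A B₀ y₂ →
        CtrlDom D κ κ' h A₀ (fun τ => Real.exp (τ / h)) (y₁ - y₂)) ∧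
      ∀ A₁, 0 ≤ A₁ → ∀ y₁ y₂ Y₁ Y₂, GoodDom D κ κ' A B₀ y₁ → GoodDom D κ κ' A B₀ y₂ →
        CtrlDom D κ κ' h A₁ (fun τ => Real.exp (τ / h)) (y₁ - y₂) →
        IsPrimitive D γ γ' (σ ∘ y₁) x Y₁ → IsPrimitive D γ γ' (σ ∘ y₂) x Y₂ →
        CtrlDom D κ κ' h (A₁ / 2) (fun τ => Real.exp (τ / h)) (Y₁ - Y₂) := by
  obtain ⟨τ, B, hτ, hτ', hτσ⟩ := exists_cutoff hσ B₀
  obtain ⟨h, hh, i1, i2, i3, i4⟩ : ∃ h > 0, A * h ^ κ ≤ 1 ∧ A * h ^ κ' ≤ 1 ∧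
      A * h ^ (κ + κ') ≤ 1 ∧ 64 * primConst κ κ' γ γ' * X * B * h ^ (γ + γ') ≤ 1 := by
    have e := (((eventually_mul_rpow_le A hκ one_pos).and
      (eventually_mul_rpow_le A hκ' one_pos)).and
      (eventually_mul_rpow_le A (add_pos hκ hκ') one_pos)).and
      ((eventually_mul_rpow_le (64 * primConst κ κ' γ γ' * X * B)
        (by linarith [he.sum] : 0 < γ + γ') one_pos).and self_mem_nhdsWithin)
    obtain ⟨h, ⟨⟨h1, h2⟩, h3⟩, h4, h5⟩ := e.exists
    exact ⟨h, h5, h1, h2, h3, h4⟩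
  have semi : ∀ y, GoodDom D κ κ' A B₀ y → SemiDom D κ κ' h 1 (fun _ => 1) y := fun y hy =>
    hy.1.semiDom hh i1 i2 (by rwa [mul_assoc, ← Real.rpow_add hh])
  -- The `2` covers differences of increments, the `2 * |B₀|` differences of values; the weight is
  -- at least `1` on `D`.
  refine ⟨h, hh, 2 + 2 * |B₀|, by positivity, fun y₁ y₂ h₁ h₂ => ?_,
    fun A₁ hA₁ y₁ y₂ Y₁ Y₂ h₁ h₂ hz hY₁ hY₂ => ?_⟩
  · have s₁ := semi y₁ h₁
    have s₂ := semi y₂ h₂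
    have one : ∀ u v, (u, v) ∈ D → 1 ≤ Real.exp ((u + v) / h) := fun u v huv =>
      Real.one_le_exp (div_nonneg (hD.nonneg _ _ huv) hh.le)
    have key : ∀ {p q P : ℝ} {u v : ℝ}, (u, v) ∈ D → 0 ≤ P → |p| ≤ P → |q| ≤ P →
        |p - q| ≤ (2 + 2 * |B₀|) * Real.exp ((u + v) / h) * P := by
      intro p q P u v huv hP hp hq
      have e1 := abs_sub p q
      have e2 := one u v huv
      have e3 : 2 ≤ (2 + 2 * |B₀|) * Real.exp ((u + v) / h) := by
        nlinarith [abs_nonneg B₀]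
      nlinarith
    refine ⟨⟨fun a b t j1 j2 j3 j4 => ?_, fun s c d j1 j2 j3 j4 => ?_,
      fun a b c d j1 j2 j3 j4 j5 j6 => ?_⟩, fun u v j => ?_⟩
    · have n := Real.rpow_nonneg (div_nonneg (sub_nonneg.2 j1) hh.le) κ
      have e1 := s₁.fst a b t j1 j2 j3 j4
      have e2 := s₂.fst a b t j1 j2 j3 j4
      rw [mul_one, one_mul] at e1 e2
      have := key j4 n e1 e2
      convert this using 2
      simp only [Pi.sub_apply]; ring
    · have n := Real.rpow_nonneg (div_nonneg (sub_nonneg.2 j1) hh.le) κ'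
      have e1 := s₁.snd s c d j1 j2 j3 j4
      have e2 := s₂.snd s c d j1 j2 j3 j4
      rw [mul_one, one_mul] at e1 e2
      have := key j4 n e1 e2
      convert this using 2
      simp only [Pi.sub_apply]; ring
    · have n := Real.rpow_nonneg (div_nonneg (sub_nonneg.2 j1) hh.le) κ
      have n' := Real.rpow_nonneg (div_nonneg (sub_nonneg.2 j2) hh.le) κ'
      have e1 := s₁.rect a b c d j1 j2 j3 j4 j5 j6
      have e2 := s₂.rect a b c d j1 j2 j3 j4 j5 j6
      rw [mul_one, one_mul] at e1 e2
      have := key j6 (mul_nonneg n n') e1 e2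
      rw [← mul_assoc] at this
      convert this using 2
      simp only [rectIncr, Pi.sub_apply]; ring
    · have e1 := (h₁.2 u v j).trans (le_abs_self B₀)
      have e2 := (h₂.2 u v j).trans (le_abs_self B₀)
      have e3 := abs_sub (y₁ (u, v)) (y₂ (u, v))
      have e4 := one u v j
      have e5 : 2 * |B₀| ≤ (2 + 2 * |B₀|) * Real.exp ((u + v) / h) := by
        nlinarith [abs_nonneg B₀]
      rw [Pi.sub_apply]
      linarith
  · have cg : ∀ y, GoodDom D κ κ' A B₀ y → EqOn (σ ∘ y) (τ ∘ y) D := fun y hy q hq =>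
      (hτσ _ (hy.2 q.1 q.2 hq)).symm
    exact hz.contraction he hκγ hκγ' hD hh hA₁ hX hx hτ hτ' i4 (semi y₁ h₁) (semi y₂ h₂)
      (hY₁.congr hD (cg y₁ h₁)) (hY₂.congr hD (cg y₂ h₂))

lemma eq_zero_of_forall_le_div_pow {r M : ℝ} (h : ∀ n : ℕ, |r| ≤ M / 2 ^ n) : r = 0 := by
  have t : Filter.Tendsto (fun n : ℕ => M / (2 : ℝ) ^ n) Filter.atTop (nhds 0) := by
    have := (tendsto_pow_atTop_nhds_zero_of_lt_one (r := (1 / 2 : ℝ)) (by norm_num)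
      (by norm_num)).const_mul M
    rw [mul_zero] at this
    refine this.congr fun n => ?_
    rw [one_div, inv_pow]; rfl
  exact abs_eq_zero.1 (le_antisymm (ge_of_tendsto' t h) (abs_nonneg _))

/-- Each function is its own primitive, so the weighted bound for the difference can be halved
indefinitely. -/
theorem eqOn_of_isPrimitive (he : YoungExp κ κ' γ γ') (hκ : 0 < κ) (hκ' : 0 < κ')
    (hκγ : κ ≤ γ) (hκγ' : κ' ≤ γ') (hD : LowerDomain D R) (hX : 0 ≤ X) (hx : RectDom D γ γ' X x)
    {σ : ℝ → ℝ} (hσ : ContDiff ℝ 3 σ) {y₁ y₂ : ℝ × ℝ → ℝ} (h₁ : GoodDom D κ κ' A B₀ y₁)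
    (h₂ : GoodDom D κ κ' A B₀ y₂) (p₁ : IsPrimitive D γ γ' (σ ∘ y₁) x y₁)
    (p₂ : IsPrimitive D γ γ' (σ ∘ y₂) x y₂) : EqOn y₁ y₂ D := by
  obtain ⟨h, hh, A₀, hA₀, hstart, hstep⟩ :=
    exists_contraction_scale he hκ hκ' hκγ hκγ' hD hX hx hσ A B₀
  have iter : ∀ n : ℕ, CtrlDom D κ κ' h (A₀ / 2 ^ n) (fun τ => Real.exp (τ / h)) (y₁ - y₂) := by
    intro n
    induction n with
    | zero => simpa using hstart y₁ y₂ h₁ h₂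
    | succ n ih =>
      have := hstep _ (by positivity) y₁ y₂ y₁ y₂ h₁ h₂ ih p₁ p₂
      rwa [div_div, ← pow_succ] at this
  rintro ⟨u, v⟩ huv
  refine sub_eq_zero.1 (eq_zero_of_forall_le_div_pow
    (M := A₀ * Real.exp ((u + v) / h)) fun n => ?_)
  have := (iter n).sup u v huv
  rwa [div_mul_eq_mul_div] at this

lemma SemiDom.of_tendsto {h A : ℝ} {ω : ℝ → ℝ} {g : ℕ → ℝ × ℝ → ℝ} {y : ℝ × ℝ → ℝ}
    (hD : LowerDomain D R)
    (hg : ∀ n, SemiDom D κ κ' h A ω (g n))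
    (hy : ∀ q ∈ D, Filter.Tendsto (fun n => g n q) Filter.atTop (nhds (y q))) :
    SemiDom D κ κ' h A ω y := by
  refine ⟨fun a b t j1 j2 j3 j4 => ?_, fun s c d j1 j2 j3 j4 => ?_,
    fun a b c d j1 j2 j3 j4 j5 j6 => ?_⟩
  · exact le_of_tendsto' ((hy _ j4).sub (hy _ j3)).abs fun n => (hg n).fst a b t j1 j2 j3 j4
  · exact le_of_tendsto' ((hy _ j4).sub (hy _ j3)).abs fun n => (hg n).snd s c d j1 j2 j3 j4
  · have m1 := hD.mem_of_rect j5 j6 le_rfl j1 le_rfl j2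
    have m2 := hD.mem_of_rect j5 j6 j1 le_rfl le_rfl j2
    have m3 := hD.mem_of_rect j5 j6 le_rfl j1 j2 le_rfl
    exact le_of_tendsto' ((((hy _ m1).sub (hy _ m3)).sub (hy _ m2)).add (hy _ j6)).abs
      fun n => (hg n).rect a b c d j1 j2 j3 j4 j5 j6

lemma CtrlDom.of_tendsto {h A : ℝ} {ω : ℝ → ℝ} {g : ℕ → ℝ × ℝ → ℝ} {y : ℝ × ℝ → ℝ}
    (hD : LowerDomain D R)
    (hg : ∀ n, CtrlDom D κ κ' h A ω (g n))
    (hy : ∀ q ∈ D, Filter.Tendsto (fun n => g n q) Filter.atTop (nhds (y q))) :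
    CtrlDom D κ κ' h A ω y :=
  ⟨SemiDom.of_tendsto hD (fun n => (hg n).toSemiDom) hy,
    fun u v j => le_of_tendsto' (hy _ j).abs fun n => (hg n).sup u v j⟩

/-- Existence of a fixed point for coefficients with bounded first and second differences. -/
theorem exists_isPrimitive_comp_self (he : YoungExp κ κ' γ γ') (hκ : 0 < κ) (hκ' : 0 < κ')
    (hκγ : κ ≤ γ) (hκγ' : κ' ≤ γ') (hD : LowerDomain D R) (hX : 0 ≤ X) (hx : RectDom D γ γ' X x)
    {σ : ℝ → ℝ} (hσ : ContDiff ℝ 3 σ) {B : ℝ} (hB : RegFun B σ) :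
    ∃ y A B₀, 0 ≤ A ∧ GoodDom D κ κ' A B₀ y ∧ IsPrimitive D γ γ' (σ ∘ y) x y := by
  have hB0 := hB.nonneg
  have hP := primConst_pos he
  set M := primConst κ κ' γ γ' * X * (2 * B) with hM
  have hM0 : 0 ≤ M := by positivity
  -- With a constant weight, `Ω` grows to `1 + 2 * R / h`; the loss `1 / h` is affordable because `γ
  -- + γ' > 1`. As `σ` has bounded differences, `σ ∘ y` is controlled by `2 * B` for every `y` in
  -- the set, so no compatibility with the size of `y` is required.
  obtain ⟨h, hh, hh1, i1, i2⟩ : ∃ h > 0, h ≤ 1 ∧ M * h ^ (γ + γ') ≤ 1 / 2 ∧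
      M * (2 * R) * h ^ (γ + γ' - 1) ≤ 1 / 2 := by
    have e := ((eventually_mul_rpow_le M (by linarith [he.sum] : 0 < γ + γ') one_half_pos).and
      (eventually_mul_rpow_le (M * (2 * R)) (by linarith [he.sum] : 0 < γ + γ' - 1)
        one_half_pos)).and (Ioc_mem_nhdsGT (zero_lt_one' ℝ))
    obtain ⟨h, ⟨h1, h2⟩, h3⟩ := e.exists
    exact ⟨h, h3.1, h3.2, h1, h2⟩
  have hω := weightSum_one hh
  have hsum : ∀ u v, (u, v) ∈ D → u + v ≤ 2 * R := fun u v j => by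
    linarith [(hD.bdd _ _ j).1, (hD.bdd _ _ j).2]
  -- the integrands
  obtain ⟨A₁, hA₁, hhol⟩ := SemiDom.holderDom (D := D) (R := R) (κ := κ) (κ' := κ') (h := h)
    (A := 2 * B) hD he.κ_nonneg he.κ'_nonneg hh hh1 (by linarith)
  have ctrl : ∀ y, SemiDom D κ κ' h 1 (fun _ => 1) y →
      CtrlDom D κ κ' h (2 * B) (fun _ => 1) (σ ∘ y) := fun y hy => hB.ctrlDom_comp hD hh hy
  have prim : ∀ y, SemiDom D κ κ' h 1 (fun _ => 1) y → ∃ Y, IsPrimitive D γ γ' (σ ∘ y) x Y :=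
    fun y hy => exists_primitive he hD hA₁ hX (hhol _ (ctrl y hy).toSemiDom) hx
      fun u v _ => hB.bdd _
  -- the set of functions is preserved
  have self : ∀ y Y, SemiDom D κ κ' h 1 (fun _ => 1) y → IsPrimitive D γ γ' (σ ∘ y) x Y →
      SemiDom D κ κ' h 1 (fun _ => 1) Y := by
    intro y Y hy hY
    have s := (ctrl y hy).semiDom_primitive he hκγ hκγ' hD hh (by linarith) hX hω hx hY
    have wle : ∀ u v, (u, v) ∈ D → M * h ^ (γ + γ') * (1 + (u + v) / h) ≤ 1 := by
      intro u v j
      have hg : h ^ (γ + γ') / h = h ^ (γ + γ' - 1) := (Real.rpow_sub_one hh.ne' _).symm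
      have hg0 : 0 ≤ h ^ (γ + γ' - 1) := Real.rpow_nonneg hh.le _
      have e1 : M * h ^ (γ + γ') * (1 + (u + v) / h) =
          M * h ^ (γ + γ') + M * (u + v) * h ^ (γ + γ' - 1) := by rw [← hg]; ring
      have e2 : M * (u + v) * h ^ (γ + γ' - 1) ≤ M * (2 * R) * h ^ (γ + γ' - 1) := by
        have := hsum u v j
        gcongr
      rw [e1]; linarith
    refine ⟨fun a b t j1 j2 j3 j4 => (s.fst a b t j1 j2 j3 j4).trans ?_,
      fun s' c d j1 j2 j3 j4 => (s.snd s' c d j1 j2 j3 j4).trans ?_,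
      fun a b c d j1 j2 j3 j4 j5 j6 => (s.rect a b c d j1 j2 j3 j4 j5 j6).trans ?_⟩
    · have n := Real.rpow_nonneg (div_nonneg (sub_nonneg.2 j1) hh.le) κ
      rw [mul_one]
      exact mul_le_mul_of_nonneg_right (wle b t j4) n
    · have n := Real.rpow_nonneg (div_nonneg (sub_nonneg.2 j1) hh.le) κ'
      rw [mul_one]
      exact mul_le_mul_of_nonneg_right (wle s' d j4) n
    · have n := Real.rpow_nonneg (div_nonneg (sub_nonneg.2 j1) hh.le) κ
      have n' := Real.rpow_nonneg (div_nonneg (sub_nonneg.2 j2) hh.le) κ'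
      rw [mul_one]
      exact mul_le_mul_of_nonneg_right (mul_le_mul_of_nonneg_right (wle b d j6) n) n'
  obtain ⟨A₂, hA₂, hhol₂⟩ := SemiDom.holderDom (D := D) (R := R) (κ := κ) (κ' := κ') (h := h)
    (A := 1) hD he.κ_nonneg he.κ'_nonneg hh hh1 zero_le_one
  set B₀ := 1 + 2 * R / h with hB₀
  have good : ∀ y, SemiDom D κ κ' h 1 (fun _ => 1) y →
      (∀ u v, (u, v) ∈ D → u + v = 0 → y (u, v) = 0) → GoodDom D κ κ' A₂ B₀ y := by
    refine fun y hy hd => ⟨hhol₂ y hy, fun u v j => ?_⟩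
    have := hy.abs_le hD he.κ_nonneg hh zero_le_one hω hd j
    have h2 : (u + v) / h ≤ 2 * R / h := div_le_div_of_nonneg_right (hsum u v j) hh.le
    rw [one_mul] at this
    linarith
  -- the Picard iteration
  set Φ : (ℝ × ℝ → ℝ) → ℝ × ℝ → ℝ := fun y => Classical.epsilon (IsPrimitive D γ γ' (σ ∘ y) x)
    with hΦ
  have hΦ' : ∀ y, SemiDom D κ κ' h 1 (fun _ => 1) y → IsPrimitive D γ γ' (σ ∘ y) x (Φ y) :=
    fun y hy => Classical.epsilon_spec (prim y hy)
  set ys : ℕ → ℝ × ℝ → ℝ := fun n => Φ^[n] 0 with hys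
  have ys_succ : ∀ n, ys (n + 1) = Φ (ys n) := fun n => Function.iterate_succ_apply' Φ n 0
  have semi : ∀ n, SemiDom D κ κ' h 1 (fun _ => 1) (ys n) := by
    intro n
    induction n with
    | zero =>
      refine ⟨fun a b t j1 _ _ _ => ?_, fun s c d j1 _ _ _ => ?_, fun a b c d j1 j2 _ _ _ _ => ?_⟩
      · have n := Real.rpow_nonneg (div_nonneg (sub_nonneg.2 j1) hh.le) κ
        simpa [hys] using n
      · have n := Real.rpow_nonneg (div_nonneg (sub_nonneg.2 j1) hh.le) κ'
        simpa [hys] using n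
      · have n := Real.rpow_nonneg (div_nonneg (sub_nonneg.2 j1) hh.le) κ
        have n' := Real.rpow_nonneg (div_nonneg (sub_nonneg.2 j2) hh.le) κ'
        simpa [hys, rectIncr] using mul_nonneg n n'
    | succ n ih => rw [ys_succ]; exact self _ _ ih (hΦ' _ ih)
  have diag : ∀ n u v, (u, v) ∈ D → u + v = 0 → ys n (u, v) = 0 := by
    rintro (_ | n) u v j1 j2
    · rfl
    · rw [ys_succ]; exact (hΦ' _ (semi n)).diag (by linarith [he.sum]) j1 j2
  have hgood : ∀ n, GoodDom D κ κ' A₂ B₀ (ys n) := fun n => good _ (semi n) (diag n)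
  -- Two scales are at work: `h` keeps the iterates in a fixed set, `k` makes the map contract. The
  -- constants `A₂` and `B₀` depend on `h`, so `k` is chosen afterwards.
  obtain ⟨k, hk, A₀, hA₀, hstart, hstep⟩ :=
    exists_contraction_scale he hκ hκ' hκγ hκγ' hD hX hx hσ A₂ B₀
  have diff : ∀ n m : ℕ, CtrlDom D κ κ' k (A₀ / 2 ^ n) (fun τ => Real.exp (τ / k))
      (ys (m + n) - ys n) := by
    intro n m
    induction n with
    | zero => simpa using hstart _ _ (hgood m) (hgood 0)
    | succ n ih =>
      have := hstep _ (by positivity) _ _ _ _ (hgood (m + n)) (hgood n) ih (hΦ' _ (semi _))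
        (hΦ' _ (semi _))
      rwa [div_div, ← pow_succ, ← ys_succ, ← ys_succ] at this
  have hlim : ∀ q, ∃ l, q ∈ D → Filter.Tendsto (fun n => ys n q) Filter.atTop (nhds l) := by
    rintro ⟨u, v⟩
    by_cases hq : (u, v) ∈ D
    · have hc : CauchySeq fun n => ys n (u, v) := by
        refine cauchySeq_of_le_geometric (1 / 2) (A₀ * Real.exp ((u + v) / k)) (by norm_num)
          fun n => ?_
        have := (diff n 1).sup u v hq
        rw [Pi.sub_apply, add_comm 1 n] at this
        rw [dist_comm, Real.dist_eq]
        refine this.trans_eq ?_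
        rw [one_div, inv_pow]
        ring
      obtain ⟨l, hl⟩ := cauchySeq_tendsto_of_complete hc
      exact ⟨l, fun _ => hl⟩
    · exact ⟨0, fun h => absurd h hq⟩
  choose y hy using hlim
  have hys' : ∀ n, CtrlDom D κ κ' k (A₀ / 2 ^ n) (fun τ => Real.exp (τ / k)) (y - ys n) :=
    fun n => CtrlDom.of_tendsto hD (fun m => diff n m) fun q hq =>
      (((Filter.tendsto_add_atTop_iff_nat n).2 (hy q hq)).sub_const _)
  have ysemi : SemiDom D κ κ' h 1 (fun _ => 1) y := SemiDom.of_tendsto hD semi hy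
  have ygood : GoodDom D κ κ' A₂ B₀ y := by
    refine good y ysemi fun u v j1 j2 => ?_
    refine tendsto_nhds_unique (hy _ j1) (tendsto_const_nhds.congr fun n => ?_)
    exact (diag n u v j1 j2).symm
  obtain ⟨Y, hY⟩ := prim y ysemi
  have heq : EqOn Y y D := by
    rintro ⟨u, v⟩ huv
    refine sub_eq_zero.1 (eq_zero_of_forall_le_div_pow
      (M := A₀ * Real.exp ((u + v) / k)) fun n => ?_)
    have e1 := (hstep _ (by positivity) _ _ _ _ ygood (hgood n) (hys' n) hY
      (hΦ' _ (semi _))).sup u v huv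
    have e2 := (hys' (n + 1)).sup u v huv
    rw [ys_succ] at e2
    rw [Pi.sub_apply] at e1 e2
    have e3 := abs_sub (Y (u, v) - Φ (ys n) (u, v)) (y (u, v) - Φ (ys n) (u, v))
    rw [sub_sub_sub_cancel_right] at e3
    refine e3.trans ((add_le_add e1 e2).trans_eq ?_)
    rw [pow_succ]; ring
  exact ⟨y, A₂, B₀, hA₂, ygood, hY.congr_right hD heq⟩

end FixedPoint

/-! ### The domain of the rotated equation -/

theorem lowerDomain_domain (R₁ R₂ T : ℝ) :
    LowerDomain (domain R₁ R₂ T) (2 * (|R₁| + |R₂|)) where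
  nonneg u v h := by
    simp only [domain, mem_iUnion, closedCone, mem_ofPred_eq] at h
    obtain ⟨_, _, _, _, h⟩ := h
    exact h
  lower u v u' v' h hu hv h0 := by
    simp only [domain, mem_iUnion, closedCone, mem_ofPred_eq] at h ⊢
    obtain ⟨p, hp, h1, h2, _⟩ := h
    exact ⟨p, hp, hu.trans h1, hv.trans h2, h0⟩
  bdd u v h := by
    simp only [domain, mem_iUnion, closedCone, mem_ofPred_eq] at h
    obtain ⟨p, hp, h1, h2, _⟩ := h
    obtain ⟨⟨q, ⟨⟨q1, q2⟩, q3, q4⟩, rfl⟩, -, -⟩ := hp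
    have hs : 1 ≤ √2 := Real.one_le_sqrt.2 one_le_two
    have e1 := neg_abs_le R₁
    have e2 := le_abs_self R₂
    have e3 := abs_nonneg R₁
    have e4 := abs_nonneg R₂
    have key : ∀ w, w ≤ 2 * (|R₁| + |R₂|) → w / √2 ≤ 2 * (|R₁| + |R₂|) := fun w hw =>
      (div_le_iff₀ (by linarith)).2 (hw.trans (le_mul_of_one_le_right (by positivity) hs))
    exact ⟨h1.trans (key _ (by linarith)), h2.trans (key _ (by linarith))⟩

section Norms

variable {D : Set (ℝ × ℝ)} {R κ κ' γ γ' A A' N X : ℝ} {f x : ℝ × ℝ → ℝ}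

/-! ### Hölder bounds and semi-norms -/

lemma LowerDomain.rect_subset (hD : LowerDomain D R) {a b c d : ℝ} (h0 : 0 ≤ a + c)
    (hbd : (b, d) ∈ D) : Icc a b ×ˢ Icc c d ⊆ D := by
  rintro ⟨u, v⟩ ⟨⟨h1, h2⟩, h3, h4⟩
  exact hD.mem_of_rect h0 hbd h1 h2 h3 h4

lemma LowerDomain.sub_le (hD : LowerDomain D R) {a b t : ℝ} (ha : 0 ≤ a + t) (hb : (b, t) ∈ D) :
    b - a ≤ 2 * R := by
  have := hD.bdd _ _ hb
  linarith

lemma LowerDomain.sub_le_snd (hD : LowerDomain D R) {s c d : ℝ} (hc : 0 ≤ s + c)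
    (hd : (s, d) ∈ D) : d - c ≤ 2 * R := by
  have := hD.bdd _ _ hd
  linarith

theorem rectDom_of_rectNorm_le (hD : LowerDomain D R) (hκ : 0 < κ) (hκ' : 0 < κ') (hN : 0 ≤ N)
    (h : rectNorm D κ κ' f ≤ ENNReal.ofReal N) : RectDom D κ κ' N f := by
  intro a b c d hab hcd h0 hbd
  rcases hab.eq_or_lt with rfl | hab
  · rw [show rectIncr f a a c d = 0 by unfold rectIncr; ring, sub_self, Real.zero_rpow hκ.ne']
    simp
  rcases hcd.eq_or_lt with rfl | hcd
  · rw [show rectIncr f a b c c = 0 by unfold rectIncr; ring, sub_self, Real.zero_rpow hκ'.ne']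
    simp
  have h1 : ENNReal.ofReal (|rectIncr f a b c d| / ((b - a) ^ κ * (d - c) ^ κ')) ≤
      ENNReal.ofReal N := by
    refine le_trans ?_ h
    unfold rectNorm
    exact le_iSup_of_le a <| le_iSup_of_le b <| le_iSup_of_le c <| le_iSup_of_le d <|
      le_iSup_of_le hab <| le_iSup_of_le hcd <| le_iSup_of_le (hD.rect_subset h0 hbd) le_rfl
  rw [ENNReal.ofReal_le_ofReal_iff hN, div_le_iff₀ (mul_pos (Real.rpow_pos_of_pos (by linarith) _)
    (Real.rpow_pos_of_pos (by linarith) _)), ← mul_assoc] at h1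
  exact h1

theorem holderDom_of_hNorm_le (hD : LowerDomain D R) (hκ : 0 < κ) (hκ' : 0 < κ') (hN : 0 ≤ N)
    (h : hNorm D κ κ' f ≤ ENNReal.ofReal N) : HolderDom D κ κ' N f where
  fst a b t hab ha hb := by
    rcases hab.eq_or_lt with rfl | hab
    · simp [Real.zero_rpow hκ.ne']
    have h1 : ENNReal.ofReal (|f (b, t) - f (a, t)| / (b - a) ^ κ) ≤ ENNReal.ofReal N := by
      refine le_trans (le_trans ?_ (le_add_self.trans le_self_add)) h
      unfold holderFst
      exact le_iSup_of_le a <| le_iSup_of_le b <| le_iSup_of_le t <| le_iSup_of_le hab <|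
        le_iSup_of_le ha <| le_iSup_of_le hb le_rfl
    rwa [ENNReal.ofReal_le_ofReal_iff hN,
      div_le_iff₀ (Real.rpow_pos_of_pos (by linarith) _)] at h1
  snd s c d hcd hc hd := by
    rcases hcd.eq_or_lt with rfl | hcd
    · simp [Real.zero_rpow hκ'.ne']
    have h1 : ENNReal.ofReal (|f (s, d) - f (s, c)| / (d - c) ^ κ') ≤ ENNReal.ofReal N := by
      refine le_trans (le_trans ?_ le_add_self) h
      unfold holderSnd
      exact le_iSup_of_le s <| le_iSup_of_le c <| le_iSup_of_le d <| le_iSup_of_le hcd <|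
        le_iSup_of_le hc <| le_iSup_of_le hd le_rfl
    rwa [ENNReal.ofReal_le_ofReal_iff hN,
      div_le_iff₀ (Real.rpow_pos_of_pos (by linarith) _)] at h1
  rect := rectDom_of_rectNorm_le hD hκ hκ' hN ((le_self_add.trans le_self_add).trans h)

theorem HolderDom.hNorm_le (hD : LowerDomain D R) (hf : HolderDom D κ κ' A f) :
    hNorm D κ κ' f ≤ 3 * ENNReal.ofReal A := by
  have e1 : rectNorm D κ κ' f ≤ ENNReal.ofReal A := by
    refine iSup_le fun a => iSup_le fun b => iSup_le fun c => iSup_le fun d => iSup_le fun hab =>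
      iSup_le fun hcd => iSup_le fun hs => ENNReal.ofReal_le_ofReal ?_
    rw [div_le_iff₀ (mul_pos (Real.rpow_pos_of_pos (by linarith) _)
      (Real.rpow_pos_of_pos (by linarith) _)), ← mul_assoc]
    exact hf.rect a b c d hab.le hcd.le
      (hD.nonneg _ _ (hs ⟨left_mem_Icc.2 hab.le, left_mem_Icc.2 hcd.le⟩))
      (hs ⟨right_mem_Icc.2 hab.le, right_mem_Icc.2 hcd.le⟩)
  have e2 : holderFst D κ f ≤ ENNReal.ofReal A := by
    refine iSup_le fun a => iSup_le fun b => iSup_le fun t => iSup_le fun hab =>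
      iSup_le fun ha => iSup_le fun hb => ENNReal.ofReal_le_ofReal ?_
    rw [div_le_iff₀ (Real.rpow_pos_of_pos (by linarith) _)]
    exact hf.fst a b t hab.le ha hb
  have e3 : holderSnd D κ' f ≤ ENNReal.ofReal A := by
    refine iSup_le fun s => iSup_le fun c => iSup_le fun d => iSup_le fun hcd =>
      iSup_le fun hc => iSup_le fun hd => ENNReal.ofReal_le_ofReal ?_
    rw [div_le_iff₀ (Real.rpow_pos_of_pos (by linarith) _)]
    exact hf.snd s c d hcd.le hc hd
  calc hNorm D κ κ' f ≤ ENNReal.ofReal A + ENNReal.ofReal A + ENNReal.ofReal A :=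
        add_le_add (add_le_add e1 e2) e3
    _ = 3 * ENNReal.ofReal A := by ring

theorem HolderDom.memH (hD : LowerDomain D R) (hf : HolderDom D κ κ' A f)
    (hc : ContinuousOn f D) : MemH D κ κ' f :=
  ⟨hc, (hf.hNorm_le hD).trans_lt (ENNReal.mul_lt_top (by norm_num) ENNReal.ofReal_lt_top)⟩

theorem MemH.exists_holderDom (hD : LowerDomain D R) (hκ : 0 < κ) (hκ' : 0 < κ')
    (hf : MemH D κ κ' f) : ∃ A, 0 ≤ A ∧ HolderDom D κ κ' A f :=
  ⟨_, ENNReal.toReal_nonneg, holderDom_of_hNorm_le hD hκ hκ' ENNReal.toReal_nonneg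
    (ENNReal.ofReal_toReal hf.2.ne).ge⟩

theorem MemC.exists_rectDom (hD : LowerDomain D R) (hγ : 0 < γ) (hγ' : 0 < γ')
    (hx : MemC D γ γ' x) : ∃ X, 0 ≤ X ∧ RectDom D γ γ' X x :=
  ⟨_, ENNReal.toReal_nonneg, rectDom_of_rectNorm_le hD hγ hγ' ENNReal.toReal_nonneg
    (ENNReal.ofReal_toReal hx.2.ne).ge⟩

lemma HolderDom.mono (hA : A ≤ A') (hf : HolderDom D κ κ' A f) :
    HolderDom D κ κ' A' f where
  fst a b t hab ha hb := (hf.fst a b t hab ha hb).trans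
    (mul_le_mul_of_nonneg_right hA (Real.rpow_nonneg (by linarith) _))
  snd s c d hcd hc hd := (hf.snd s c d hcd hc hd).trans
    (mul_le_mul_of_nonneg_right hA (Real.rpow_nonneg (by linarith) _))
  rect a b c d hab hcd h0 hbd := (hf.rect a b c d hab hcd h0 hbd).trans
    (mul_le_mul_of_nonneg_right (mul_le_mul_of_nonneg_right hA (Real.rpow_nonneg (by linarith) _))
      (Real.rpow_nonneg (by linarith) _))

/-- On a bounded domain the exponents may be lowered. -/
theorem HolderDom.of_exponent_le (hD : LowerDomain D R) (hκ : 0 ≤ κ) (hκ' : 0 ≤ κ')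
    (hκγ : κ ≤ γ) (hκγ' : κ' ≤ γ') (hA : 0 ≤ A) (hf : HolderDom D γ γ' A f) :
    ∃ A', 0 ≤ A' ∧ HolderDom D κ κ' A' f := by
  set h := max (2 * R) 1 with hh
  have h1 : 1 ≤ h := le_max_right _ _
  have h2 : 2 * R ≤ h := le_max_left _ _
  have h0 : 0 < h := by linarith
  have aux : ∀ {α β r : ℝ}, 0 ≤ α → α ≤ β → 0 ≤ r → r ≤ h → r ^ β ≤ h ^ β * r ^ α := by
    intro α β r hα hαβ hr hrh
    refine (scaled_rpow_le hr hrh h0 hα hαβ).trans ?_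
    refine mul_le_mul_of_nonneg_left ?_ (Real.rpow_nonneg h0.le _)
    exact Real.rpow_le_rpow (div_nonneg hr h0.le) (div_le_self hr h1) hα
  have p1 : 1 ≤ h ^ γ := Real.one_le_rpow h1 (hκ.trans hκγ)
  have p2 : 1 ≤ h ^ γ' := Real.one_le_rpow h1 (hκ'.trans hκγ')
  refine ⟨A * h ^ γ * h ^ γ', by positivity, ⟨?_, ?_, ?_⟩⟩
  · intro a b t hab ha hb
    have hr : 0 ≤ b - a := by linarith
    have n := Real.rpow_nonneg hr κ
    calc |f (b, t) - f (a, t)| ≤ A * (b - a) ^ γ := hf.fst a b t hab ha hb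
      _ ≤ A * (h ^ γ * (b - a) ^ κ) := mul_le_mul_of_nonneg_left
          (aux hκ hκγ hr ((hD.sub_le (hD.nonneg _ _ ha) hb).trans h2)) hA
      _ = A * h ^ γ * 1 * (b - a) ^ κ := by ring
      _ ≤ A * h ^ γ * h ^ γ' * (b - a) ^ κ := by gcongr
  · intro s c d hcd hc hd
    have hr : 0 ≤ d - c := by linarith
    have n := Real.rpow_nonneg hr κ'
    calc |f (s, d) - f (s, c)| ≤ A * (d - c) ^ γ' := hf.snd s c d hcd hc hd
      _ ≤ A * (h ^ γ' * (d - c) ^ κ') := mul_le_mul_of_nonneg_left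
          (aux hκ' hκγ' hr ((hD.sub_le_snd (hD.nonneg _ _ hc) hd).trans h2)) hA
      _ = A * 1 * h ^ γ' * (d - c) ^ κ' := by ring
      _ ≤ A * h ^ γ * h ^ γ' * (d - c) ^ κ' := by gcongr
  · intro a b c d hab hcd hac hbd
    have hr : 0 ≤ b - a := by linarith
    have hr' : 0 ≤ d - c := by linarith
    have n := Real.rpow_nonneg hr κ
    have n' := Real.rpow_nonneg hr γ
    have n'' := Real.rpow_nonneg hr' γ'
    have m1 := aux hκ hκγ hr ((hD.sub_le (t := d) (by linarith) hbd).trans h2)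
    have m2 := aux hκ' hκγ' hr' ((hD.sub_le_snd (s := b) (by linarith) hbd).trans h2)
    calc |rectIncr f a b c d| ≤ A * (b - a) ^ γ * (d - c) ^ γ' := hf.rect a b c d hab hcd hac hbd
      _ ≤ A * (h ^ γ * (b - a) ^ κ) * (h ^ γ' * (d - c) ^ κ') := by gcongr
      _ = A * h ^ γ * h ^ γ' * (b - a) ^ κ * (d - c) ^ κ' := by ring

end Norms

/-! ### Bounds for the derivatives of the coefficient -/

lemma abs_hasDerivAt_le {g : ℝ → ℝ} {g' c N δ : ℝ} (hg : HasDerivAt g g' c) (hδ : 0 < δ)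
    (h : ∀ α, 0 < α → α ≤ δ → |g (c + α) - g c| ≤ N * α) : |g'| ≤ N := by
  refine le_of_tendsto hg.tendsto_slope_zero_right.abs ?_
  filter_upwards [Ioc_mem_nhdsGT hδ] with α hα
  rw [smul_eq_mul, abs_mul, abs_inv, abs_of_pos hα.1, inv_mul_le_iff₀ hα.1, mul_comm]
  exact h α hα.1 hα.2

lemma abs_sqrt_abs_sub_le {a b e : ℝ} (hab : a ≤ b) :
    |√(|b - e|) - √(|a - e|)| ≤ (b - a) ^ (1 / 2 : ℝ) := by
  rw [← Real.sqrt_eq_rpow]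
  have key : ∀ p q : ℝ, p ≤ q + (b - a) → 0 ≤ q → √p ≤ √q + √(b - a) := fun p q h hq => by
    have s1 := Real.sq_sqrt hq
    have s2 := Real.sq_sqrt (by linarith : 0 ≤ b - a)
    have s3 := mul_nonneg (Real.sqrt_nonneg q) (Real.sqrt_nonneg (b - a))
    exact Real.sqrt_le_iff.2 ⟨by positivity, by nlinarith⟩
  have e1 : |b - e| ≤ |a - e| + (b - a) := by
    have := abs_add_le (a - e) (b - a)
    rw [abs_of_nonneg (by linarith : 0 ≤ b - a)] at this
    rwa [show b - e = a - e + (b - a) by ring]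
  have e2 : |a - e| ≤ |b - e| + (b - a) := by
    have := abs_sub (b - e) (b - a)
    rw [abs_of_nonneg (by linarith : 0 ≤ b - a)] at this
    rwa [show a - e = b - e - (b - a) by ring]
  rw [abs_le]
  have := key _ _ e1 (abs_nonneg _)
  have := key _ _ e2 (abs_nonneg _)
  constructor <;> linarith

/-- A function of half-Hölder type whose increments from its base point are square roots. -/
def sqrtTest (c a₀ c₀ : ℝ) (p : ℝ × ℝ) : ℝ := c + √|p.1 - a₀| + √|p.2 - c₀|

lemma memH_sqrtTest {D : Set (ℝ × ℝ)} {R : ℝ} (hD : LowerDomain D R) (c a₀ c₀ : ℝ) :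
    MemH D (1 / 2) (1 / 2) (sqrtTest c a₀ c₀) ∧
      hNorm D (1 / 2) (1 / 2) (sqrtTest c a₀ c₀) ≤ 3 := by
  have hol : HolderDom D (1 / 2) (1 / 2) 1 (sqrtTest c a₀ c₀) := by
    refine ⟨fun a b t hab _ _ => ?_, fun s c' d hcd _ _ => ?_, fun a b c' d hab hcd _ _ => ?_⟩
    · rw [one_mul]
      refine le_trans (le_of_eq ?_) (abs_sqrt_abs_sub_le (e := a₀) hab)
      congr 1
      simp only [sqrtTest]; ring
    · rw [one_mul]
      refine le_trans (le_of_eq ?_) (abs_sqrt_abs_sub_le (e := c₀) hcd)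
      congr 1
      simp only [sqrtTest]; ring
    · rw [show rectIncr (sqrtTest c a₀ c₀) a b c' d = 0 by
        simp only [rectIncr, sqrtTest]; ring, abs_zero, one_mul]
      exact mul_nonneg (Real.rpow_nonneg (by linarith) _) (Real.rpow_nonneg (by linarith) _)
  have hc : Continuous (sqrtTest c a₀ c₀) := by unfold sqrtTest; fun_prop
  exact ⟨hol.memH hD hc.continuousOn, by simpa using hol.hNorm_le hD⟩

/-- The semi-norms do not see constants, so `sqrtTest c _ _` has norm at most `3` for every `c`,
while at distances `α ^ 2` and `β ^ 2` from its base point it takes the value `c + α + β`. The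
growth condition bounds first and second differences of `σ` by `12 * C` times `α` and `α * β`,
uniformly in `c`, where `12 = 3 * (1 + 3)`. Difference quotients then bound `σ'` and `σ''`. -/
theorem HypL.exists_regFun {D : Set (ℝ × ℝ)} {R : ℝ} {σ : ℝ → ℝ} (hD : LowerDomain D R)
    (hσ : HypL D σ) {M : ℝ} (hM : ∀ r, |σ r| ≤ M) {p : ℝ × ℝ} (hp : p ∈ D) (hp0 : 0 < p.1 + p.2) :
    ∃ B, RegFun B σ := by
  have half : (1 / 2 : ℝ) ∈ Ioo (0 : ℝ) 1 := by norm_num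
  obtain ⟨C, hC, hg⟩ := hσ.growth _ half _ half
  -- The base point `(p.1 - r, p.2 - r)` lies on the antidiagonal, so the square of side `r` with
  -- upper right corner `p` is contained in `D` and leaves room for `α, β ≤ √r`.
  set r := (p.1 + p.2) / 2 with hr
  have hr0 : 0 < r := by positivity
  set N := C * 12 with hN
  have hol : ∀ c, HolderDom D (1 / 2) (1 / 2) N (σ ∘ sqrtTest c (p.1 - r) (p.2 - r)) := by
    intro c
    obtain ⟨h1, h2⟩ := memH_sqrtTest hD c (p.1 - r) (p.2 - r)
    refine holderDom_of_hNorm_le hD half.1 half.1 (by positivity) ((hg _ h1).trans ?_)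
    rw [hN, ENNReal.ofReal_mul hC.le, mul_assoc]
    refine mul_le_mul_right ((mul_le_mul' h2 (add_le_add_right h2 1)).trans (le_of_eq ?_)) _
    rw [ENNReal.ofReal_ofNat]; norm_num
  have hval : ∀ c α β, 0 ≤ α → 0 ≤ β →
      sqrtTest c (p.1 - r) (p.2 - r) (p.1 - r + α ^ 2, p.2 - r + β ^ 2) = c + α + β := by
    intro c α β hα hβ
    simp [sqrtTest, Real.sqrt_sq, hα, hβ]
  have hsq : ∀ α, 0 ≤ α → α ≤ √r → α ^ 2 ≤ r := fun α h0 h => (Real.le_sqrt h0 hr0.le).1 h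
  have hpow : ∀ α : ℝ, 0 ≤ α → (α ^ 2) ^ (1 / 2 : ℝ) = α := fun α h => by
    rw [← Real.sqrt_eq_rpow, Real.sqrt_sq h]
  have hbase : p.1 - r + (p.2 - r) = 0 := by rw [hr]; ring
  have first : ∀ c α, 0 < α → α ≤ √r → |σ (c + α) - σ c| ≤ N * α := by
    intro c α h0 h
    have mem : ∀ w, 0 ≤ w → w ≤ r → (p.1 - r + w, p.2 - r) ∈ D := fun w w0 w1 =>
      hD.lower _ _ _ _ hp (by linarith) (by linarith) (by linarith)
    have := (hol c).fst (p.1 - r) (p.1 - r + α ^ 2) (p.2 - r) (by nlinarith)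
      (by simpa using mem 0 le_rfl hr0.le) (mem _ (sq_nonneg _) (hsq α h0.le h))
    have v1 := hval c α 0 h0.le le_rfl
    have v0 := hval c 0 0 le_rfl le_rfl
    simp only [ne_eq, OfNat.ofNat_ne_zero, not_false_eq_true, zero_pow, add_zero] at v0 v1
    rwa [Function.comp_apply, Function.comp_apply, v0, v1, add_sub_cancel_left,
      hpow α h0.le] at this
  have second : ∀ c α β, 0 < α → α ≤ √r → 0 < β → β ≤ √r →
      |σ (c + α + β) - σ (c + α) - (σ (c + β) - σ c)| ≤ N * β * α := by
    intro c α β h0 h k0 k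
    have := (hol c).rect (p.1 - r) (p.1 - r + α ^ 2) (p.2 - r) (p.2 - r + β ^ 2) (by nlinarith)
      (by nlinarith) hbase.ge (hD.lower _ _ _ _ hp (by linarith [hsq α h0.le h])
        (by linarith [hsq β k0.le k]) (by nlinarith))
    have v0 := hval c 0 0 le_rfl le_rfl
    have v1 := hval c α 0 h0.le le_rfl
    have v2 := hval c 0 β le_rfl k0.le
    have v3 := hval c α β h0.le k0.le
    simp only [ne_eq, OfNat.ofNat_ne_zero, not_false_eq_true, zero_pow, add_zero] at v0 v1 v2
    simp only [rectIncr, Function.comp_apply, v0, v1, v2, v3, add_sub_cancel_left, hpow α h0.le,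
      hpow β k0.le] at this
    calc _ = |σ c - σ (c + β) - σ (c + α) + σ (c + α + β)| := by congr 1; ring
      _ ≤ N * α * β := this
      _ = N * β * α := by ring
  have hs := hσ.smooth
  have d1 : Differentiable ℝ σ := hs.differentiable (by norm_num)
  have d2 : Differentiable ℝ (deriv σ) := by
    have : ContDiff ℝ 1 (deriv σ) :=
      ((contDiff_succ_iff_deriv (n := 1)).1 (hs.of_le (by norm_num))).2.2
    exact this.differentiable (by norm_num)
  have hsr : 0 < √r := Real.sqrt_pos.2 hr0
  have b1 : ∀ c, |deriv σ c| ≤ N := fun c =>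
    abs_hasDerivAt_le (d1 c).hasDerivAt hsr (first c)
  -- Dividing the second difference by `α` bounds the increment of `σ'` over `β` by `N * β`;
  -- dividing by `β` then bounds `σ''`.
  have b2 : ∀ c, |deriv (deriv σ) c| ≤ N := fun c =>
    abs_hasDerivAt_le (d2 c).hasDerivAt hsr fun β k0 k =>
      abs_hasDerivAt_le (g := fun s => σ (s + β) - σ s)
        (((d1 (c + β)).hasDerivAt.comp_add_const c β).sub (d1 c).hasDerivAt) hsr
        fun α h0 h => second c α β h0 h k0 k
  exact ⟨max M N, regFun_of_deriv_le d1 d2 (fun r => (hM r).trans (le_max_left _ _))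
    (fun r => (b1 r).trans (le_max_right _ _)) (fun r => (b2 r).trans (le_max_right _ _))⟩

/-! ### Existence, initial conditions and uniqueness -/

section Solution

variable {D : Set (ℝ × ℝ)} {R κ κ' γ γ' A M X : ℝ} {f x y : ℝ × ℝ → ℝ} {σ : ℝ → ℝ}

lemma IsPrimitive.exists_bound (hD : LowerDomain D R) (hy : IsPrimitive D γ γ' f x y) :
    ∃ C, 0 ≤ C ∧ ∀ u v, (u, v) ∈ D → |y (u, v)| ≤ C * (u + v) ^ (γ + γ') := by
  obtain ⟨C, hC⟩ := hy.bound
  exact ⟨|C|, abs_nonneg C, fun u v h => (hC u v h).trans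
    (mul_le_mul_of_nonneg_right (le_abs_self C) (Real.rpow_nonneg (hD.nonneg _ _ h) _))⟩

lemma IsPrimitive.exists_bound_const (hD : LowerDomain D R) (hγ : 0 ≤ γ + γ')
    (hy : IsPrimitive D γ γ' f x y) : ∃ B, ∀ u v, (u, v) ∈ D → |y (u, v)| ≤ B := by
  obtain ⟨C, hC, h⟩ := hy.exists_bound hD
  refine ⟨C * (2 * R) ^ (γ + γ'), fun u v huv => (h u v huv).trans ?_⟩
  have := hD.bdd _ _ huv
  exact mul_le_mul_of_nonneg_left (Real.rpow_le_rpow (hD.nonneg _ _ huv) (by linarith) hγ) hC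

lemma IsPrimitive.continuousOn (hD : LowerDomain D R) (hκ : 0 < κ) (hκ' : 0 < κ')
    (hγ : 0 < γ + γ') (hA : 0 ≤ A) (hy : IsPrimitive D γ γ' f x y)
    (hol : HolderDom D κ κ' A y) : ContinuousOn y D := by
  obtain ⟨C, hC, h⟩ := hy.exists_bound hD
  exact continuousOn_of_holder hD hκ hκ' hγ hA hC hol h

lemma hasDerivWithinAt_zero_of_rpow {g : ℝ → ℝ} {S : Set ℝ} {s C θ : ℝ} (hθ : 1 < θ)
    (hg : ∀ u ∈ S, |g u| ≤ C * |u - s| ^ θ) (hs : s ∈ S) : HasDerivWithinAt g 0 S s := by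
  have hgs : g s = 0 := by
    have := hg s hs
    rw [sub_self, abs_zero, Real.zero_rpow (by linarith), mul_zero] at this
    exact abs_eq_zero.1 (le_antisymm this (abs_nonneg _))
  rw [hasDerivWithinAt_iff_isLittleO]
  simp only [hgs, sub_zero, smul_zero]
  have e1 : g =O[nhdsWithin s S] fun u => |u - s| ^ θ := by
    refine Asymptotics.IsBigO.of_bound C ?_
    filter_upwards [self_mem_nhdsWithin] with u hu
    rw [Real.norm_eq_abs, Real.norm_of_nonneg (Real.rpow_nonneg (abs_nonneg _) _)]
    exact hg u hu
  refine e1.trans_isLittleO ?_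
  have t : Filter.Tendsto (fun u : ℝ => |u - s|) (nhdsWithin s S) (nhds 0) := by
    have : Continuous fun u : ℝ => |u - s| := by fun_prop
    simpa using (this.tendsto s).mono_left nhdsWithin_le_nhds
  have t2 : Filter.Tendsto (fun u : ℝ => |u - s| ^ (θ - 1)) (nhdsWithin s S) (nhds 0) := by
    have := t.rpow_const (p := θ - 1) (Or.inr (by linarith))
    rwa [Real.zero_rpow (by linarith)] at this
  have e2 : (fun u : ℝ => |u - s| ^ (θ - 1) * (u - s)) =o[nhdsWithin s S] fun u => u - s := by
    simpa using ((Asymptotics.isLittleO_one_iff ℝ).2 t2).mul_isBigO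
      (Asymptotics.isBigO_refl (fun u : ℝ => u - s) (nhdsWithin s S))
  refine e2.norm_left.congr_left fun u => ?_
  rw [norm_mul, Real.norm_of_nonneg (Real.rpow_nonneg (abs_nonneg _) _), Real.norm_eq_abs]
  rcases (abs_nonneg (u - s)).eq_or_lt with h | h
  · rw [← h, mul_zero, Real.zero_rpow (by linarith)]
  · rw [← Real.rpow_add_one h.ne']; congr 1; ring

/-- The decay has order greater than one, so both partial derivatives at the antidiagonal exist and
are zero, hence opposite. -/
theorem IsPrimitive.initialConditions (hD : LowerDomain D R) (hγ : 1 < γ + γ')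
    (hy : IsPrimitive D γ γ' f x y) : InitialConditions D y := by
  intro s hs
  obtain ⟨C, hC, h⟩ := hy.exists_bound hD
  refine ⟨hy.diag (by linarith) hs (by ring), 0, ?_, ?_⟩
  · refine hasDerivWithinAt_zero_of_rpow hγ (C := C) (fun u hu => ?_) hs
    have := h u (-s) hu
    rwa [← sub_eq_add_neg, ← abs_of_nonneg (show 0 ≤ u - s from hD.nonneg _ _ hu)] at this
  · rw [neg_zero]
    refine hasDerivWithinAt_zero_of_rpow hγ (C := C) (fun v hv => ?_) hs
    have := h s v hv
    rwa [show s + v = v - -s by ring,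
      ← abs_of_nonneg (show 0 ≤ v - -s by linarith [hD.nonneg _ _ hv])] at this

/-- The primitive of `σ ∘ y` is constructed independently of the equation and identified with `y` by
uniqueness of cone integrals; this gives the solution its additivity and its decay. -/
theorem IsSolution.isPrimitive (he : YoungExp κ κ' γ γ') (hD : LowerDomain D R) (hA : 0 ≤ A)
    (hX : 0 ≤ X) (hf : HolderDom D κ κ' A (σ ∘ y)) (hM : ∀ r, |σ r| ≤ M)
    (hx : RectDom D γ γ' X x) (hy : IsSolution D γ γ' σ x y) :
    IsPrimitive D γ γ' (σ ∘ y) x y := by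
  obtain ⟨Y, hY⟩ := exists_primitive he hD hA hX hf hx fun _ _ _ => hM _
  exact hY.congr_right hD fun p hp =>
    (hY.hasConeIntegral he hD hA hX hf (fun _ _ _ => hM _) hx hp).unique (hy p hp)

theorem exists_holderDom_isPrimitive (he : YoungExp (1 / 2) (1 / 2) γ γ') (hD : LowerDomain D R)
    (hX : 0 ≤ X) (hx : RectDom D γ γ' X x) (hσ : HypL D σ) (hM : ∀ r, |σ r| ≤ M) :
    ∃ y A, 0 ≤ A ∧ HolderDom D (1 / 2) (1 / 2) A y ∧ IsPrimitive D γ γ' (σ ∘ y) x y := by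
  have half : (0 : ℝ) < 1 / 2 := by norm_num
  by_cases h : ∃ p ∈ D, 0 < p.1 + p.2
  · obtain ⟨p, hp, hp0⟩ := h
    obtain ⟨B, hB⟩ := hσ.exists_regFun hD hM hp hp0
    obtain ⟨y, A, B₀, hA, hy, hY⟩ := exists_isPrimitive_comp_self he half half
      (by linarith [he.fst]) (by linarith [he.snd]) hD hX hx hσ.smooth hB
    exact ⟨y, A, hA, hy.1, hY⟩
  -- If `D` lies on the antidiagonal there is no room for the test functions of
  -- `HypL.exists_regFun`. Every primitive vanishes there, and zero is a solution.
  · push Not at h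
    have hol : ∀ c : ℝ, HolderDom D (1 / 2) (1 / 2) 0 fun _ => c := fun c =>
      ⟨fun _ _ _ _ _ _ => by simp, fun _ _ _ _ _ _ => by simp,
        fun _ _ _ _ _ _ _ _ => by simp [rectIncr]⟩
    obtain ⟨Y, hY⟩ := exists_primitive he hD le_rfl hX (hol (σ 0)) hx fun _ _ _ => hM _
    refine ⟨fun _ => 0, 0, le_rfl, hol 0, hY.congr_right hD fun p hp => ?_⟩
    exact hY.diag (by linarith [he.sum]) hp
      (le_antisymm (h p hp) (hD.nonneg _ _ hp))

/-- Well-posedness of the equation on a bounded domain that contains the light cones of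
its points. -/
theorem exists_unique_isSolution (hγ : γ ∈ Ioo (1 / 2 : ℝ) 1) (hγ' : γ' ∈ Ioo (1 / 2 : ℝ) 1)
    (hD : LowerDomain D R) (hx : MemC D γ γ' x) (hσ : HypL D σ) (hM : ∀ r, |σ r| ≤ M) :
    ∃ y, IsSolution D γ γ' σ x y ∧ InitialConditions D y ∧
      ∀ κ ∈ Ioo (1 - γ) γ, ∀ κ' ∈ Ioo (1 - γ') γ', MemH D κ κ' y ∧
        ∀ y₂, MemH D κ κ' y₂ → IsSolution D γ γ' σ x y₂ → EqOn y₂ y D := by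
  obtain ⟨g1, g2⟩ := hγ
  obtain ⟨g1', g2'⟩ := hγ'
  have half : (1 / 2 : ℝ) ∈ Ioo (0 : ℝ) 1 := by norm_num
  have hγγ : 1 < γ + γ' := by linarith
  -- Existence uses only the exponents `1 / 2`, admissible for all `γ, γ' > 1 / 2`, so one `y` is
  -- fixed before `κ` and `κ'`. As a primitive it then acquires the exponents `γ, γ'`, which lie
  -- above all admissible `κ, κ'`.
  have he : YoungExp (1 / 2) (1 / 2) γ γ' := ⟨half.1.le, half.1.le, by linarith, by linarith,
    by linarith, by linarith, hγγ⟩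
  obtain ⟨X, hX, hx⟩ := hx.exists_rectDom hD he.γ_pos he.γ'_pos
  obtain ⟨y, A, hA, hy, hY⟩ := exists_holderDom_isPrimitive he hD hX hx hσ hM
  have hyH : MemH D (1 / 2) (1 / 2) y :=
    hy.memH hD (hY.continuousOn hD half.1 half.1 (by linarith) hA hy)
  obtain ⟨A₁, hA₁, hf⟩ := (hσ.preserves _ half _ half y hyH).exists_holderDom hD half.1 half.1
  obtain ⟨A₂, hA₂, hy₁⟩ := hY.holderDom he hD hA₁ hX hf (fun _ _ _ => hM _) hx
  obtain ⟨B₁, hB₁⟩ := hY.exists_bound_const hD (by linarith)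
  refine ⟨y, fun p hp => hY.hasConeIntegral he hD hA₁ hX hf (fun _ _ _ => hM _) hx hp,
    hY.initialConditions hD hγγ, ?_⟩
  rintro κ ⟨k1, k2⟩ κ' ⟨k1', k2'⟩
  have hκ : κ ∈ Ioo (0 : ℝ) 1 := ⟨by linarith, by linarith⟩
  have hκ' : κ' ∈ Ioo (0 : ℝ) 1 := ⟨by linarith, by linarith⟩
  have he' : YoungExp κ κ' γ γ' := ⟨hκ.1.le, hκ'.1.le, by linarith, by linarith, by linarith,
    by linarith, hγγ⟩
  obtain ⟨A₃, hA₃, hy₃⟩ := hy₁.of_exponent_le hD hκ.1.le hκ'.1.le k2.le k2'.le hA₂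
  refine ⟨hy₃.memH hD hyH.1, fun y₂ hy₂ hs => ?_⟩
  obtain ⟨A₄, hA₄, hf₂⟩ := (hσ.preserves _ hκ _ hκ' y₂ hy₂).exists_holderDom hD hκ.1 hκ'.1
  obtain ⟨A₅, hA₅, hy₅⟩ := hy₂.exists_holderDom hD hκ.1 hκ'.1
  have hY₂ := hs.isPrimitive he' hD hA₄ hX hf₂ hM hx
  obtain ⟨B₂, hB₂⟩ := hY₂.exists_bound_const hD (by linarith)
  exact eqOn_of_isPrimitive (A := max A₃ A₅) (B₀ := max B₁ B₂) he' hκ.1 hκ'.1 k2.le k2'.le hD hX hx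
    hσ.smooth
    ⟨hy₅.mono (le_max_right _ _), fun u v h => (hB₂ u v h).trans (le_max_right _ _)⟩
    ⟨hy₃.mono (le_max_left _ _), fun u v h => (hB₁ u v h).trans (le_max_left _ _)⟩ hY₂ hY

end Solution

end YoungWave

end

theorem theorem3p2 (R₁ R₂ T : ℝ) (hR : R₁ < R₂) (hT : 0 < T)
    (γ γ' : ℝ) (hγ : γ ∈ Set.Ioo (1 / 2 : ℝ) 1) (hγ' : γ' ∈ Set.Ioo (1 / 2 : ℝ) 1)
    (x : ℝ × ℝ → ℝ) (hx : YoungWave.MemC (YoungWave.domain R₁ R₂ T) γ γ' x)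
    (σ : ℝ → ℝ) (hσ : YoungWave.HypL (YoungWave.domain R₁ R₂ T) σ)
    (hσb : ∃ M : ℝ, ∀ r : ℝ, |σ r| ≤ M) :
    ∃ y : ℝ × ℝ → ℝ,
      YoungWave.IsSolution (YoungWave.domain R₁ R₂ T) γ γ' σ x y ∧
      YoungWave.InitialConditions (YoungWave.domain R₁ R₂ T) y ∧
      ∀ κ ∈ Set.Ioo (1 - γ) γ, ∀ κ' ∈ Set.Ioo (1 - γ') γ',
        YoungWave.MemH (YoungWave.domain R₁ R₂ T) κ κ' y ∧
        ∀ y₂ : ℝ × ℝ → ℝ, YoungWave.MemH (YoungWave.domain R₁ R₂ T) κ κ' y₂ →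
          YoungWave.IsSolution (YoungWave.domain R₁ R₂ T) γ γ' σ x y₂ →
          Set.EqOn y₂ y (YoungWave.domain R₁ R₂ T) := by
  obtain ⟨M, hM⟩ := hσb
  exact YoungWave.exists_unique_isSolution hγ hγ' (YoungWave.lowerDomain_domain R₁ R₂ T) hx hσ hM
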